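/- **Lemma 3.2.** Let $\Omega\subset\mathbb R^3$ be a bounded polyhedral domain (open, connected, equal to the interior of its closure), let $f\in L^2(\Omega)$ and let $k\ge 1$. Put $P_{-1}=\{0\}$. *Mesh.* Let $\mathcal T_h$ be a finite mesh of $\overline\Omega$ by compact, not necessarily convex, polyhedra $K$ with simply connected interior, each of which is the closure of its interior. The interiors of different polyhedra are disjoint, and $\partial K$ is the union of flat face-polygons $F\in\mathcal F_h$, each the closure of its connected relative interior. Different face-polygons meet only in their relative boundaries. Each $\partial F$ is the union of edges $e\in\mathcal E_h$, which are line segments, and different edges meet at most in common end points. Coplanar adjacent faces and collinear adjacent edges are allowed. *Subdivision.* Each $K$ is subdivided by a conforming (face-to-face) tetrahedral mesh $K=\bigcup T_i$, which induces on each face-polygon $F\subset\partial K$ a conforming triangulation of $F$, such that the following hold. - If two polyhedra share $F$, they induce the same triangulation of $F$. - The end points of the edges $e\subset\partial F$ are vertices of the triangulation of $F$. - Each $F$ is subdivided into more than one triangle. - Each tetrahedron $T_i\subset K$ has at least two face-triangles that are inside $K$, that is, not contained in $\partial K$. For $G=K$ or $G=F$, let $\mathbb V_k(G)$ be the space of continuous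 functions on $G$ that are polynomials of degree at most $k$ on each tetrahedron (respectively triangle) of the subdivision of $G$. *Virtual element space.* Let $\tilde V_h$ be the space of all $\tilde v\in H^1_0(\Omega)\cap C^0(\overline\Omega)$ such that $\tilde v|_e\in P_k(e)$ for every edge $e\in\mathcal E_h$; $\tilde v|_F\in H^1(F)$ and $\Delta_F\tilde v|_F\in P_{k-2}(F)$ for every $F\in\mathcal F_h$; and $\Delta\tilde v|_K\in P_{k-2}(K)$ for every $K\in\mathcal T_h$. Here $\Delta_F$ is the two-dimensional Laplacian on the plane of $F$, and the Laplacians are taken in the weak sense. *Interpolation.* For $\tilde v\in\tilde V_h$ let $v_h=\Pi_h^\nabla\tilde v$ be the function on $\overline\Omega$ with $v_h|_K\in\mathbb V_k(K)$ for all $K$ that satisfies, on each face-polygon $F$, $$v_h=\tilde v\ \text{ on }\partial F,\qquad (\nabla_F(v_h|_F-\tilde v),\nabla_F w_h)_F=0\quad\forall w_h\in\mathbb V_k(F)\cap H^1_0(F),$$ and, on each polyhedron $K$, with the values on $\partial K$ given by the first step, $$(\nabla(v_h-\tilde v),\nabla w_h)_K=0\quad\forall w_h\in\mathbb V_k(K)\cap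 H^1_0(K).$$ Then $\Pi_h^\nabla\tilde v$ exists and is unique for every $\tilde v\in\tilde V_h$, and the stabilizer-free virtual element equation $$\sum_{K\in\mathcal T_h}(\nabla u_h,\nabla v_h)_K=(f,v_h)\qquad\forall\,\tilde v\in\tilde V_h,\ v_h=\Pi_h^\nabla\tilde v,$$ has a unique solution: there are exactly one $\tilde u\in\tilde V_h$ and exactly one $u_h\in\Pi_h^\nabla(\tilde V_h)$ such that $u_h=\Pi_h^\nabla\tilde u$ satisfies the equation. -/

import Mathlib

open MeasureTheory Set
open scoped ContDiff

noncomputable section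

namespace VEM

/-- Euclidean space `ℝⁿ`. -/
abbrev E (n : ℕ) : Type := EuclideanSpace ℝ (Fin n)

/-! ## Polynomials -/

/-- `p ∈ P_d` for an integer `d`; the zero polynomial is in every `P_d`, so `P_{-1} = {0}`. -/
def DegLE {n : ℕ} (d : ℤ) (p : MvPolynomial (Fin n) ℝ) : Prop :=
  p = 0 ∨ (p.totalDegree : ℤ) ≤ d

/-- The polynomial function of `p` on `ℝⁿ`. -/
def polyFun {n : ℕ} (p : MvPolynomial (Fin n) ℝ) (x : E n) : ℝ :=
  MvPolynomial.eval (fun i => x i) p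

/-- `v|_A ∈ P_d(A)`: on `A`, the function `v` is the restriction of a polynomial of total degree
at most `d`. (For `A` in an affine subspace this is the usual `P_d` of that subspace.) -/
def IsPolyOn {n : ℕ} (d : ℤ) (A : Set (E n)) (v : E n → ℝ) : Prop :=
  ∃ p : MvPolynomial (Fin n) ℝ, DegLE d p ∧ ∀ x ∈ A, v x = polyFun p x

/-! ## Weak derivatives on an open set `U ⊆ ℝⁿ` -/

/-- `φ ∈ C_c^∞(U)`. -/
def IsTestFun {n : ℕ} (U : Set (E n)) (φ : E n → ℝ) : Prop :=
  ContDiff ℝ ∞ φ ∧ HasCompactSupport φ ∧ tsupport φ ⊆ U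

/-- `v ∈ L²(U)` has the weak gradient `g ∈ L²(U)ⁿ` on `U`. -/
structure HasWeakGradient {n : ℕ} (U : Set (E n)) (v : E n → ℝ) (g : E n → E n) : Prop where
  memLp_fun : MemLp v 2 (volume.restrict U)
  memLp_grad : MemLp g 2 (volume.restrict U)
  integral_eq : ∀ φ : E n → ℝ, IsTestFun U φ →
    ∫ x in U, v x • gradient φ x = -∫ x in U, φ x • g x

/-- `v ∈ H¹(U)`. -/
def MemH1 {n : ℕ} (U : Set (E n)) (v : E n → ℝ) : Prop :=
  ∃ g, HasWeakGradient U v g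

open Classical in
/-- The weak gradient of `v ∈ H¹(U)`, unique up to null sets (and `0` if `v ∉ H¹(U)`). -/
def weakGradient {n : ℕ} (U : Set (E n)) (v : E n → ℝ) : E n → E n :=
  if h : MemH1 U v then h.choose else 0

/-- `(∇v, ∇w)_U`, for `v, w ∈ H¹(U)`. -/
def gradInner {n : ℕ} (U : Set (E n)) (v w : E n → ℝ) : ℝ :=
  ∫ x in U, inner ℝ (weakGradient U v x) (weakGradient U w x)

/-- `Δ v = q` weakly (in the sense of distributions) on `U`, for `v ∈ H¹(U)`. -/
def HasWeakLaplacian {n : ℕ} (U : Set (E n)) (v q : E n → ℝ) : Prop :=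
  ∀ φ : E n → ℝ, IsTestFun U φ →
    ∫ x in U, inner ℝ (weakGradient U v x) (gradient φ x) = -∫ x in U, q x * φ x

/-- `v ∈ H¹(U)` and `Δ v|_U ∈ P_d(U)`. -/
def HasPolyLaplacian {n : ℕ} (d : ℤ) (U : Set (E n)) (v : E n → ℝ) : Prop :=
  MemH1 U v ∧ ∃ p : MvPolynomial (Fin n) ℝ, DegLE d p ∧ HasWeakLaplacian U v (polyFun p)

/-- `v ∈ C⁰(closure U) ∩ H¹₀(U)`: the function `v` is continuous on the closure of `U`, it is in
`H¹(U)`, and its trace, which is its restriction to the boundary, vanishes. -/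
def MemC0H10 {n : ℕ} (U : Set (E n)) (v : E n → ℝ) : Prop :=
  ContinuousOn v (closure U) ∧ MemH1 U v ∧ ∀ x ∈ frontier U, v x = 0

/-! ## Polyhedral meshes -/

/-- The data of a polyhedral mesh: the (closed) polyhedra `K`, the (closed, flat) face-polygons
`F`, for every face-polygon an isometric parametrization of its plane by `ℝ²`, and the edges, each
given by its two end points. -/
structure MeshData where
  numCells : ℕ
  numFaces : ℕ
  cell : Fin numCells → Set (E 3)
  face : Fin numFaces → Set (E 3)
  chart : Fin numFaces → (E 2 →ᵃⁱ[ℝ] E 3)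
  edges : Finset (Finset (E 3))

namespace MeshData

variable (M : MeshData)

/-- The face-polygon `F`, as a subset of `ℝ²`. -/
def flatFace (j : Fin M.numFaces) : Set (E 2) := M.chart j ⁻¹' M.face j

/-- The relative boundary `∂F` of the face-polygon `F`. -/
def faceBoundary (j : Fin M.numFaces) : Set (E 3) := M.chart j '' frontier (M.flatFace j)

/-- `M` is a polyhedral mesh on the domain `Ω`. Cells and faces need not be convex, and adjacent
faces of a cell may be coplanar. -/
structure IsMesh (Ω : Set (E 3)) : Prop where
  -- every cell is a compact polyhedral body without handles or tunnels
  cell_compact : ∀ i, IsCompact (M.cell i)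
  cell_regular : ∀ i, closure (interior (M.cell i)) = M.cell i
  cell_simplyConnected : ∀ i, IsSimplyConnected (interior (M.cell i))
  -- the boundary of every cell consists of face-polygons
  cell_frontier : ∀ i,
    frontier (M.cell i) = ⋃ j ∈ {j | M.face j ⊆ frontier (M.cell i)}, M.face j
  -- the cells do not overlap and fill the domain
  cell_disjoint : ∀ i i', i ≠ i' → Disjoint (interior (M.cell i)) (interior (M.cell i'))
  cell_cover : (⋃ i, M.cell i) = closure Ω
  -- every face is a compact flat polygonal region with connected relative interior
  face_flat : ∀ j, M.face j ⊆ range (M.chart j)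
  face_compact : ∀ j, IsCompact (M.face j)
  face_regular : ∀ j, closure (interior (M.flatFace j)) = M.flatFace j
  face_connected : ∀ j, IsConnected (interior (M.flatFace j))
  -- every face is a face of some cell, and different faces meet only along their boundaries
  face_of_cell : ∀ j, ∃ i, M.face j ⊆ frontier (M.cell i)
  face_inter : ∀ j j', j ≠ j' → M.face j ∩ M.face j' ⊆ M.faceBoundary j
  -- the edges are line segments which make up the boundaries of the faces and which meet only
  -- at common end points
  edge_card : ∀ e ∈ M.edges, e.card = 2
  edge_inter : ∀ e ∈ M.edges, ∀ e' ∈ M.edges, e ≠ e' →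
    convexHull ℝ (e : Set (E 3)) ∩ convexHull ℝ (e' : Set (E 3)) ⊆ (e : Set (E 3)) ∩ e'
  edge_of_face : ∀ e ∈ M.edges, ∃ j, convexHull ℝ (e : Set (E 3)) ⊆ M.faceBoundary j
  face_boundary : ∀ j, ∀ x ∈ M.faceBoundary j, ∃ e ∈ M.edges,
    convexHull ℝ (e : Set (E 3)) ⊆ M.faceBoundary j ∧ x ∈ convexHull ℝ (e : Set (E 3))

end MeshData

/-! ## Macro-subdivisions -/

/-- The simplicial complex `S` is a finite, purely `n`-dimensional triangulation of `A`. -/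
structure IsTriangulation (n : ℕ) (S : Geometry.SimplicialComplex ℝ (E 3)) (A : Set (E 3)) :
    Prop where
  finite : S.faces.Finite
  pure : ∀ s ∈ S.faces, ∃ t ∈ S.faces, s ⊆ t ∧ t.card = n + 1
  space_eq : S.space = A

/-- Subdivisions of the polyhedra into tetrahedra and of the face-polygons into triangles. -/
structure Subdivision (M : MeshData) where
  tet : Fin M.numCells → Geometry.SimplicialComplex ℝ (E 3)
  tri : Fin M.numFaces → Geometry.SimplicialComplex ℝ (E 3)

/-- The requirements on the subdivisions. -/
structure Subdivision.IsAdmissible {M : MeshData} (S : Subdivision M) : Prop where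
  tet_triangulation : ∀ i, IsTriangulation 3 (S.tet i) (M.cell i)
  tri_triangulation : ∀ j, IsTriangulation 2 (S.tri j) (M.face j)
  -- on a face of a polyhedron, the tetrahedra induce the triangulation of the face (so the two
  -- polyhedra that share a face induce the same subdivision of it)
  compatible : ∀ i j, M.face j ⊆ frontier (M.cell i) → ∀ s : Finset (E 3),
    s ∈ (S.tri j).faces ↔ s ∈ (S.tet i).faces ∧ convexHull ℝ (s : Set (E 3)) ⊆ M.face j
  -- the vertices of a polygon are vertices of its triangulation
  vertices : ∀ j, ∀ e ∈ M.edges, convexHull ℝ (e : Set (E 3)) ⊆ M.faceBoundary j →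
    ∀ x ∈ e, {x} ∈ (S.tri j).faces
  -- every face-polygon is subdivided into more than one triangle
  two_triangles : ∀ j, ∃ s ∈ (S.tri j).faces, ∃ t ∈ (S.tri j).faces,
    s ≠ t ∧ s.card = 3 ∧ t.card = 3
  -- every tetrahedron has at least two face-triangles inside the polyhedron
  two_interior_faces : ∀ i, ∀ T ∈ (S.tet i).faces, T.card = 4 →
    ∃ s t : Finset (E 3), s ⊆ T ∧ t ⊆ T ∧ s ≠ t ∧ s.card = 3 ∧ t.card = 3 ∧
      ¬ convexHull ℝ (s : Set (E 3)) ⊆ frontier (M.cell i) ∧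
      ¬ convexHull ℝ (t : Set (E 3)) ⊆ frontier (M.cell i)

/-- `w ∈ 𝕍_k`: `w` is continuous on the triangulated set, and in `P_k` on every simplex. -/
def MacroPk (k : ℕ) (S : Geometry.SimplicialComplex ℝ (E 3)) (w : E 3 → ℝ) : Prop :=
  ContinuousOn w S.space ∧ ∀ s ∈ S.faces, IsPolyOn k (convexHull ℝ (s : Set (E 3))) w

/-! ## The stabilizer-free virtual element method

Functions on the closure of `Ω` are represented by functions on `ℝ³` that vanish outside it. -/

/-- The virtual element space `Ṽ_h`. -/
structure VirtualSpace (Ω : Set (E 3)) (M : MeshData) (k : ℕ) (v : E 3 → ℝ) : Prop where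
  eq_zero : ∀ x ∉ closure Ω, v x = 0
  memH10 : MemC0H10 Ω v
  -- `v|_e ∈ P_k(e)`
  edge : ∀ e ∈ M.edges, IsPolyOn k (convexHull ℝ (e : Set (E 3))) v
  -- `Δ_F v|_F ∈ P_{k-2}(F)`
  face : ∀ j, HasPolyLaplacian ((k : ℤ) - 2) (interior (M.flatFace j)) (v ∘ M.chart j)
  -- `Δ v|_K ∈ P_{k-2}(K)`
  cell : ∀ i, HasPolyLaplacian ((k : ℤ) - 2) (interior (M.cell i)) v

/-- `vh = Π_h^∇ v`, the two-step interpolation. -/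
structure IsInterp (Ω : Set (E 3)) {M : MeshData} (S : Subdivision M) (k : ℕ)
    (v vh : E 3 → ℝ) : Prop where
  eq_zero : ∀ x ∉ closure Ω, vh x = 0
  -- `vh|_K ∈ 𝕍_k(K)`; in particular `vh|_F ∈ 𝕍_k(F)`
  macroPk : ∀ i, MacroPk k (S.tet i) vh
  -- first step: the 2D projection on every face-polygon
  face_boundary : ∀ j, ∀ x ∈ M.faceBoundary j, vh x = v x
  face_proj : ∀ j, ∀ w : E 3 → ℝ, MacroPk k (S.tri j) w → (∀ x ∈ M.faceBoundary j, w x = 0) →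
    gradInner (interior (M.flatFace j)) ((vh - v) ∘ M.chart j) (w ∘ M.chart j) = 0
  -- second step: the 3D projection on every polyhedron, given the values on its faces
  cell_proj : ∀ i, ∀ w : E 3 → ℝ, MacroPk k (S.tet i) w → (∀ x ∈ frontier (M.cell i), w x = 0) →
    gradInner (interior (M.cell i)) (vh - v) w = 0

/-- `(∇u, ∇v)_h`, the sum of `(∇u, ∇v)_K` over the polyhedra `K`. -/
def brokenInner (M : MeshData) (u v : E 3 → ℝ) : ℝ :=
  ∑ i, gradInner (interior (M.cell i)) u v

/-- `u ∈ Ṽ_h` and `uh = Π_h^∇ u` solve the stabilizer-free virtual element equation with right-hand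
side `f`. -/
structure IsSolution (Ω : Set (E 3)) {M : MeshData} (S : Subdivision M) (k : ℕ)
    (f : E 3 → ℝ) (u uh : E 3 → ℝ) : Prop where
  mem : VirtualSpace Ω M k u
  interp : IsInterp Ω S k u uh
  eqn : ∀ v vh : E 3 → ℝ, VirtualSpace Ω M k v → IsInterp Ω S k v vh →
    brokenInner M uh vh = ∫ x in Ω, f x * vh x

end VEM

end

noncomputable section
namespace VEM

/-! ## Weak gradients -/

variable {n : ℕ} {U : Set (E n)}

/-! Everything rests on one implication, `eq_zero_of_interp_const`: a virtual function whose
interpolant is constant on the closure of Ω is zero. Since the interpolation is linear and lands in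
a finite-dimensional space of piecewise polynomials, this makes the virtual space
finite-dimensional. It also makes the energy of the interpolant definite. If that energy vanishes,
the interpolant is constant on each tetrahedron, hence takes finitely many values, hence is constant
on the connected closure of Ω. A definite bilinear form on a finite-dimensional space represents
every functional exactly once (`existsUnique_of_definite`).

The implication is proved first on faces, then on cells, by the same argument
(`Patch.eq_zero_of_projection_eq_zero`). After subtracting the constant, v has zero boundary values,
zero projection and Laplacian p of degree at most k - 2. Let a, b be the ends of an edge of the
subdivision that meets the interior, with hat functions λ_a, λ_b. Then p λ_a λ_b is an admissible
test function of degree at most k that vanishes on the boundary. Green's formula gives ∫ p² λ_a λ_b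
= 0, so p = 0. Now v is weakly harmonic with zero boundary values, so it vanishes by the maximum
principle. Finally the constant is zero because v vanishes on the boundary of Ω.

The interior edge is where the conditions on the subdivision enter. On a face, two triangles and a
connected interior suffice (`Patch.exists_interior_face`). On a cell the argument is topological
(`Patch.exists_interior_edge`). Without an interior edge, the incidence graph of tetrahedra and
interior triangles has no leaves, hence has a cycle. A circle-valued map that winds once along this
cycle would lift to a real function on the simply connected interior, which is absurd.

The interpolant exists because compatible polynomial data on a subcomplex extend to the full complex
(`exists_macroPk_extension`, by Bernstein coefficients), after which an elliptic projection corrects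
the interior values. No regularity of the boundaries is available, so traces are avoided: vanishing
boundary values are pointwise, the maximum principle is proved by mollification, and Green's formula
by truncating the test function near zero. -/

lemma IsTestFun.continuous_gradient {φ : E n → ℝ} (h : IsTestFun U φ) :
    Continuous (gradient φ) := by
  have := h.1.continuous_fderiv (by simp)
  exact (InnerProductSpace.toDual ℝ (E n)).symm.continuous.comp this

lemma IsTestFun.hasCompactSupport_gradient {φ : E n → ℝ} (h : IsTestFun U φ) :
    HasCompactSupport (gradient φ) := by
  have := h.2.1.fderiv (𝕜 := ℝ)
  exact this.comp_left (g := (InnerProductSpace.toDual ℝ (E n)).symm) (map_zero _)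

lemma IsTestFun.eq_zero {φ : E n → ℝ} (h : IsTestFun U φ) {x : E n} (hx : x ∉ U) : φ x = 0 := by
  by_contra h0
  exact hx (h.2.2 (subset_tsupport _ h0))

lemma IsTestFun.memLp {φ : E n → ℝ} (h : IsTestFun U φ) (p : ENNReal) :
    MemLp φ p (volume.restrict U) :=
  (h.1.continuous.memLp_of_hasCompactSupport h.2.1).restrict U

lemma IsTestFun.memLp_gradient {φ : E n → ℝ} (h : IsTestFun U φ) (p : ENNReal) :
    MemLp (gradient φ) p (volume.restrict U) :=
  (h.continuous_gradient.memLp_of_hasCompactSupport h.hasCompactSupport_gradient).restrict U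

lemma integrable_smul_of_memLp {F : Type*} [NormedAddCommGroup F] [NormedSpace ℝ F]
    {α : Type*} [MeasurableSpace α] {μ : Measure α}
    {f : α → ℝ} {g : α → F} (hf : MemLp f 2 μ) (hg : MemLp g 2 μ) :
    Integrable (fun x => f x • g x) μ := by
  have : MemLp (fun x => f x • g x) 1 μ := hg.smul hf
  exact memLp_one_iff_integrable.1 this

lemma integrable_inner_of_memLp {F : Type*} [NormedAddCommGroup F] [InnerProductSpace ℝ F]
    {α : Type*} [MeasurableSpace α] {μ : Measure α}
    {f g : α → F} (hf : MemLp f 2 μ) (hg : MemLp g 2 μ) :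
    Integrable (fun x => inner ℝ (f x) (g x)) μ := by
  refine (L2.integrable_inner (𝕜 := ℝ) (hf.toLp f) (hg.toLp g)).congr ?_
  filter_upwards [hf.coeFn_toLp, hg.coeFn_toLp] with x h1 h2
  rw [h1, h2]

namespace HasWeakGradient

variable {v w : E n → ℝ} {g h : E n → E n}

lemma congr_fun (hv : HasWeakGradient U v g) (hU : MeasurableSet U) (hvw : ∀ x ∈ U, v x = w x) :
    HasWeakGradient U w g := by
  have hae : v =ᵐ[volume.restrict U] w := by
    filter_upwards [ae_restrict_mem hU] with x hx using hvw x hx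
  refine ⟨hv.1.ae_eq hae, hv.2, fun φ hφ => ?_⟩
  rw [← hv.3 φ hφ]
  refine integral_congr_ae ?_
  filter_upwards [hae] with x hx
  rw [hx]

lemma add (hv : HasWeakGradient U v g) (hw : HasWeakGradient U w h) :
    HasWeakGradient U (v + w) (g + h) := by
  refine ⟨hv.1.add hw.1, hv.2.add hw.2, fun φ hφ => ?_⟩
  simp only [Pi.add_apply, add_smul, smul_add]
  rw [integral_add, integral_add, hv.3 φ hφ, hw.3 φ hφ, neg_add]
  · exact integrable_smul_of_memLp (hφ.memLp 2) hv.2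
  · exact integrable_smul_of_memLp (hφ.memLp 2) hw.2
  · exact integrable_smul_of_memLp hv.1 (hφ.memLp_gradient 2)
  · exact integrable_smul_of_memLp hw.1 (hφ.memLp_gradient 2)

lemma smul (hv : HasWeakGradient U v g) (r : ℝ) : HasWeakGradient U (r • v) (r • g) := by
  refine ⟨hv.1.const_smul r, hv.2.const_smul r, fun φ hφ => ?_⟩
  have h1 : ∀ x, (r • v) x • gradient φ x = r • (v x • gradient φ x) := fun x => by
    simp [smul_smul]
  have h2 : ∀ x, φ x • (r • g) x = r • (φ x • g x) := fun x => by
    simp [smul_smul, mul_comm]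
  simp only [h1, h2, integral_smul, hv.3 φ hφ, smul_neg]

lemma sub (hv : HasWeakGradient U v g) (hw : HasWeakGradient U w h) :
    HasWeakGradient U (v - w) (g - h) := by
  have := hv.add (hw.smul (-1))
  simpa [sub_eq_add_neg] using this

/-- The difference of the two fields integrates to zero against every test function, so the
fundamental lemma of the calculus of variations applies. -/
lemma ae_eq (hU : IsOpen U) (hv : HasWeakGradient U v g) (hv' : HasWeakGradient U v h) :
    g =ᵐ[volume.restrict U] h := by
  have hL : LocallyIntegrableOn (g - h) U volume := by
    have := (hv.2.sub hv'.2).locallyIntegrable (by norm_num)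
    exact locallyIntegrableOn_of_locallyIntegrable_restrict this
  have := hU.ae_eq_zero_of_integral_contDiff_smul_eq_zero (μ := volume) hL ?_
  · rw [Filter.EventuallyEq, ae_restrict_iff' hU.measurableSet]
    filter_upwards [this] with x hx hxU
    simpa [sub_eq_zero] using hx hxU
  · intro φ h1 h2 h3
    have hφ : IsTestFun U φ := ⟨h1, h2, h3⟩
    have e1 := hv.3 φ hφ
    rw [hv'.3 φ hφ, neg_inj] at e1
    have : ∫ x in U, φ x • (g - h) x = 0 := by
      simp only [Pi.sub_apply, smul_sub]
      rw [integral_sub, e1, sub_self]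
      · exact integrable_smul_of_memLp (hφ.memLp 2) hv.2
      · exact integrable_smul_of_memLp (hφ.memLp 2) hv'.2
    rw [← this]
    refine (setIntegral_eq_integral_of_forall_compl_eq_zero fun x hx => ?_).symm
    rw [hφ.eq_zero hx, zero_smul]

lemma memH1 (hv : HasWeakGradient U v g) : MemH1 U v := ⟨g, hv⟩

end HasWeakGradient

lemma MemH1.hasWeakGradient {v : E n → ℝ} (h : MemH1 U v) :
    HasWeakGradient U v (weakGradient U v) := by
  rw [weakGradient, dif_pos h]
  exact h.choose_spec

lemma HasWeakGradient.weakGradient_ae_eq {v : E n → ℝ} {g : E n → E n} (hU : IsOpen U)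
    (h : HasWeakGradient U v g) : weakGradient U v =ᵐ[volume.restrict U] g :=
  h.memH1.hasWeakGradient.ae_eq hU h

lemma MemH1.add {v w : E n → ℝ} (hv : MemH1 U v) (hw : MemH1 U w) : MemH1 U (v + w) :=
  (hv.hasWeakGradient.add hw.hasWeakGradient).memH1

lemma MemH1.sub {v w : E n → ℝ} (hv : MemH1 U v) (hw : MemH1 U w) : MemH1 U (v - w) :=
  (hv.hasWeakGradient.sub hw.hasWeakGradient).memH1

lemma MemH1.smul {v : E n → ℝ} (hv : MemH1 U v) (r : ℝ) : MemH1 U (r • v) :=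
  (hv.hasWeakGradient.smul r).memH1

/-- `weakGradient` is an arbitrary choice, so all computations with `gradInner` pass through this
freedom to use any other weak gradient. -/
lemma gradInner_eq (hU : IsOpen U) {v w : E n → ℝ} {g h : E n → E n}
    (hv : HasWeakGradient U v g) (hw : HasWeakGradient U w h) :
    gradInner U v w = ∫ x in U, inner ℝ (g x) (h x) := by
  refine integral_congr_ae ?_
  filter_upwards [hv.weakGradient_ae_eq hU, hw.weakGradient_ae_eq hU] with x h1 h2
  rw [h1, h2]

lemma gradInner_comm (v w : E n → ℝ) : gradInner U v w = gradInner U w v := by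
  simp only [gradInner, real_inner_comm]

lemma gradInner_add_left (hU : IsOpen U) {u v w : E n → ℝ} (hu : MemH1 U u) (hv : MemH1 U v)
    (hw : MemH1 U w) : gradInner U (u + v) w = gradInner U u w + gradInner U v w := by
  rw [gradInner_eq hU (hu.hasWeakGradient.add hv.hasWeakGradient) hw.hasWeakGradient]
  simp only [Pi.add_apply, inner_add_left]
  exact integral_add (integrable_inner_of_memLp hu.hasWeakGradient.2 hw.hasWeakGradient.2)
    (integrable_inner_of_memLp hv.hasWeakGradient.2 hw.hasWeakGradient.2)

lemma gradInner_smul_left (hU : IsOpen U) {u w : E n → ℝ} (hu : MemH1 U u)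
    (hw : MemH1 U w) (r : ℝ) : gradInner U (r • u) w = r * gradInner U u w := by
  rw [gradInner_eq hU (hu.hasWeakGradient.smul r) hw.hasWeakGradient]
  simp only [Pi.smul_apply, inner_smul_left]
  exact integral_const_mul _ _

lemma gradInner_sub_left (hU : IsOpen U) {u v w : E n → ℝ} (hu : MemH1 U u) (hv : MemH1 U v)
    (hw : MemH1 U w) : gradInner U (u - v) w = gradInner U u w - gradInner U v w := by
  have := gradInner_add_left hU hu (hv.smul (-1)) hw
  rw [gradInner_smul_left hU hv hw] at this
  rw [show u - v = u + (-1 : ℝ) • v by simp [sub_eq_add_neg], this]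
  ring

lemma gradInner_add_right (hU : IsOpen U) {u v w : E n → ℝ} (hu : MemH1 U u) (hv : MemH1 U v)
    (hw : MemH1 U w) : gradInner U w (u + v) = gradInner U w u + gradInner U w v := by
  simp only [gradInner_comm w, gradInner_add_left hU hu hv hw]

lemma gradInner_smul_right (hU : IsOpen U) {u w : E n → ℝ} (hu : MemH1 U u)
    (hw : MemH1 U w) (r : ℝ) : gradInner U w (r • u) = r * gradInner U w u := by
  simp only [gradInner_comm w, gradInner_smul_left hU hu hw]

lemma gradInner_congr_left (hU : IsOpen U) {u v w : E n → ℝ} (hu : MemH1 U u) (hw : MemH1 U w)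
    (h : ∀ x ∈ U, u x = v x) : gradInner U u w = gradInner U v w := by
  rw [gradInner_eq hU hu.hasWeakGradient hw.hasWeakGradient,
    gradInner_eq hU (hu.hasWeakGradient.congr_fun hU.measurableSet h) hw.hasWeakGradient]

lemma gradInner_congr_right (hU : IsOpen U) {u v w : E n → ℝ} (hu : MemH1 U u) (hw : MemH1 U w)
    (h : ∀ x ∈ U, u x = v x) : gradInner U w u = gradInner U w v := by
  simp only [gradInner_comm w, gradInner_congr_left hU hu hw h]

lemma gradInner_self_nonneg (v : E n → ℝ) : 0 ≤ gradInner U v v :=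
  integral_nonneg fun _ => real_inner_self_nonneg

lemma MemH1.weakGradient_ae_eq_zero {v : E n → ℝ} (hv : MemH1 U v) (h : gradInner U v v = 0) :
    weakGradient U v =ᵐ[volume.restrict U] 0 := by
  have h1 := (integral_eq_zero_iff_of_nonneg (fun _ => real_inner_self_nonneg)
    (integrable_inner_of_memLp hv.hasWeakGradient.2 hv.hasWeakGradient.2)).1 h
  filter_upwards [h1] with x hx
  simpa using hx

lemma HasWeakLaplacian.congr {v w q : E n → ℝ} (h : HasWeakLaplacian U v q)
    (hvw : weakGradient U v =ᵐ[volume.restrict U] weakGradient U w) : HasWeakLaplacian U w q := by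
  intro φ hφ
  rw [← h φ hφ]
  refine integral_congr_ae ?_
  filter_upwards [hvw] with x hx
  rw [hx]

lemma HasWeakLaplacian.add {v w p q : E n → ℝ} (hU : IsOpen U)
    (hv : MemH1 U v) (hw : MemH1 U w) (hp : Continuous p) (hq : Continuous q)
    (h : HasWeakLaplacian U v p) (h' : HasWeakLaplacian U w q) :
    HasWeakLaplacian U (v + w) (p + q) := by
  intro φ hφ
  have e : ∫ x in U, inner ℝ (weakGradient U (v + w) x) (gradient φ x) =
      ∫ x in U, (inner ℝ (weakGradient U v x) (gradient φ x) +
        inner ℝ (weakGradient U w x) (gradient φ x)) := by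
    refine integral_congr_ae ?_
    filter_upwards [(hv.hasWeakGradient.add hw.hasWeakGradient).weakGradient_ae_eq hU] with x hx
    rw [hx, Pi.add_apply, inner_add_left]
  rw [e, integral_add, h φ hφ, h' φ hφ]
  · simp only [Pi.add_apply, add_mul]
    rw [integral_add, neg_add]
    · exact ((hp.mul hφ.1.continuous).integrable_of_hasCompactSupport
        hφ.2.1.mul_left).integrableOn
    · exact ((hq.mul hφ.1.continuous).integrable_of_hasCompactSupport
        hφ.2.1.mul_left).integrableOn
  · exact integrable_inner_of_memLp hv.hasWeakGradient.2 (hφ.memLp_gradient 2)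
  · exact integrable_inner_of_memLp hw.hasWeakGradient.2 (hφ.memLp_gradient 2)

lemma HasWeakLaplacian.smul {v q : E n → ℝ} (hU : IsOpen U) (hv : MemH1 U v)
    (h : HasWeakLaplacian U v q) (r : ℝ) : HasWeakLaplacian U (r • v) (r • q) := by
  intro φ hφ
  have e : ∫ x in U, inner ℝ (weakGradient U (r • v) x) (gradient φ x) =
      ∫ x in U, r * inner ℝ (weakGradient U v x) (gradient φ x) := by
    refine integral_congr_ae ?_
    filter_upwards [(hv.hasWeakGradient.smul r).weakGradient_ae_eq hU] with x hx
    rw [hx, Pi.smul_apply, inner_smul_left]; rfl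
  rw [e, integral_const_mul, h φ hφ]
  simp only [Pi.smul_apply, smul_eq_mul, mul_assoc, integral_const_mul]
  ring

end VEM
end

noncomputable section
namespace VEM

/-! ## Piecewise `C¹` functions are Lipschitz and have a weak gradient -/

open Filter Topology in
-- Continuous induction: the set of times at which the bound from 0 holds is closed, and the
-- hypothesis supplies later times arbitrarily close to each of its points. Only "frequently" is
-- asked for, since that is what a pigeonhole over finitely many pieces yields.
lemma abs_sub_le_of_frequently_le {f : ℝ → ℝ} {L : ℝ} (hf : ContinuousOn f (Icc 0 1))
    (h : ∀ t ∈ Ico (0 : ℝ) 1, ∃ᶠ t' in 𝓝[>] t, |f t' - f t| ≤ L * (t' - t)) :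
    |f 1 - f 0| ≤ L := by
  have hcl : IsClosed ({t | |f t - f 0| ≤ L * t} ∩ Icc 0 1) := by
    have : {t | |f t - f 0| ≤ L * t} ∩ Icc (0 : ℝ) 1 =
        Icc 0 1 ∩ (fun t => |f t - f 0| - L * t) ⁻¹' Iic 0 := by
      ext t; simp [and_comm]
    rw [this]
    refine ContinuousOn.preimage_isClosed_of_isClosed ?_ isClosed_Icc isClosed_Iic
    exact ((hf.sub continuousOn_const).abs).sub (by fun_prop)
  have := hcl.Icc_subset_of_forall_exists_gt (by simp) ?_ (right_mem_Icc.2 zero_le_one)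
  · simpa using this
  · rintro t ⟨ht, ht'⟩ y hy
    have h1 : ∀ᶠ t' in 𝓝[>] t, t' ∈ Ioc t y := Ioc_mem_nhdsGT hy
    obtain ⟨t', h2, h3⟩ := ((h t ht').and_eventually h1).exists
    refine ⟨t', ?_, h3⟩
    have ht0 : |f t - f 0| ≤ L * t := ht
    calc |f t' - f 0| ≤ |f t' - f t| + |f t - f 0| := abs_sub_le _ _ _
      _ ≤ L * (t' - t) + L * t := add_le_add h2 ht0
      _ = L * t' := by ring

open Filter Topology in
-- Restrict u to a segment. Just after any time, either the segment stays outside A, where u is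
-- zero, or it returns again and again to one of the finitely many pieces. That piece is closed, so
-- it also contains the current point.
lemma lipschitzWith_of_pieces {n : ℕ} {A : Set (E n)} {u : E n → ℝ} (hu : Continuous u)
    (h0 : ∀ x ∉ A, u x = 0) {I : Set (Set (E n))} (hI : I.Finite) (hA : A = ⋃₀ I)
    (hcl : ∀ C ∈ I, IsClosed C) {L : NNReal} (hL : ∀ C ∈ I, LipschitzOnWith L u C) :
    LipschitzWith L u := by
  refine LipschitzWith.of_dist_le_mul fun y x => ?_
  set γ : ℝ → E n := fun t => AffineMap.lineMap x y t with hγ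
  have hγc : Continuous γ := AffineMap.lineMap_continuous
  have hd : ∀ s t, dist (γ s) (γ t) = |s - t| * dist x y := fun s t => by
    rw [hγ, dist_lineMap_lineMap, Real.dist_eq]
  have hc0 : Continuous (u ∘ γ) := hu.comp hγc
  have key := abs_sub_le_of_frequently_le (f := u ∘ γ) (L := L * dist x y)
    hc0.continuousOn ?_
  · simpa [hγ, Real.dist_eq, dist_comm] using key
  intro t ht
  by_cases hA' : ∀ᶠ t' in 𝓝[>] t, γ t' ∉ A
  · have e : ∀ᶠ t' in 𝓝[>] t, (u ∘ γ) t' = 0 := hA'.mono fun t' h => h0 _ h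
    have e0 : (u ∘ γ) t = 0 := by
      refine tendsto_nhds_unique (f := u ∘ γ) (l := 𝓝[>] t) ?_ ?_
      · exact hc0.continuousAt.tendsto.mono_left nhdsWithin_le_nhds
      · exact tendsto_const_nhds.congr' (e.mono fun t' h => h.symm)
    refine Eventually.frequently ?_
    filter_upwards [e, self_mem_nhdsWithin] with t' h1 h2
    rw [h1, e0, sub_zero, abs_zero]
    have : 0 < t' - t := sub_pos.2 h2
    positivity
  -- Pigeonhole: if each of the finitely many pieces were eventually avoided, so would be their
  -- union A.
  · have : ∃ C ∈ I, ∃ᶠ t' in 𝓝[>] t, γ t' ∈ C := by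
      by_contra! hcon
      refine hA' ?_
      have := (eventually_all_finite hI).2 fun C hC => hcon C hC
      filter_upwards [this] with t' ht' hmem
      rw [hA] at hmem
      obtain ⟨C, hC, hC'⟩ := hmem
      exact ht' C hC hC'
    obtain ⟨C, hC, hf⟩ := this
    have htC : γ t ∈ C := by
      refine (hcl C hC).mem_of_frequently_of_tendsto hf ?_
      exact hγc.continuousAt.tendsto.mono_left nhdsWithin_le_nhds
    refine (hf.and_eventually self_mem_nhdsWithin).mono ?_
    rintro t' ⟨h1, h2⟩
    have := (hL C hC).dist_le_mul _ h1 _ htC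
    rw [hd, Real.dist_eq, abs_of_pos (sub_pos.2 h2)] at this
    simpa [mul_comm, mul_left_comm, mul_assoc] using this

/-- `u` is continuous on the compact set `A`, which is a finite union of compact convex sets, on
each of which `u` coincides with a `C¹` function. -/
structure PiecewiseC1 {n : ℕ} (A : Set (E n)) (u : E n → ℝ) : Prop where
  isCompact : IsCompact A
  continuousOn : ContinuousOn u A
  pieces : ∃ I : Set (Set (E n)), I.Finite ∧ A = ⋃₀ I ∧ ∀ C ∈ I, IsCompact C ∧ Convex ℝ C ∧
    ∃ q : E n → ℝ, ContDiff ℝ 1 q ∧ EqOn u q C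

namespace PiecewiseC1

variable {n : ℕ} {A : Set (E n)} {u : E n → ℝ}

lemma mul_left (hu : PiecewiseC1 A u) {φ : E n → ℝ} (hφ : ContDiff ℝ 1 φ) :
    PiecewiseC1 A (fun x => φ x * u x) := by
  obtain ⟨I, hI, hA, h⟩ := hu.pieces
  refine ⟨hu.isCompact, hφ.continuous.continuousOn.mul hu.continuousOn, I, hI, hA, fun C hC => ?_⟩
  obtain ⟨h1, h2, q, hq, hq'⟩ := h C hC
  exact ⟨h1, h2, _, hφ.mul hq, fun x hx => by simp only [hq' hx]⟩

lemma continuous_indicator (hu : PiecewiseC1 A u) (h0 : ∀ x ∈ frontier A, u x = 0) :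
    Continuous (A.indicator u) :=
  _root_.continuous_indicator h0 (by rw [hu.isCompact.isClosed.closure_eq]; exact hu.continuousOn)

lemma exists_lipschitzOnWith (hu : PiecewiseC1 A u) :
    ∃ L : NNReal, ∃ I : Set (Set (E n)), I.Finite ∧ A = ⋃₀ I ∧ ∀ C ∈ I, IsCompact C ∧ Convex ℝ C ∧
      LipschitzOnWith L u C ∧ ∃ q : E n → ℝ, ContDiff ℝ 1 q ∧ EqOn u q C := by
  obtain ⟨I, hI, hA, h⟩ := hu.pieces
  have : ∀ C : Set (E n), ∃ L : NNReal, C ∈ I → LipschitzOnWith L u C := by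
    intro C
    by_cases hC : C ∈ I
    · obtain ⟨h1, h2, q, hq, hq'⟩ := h C hC
      obtain ⟨L, hL⟩ := hq.contDiffOn.exists_lipschitzOnWith (by simp) h2 h1
      refine ⟨L, fun _ => ?_⟩
      intro x hx y hy
      rw [hq' hx, hq' hy]
      exact hL hx hy
    · exact ⟨0, fun h => absurd h hC⟩
  choose L hL using this
  refine ⟨hI.toFinset.sup L, I, hI, hA, fun C hC => ?_⟩
  obtain ⟨h1, h2, h3⟩ := h C hC
  refine ⟨h1, h2, (hL C hC).weaken ?_, h3⟩
  exact Finset.le_sup (f := L) (hI.mem_toFinset.2 hC)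

lemma exists_lipschitzWith (hu : PiecewiseC1 A u) (h0 : ∀ x ∈ frontier A, u x = 0) :
    ∃ L : NNReal, LipschitzWith L (A.indicator u) := by
  obtain ⟨L, I, hI, hA, h⟩ := hu.exists_lipschitzOnWith
  refine ⟨L, lipschitzWith_of_pieces (hu.continuous_indicator h0)
    (fun x hx => indicator_of_notMem hx _) hI hA (fun C hC => (h C hC).1.isClosed) fun C hC => ?_⟩
  have hCA : C ⊆ A := hA ▸ subset_sUnion_of_mem hC
  intro x hx y hy
  rw [indicator_of_mem (hCA hx), indicator_of_mem (hCA hy)]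
  exact (h C hC).2.2.1 hx hy

open Topology in
-- Frontiers of convex sets are null, so almost every point of A is interior to a piece, and there u
-- coincides locally with a C¹ function.
lemma exists_ae (hu : PiecewiseC1 A u) : ∃ L : NNReal, ∀ᵐ x, x ∈ A →
    x ∈ interior A ∧ DifferentiableAt ℝ u x ∧ ‖fderiv ℝ u x‖ ≤ L := by
  obtain ⟨L, I, hI, hA, h⟩ := hu.exists_lipschitzOnWith
  refine ⟨L, ?_⟩
  have h1 : ∀ᵐ x : E n, ∀ C ∈ I, x ∉ frontier C := by
    refine (ae_ball_iff hI.countable).2 fun C hC => ?_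
    exact measure_eq_zero_iff_ae_notMem.1 ((h C hC).2.1.addHaar_frontier volume)
  filter_upwards [h1] with x hx hxA
  rw [hA] at hxA
  obtain ⟨C, hC, hxC⟩ := hxA
  obtain ⟨c1, c2, c3, q, hq, hq'⟩ := h C hC
  have hxi : x ∈ interior C := by
    by_contra hcon
    exact hx C hC ⟨subset_closure hxC, hcon⟩
  have hCn : C ∈ 𝓝 x := mem_interior_iff_mem_nhds.1 hxi
  have hCA : C ⊆ A := hA ▸ subset_sUnion_of_mem hC
  refine ⟨interior_mono hCA hxi, ?_, ?_⟩
  · exact ((hq.differentiable (by simp)).differentiableAt (x := x)).congr_of_eventuallyEq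
      (Filter.eventuallyEq_of_mem hCn hq')
  · exact norm_fderiv_le_of_lipschitzOn ℝ hCn c3

end PiecewiseC1

lemma integral_lineDeriv_eq_zero {n : ℕ} {ψ : E n → ℝ} {L : NNReal} (h : LipschitzWith L ψ)
    (h' : HasCompactSupport ψ) (e : E n) : ∫ x, lineDeriv ℝ ψ x e = 0 := by
  -- Integration by parts against the constant 1; the direction is -e because the formula reverses
  -- it.
  have := (LipschitzWith.const (α := E n) (1 : ℝ)).integral_lineDeriv_mul_eq (μ := volume)
    h h' (-e)
  simp only [mul_one, neg_neg] at this
  rw [← this]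
  simp [lineDeriv]

lemma norm_gradient {n : ℕ} (u : E n → ℝ) (x : E n) : ‖gradient u x‖ = ‖fderiv ℝ u x‖ := by
  simp [gradient]

lemma inner_gradient {n : ℕ} (u : E n → ℝ) (x e : E n) :
    inner ℝ e (gradient u x) = fderiv ℝ u x e := by
  rw [real_inner_comm, gradient, InnerProductSpace.toDual_symm_apply]

lemma measurable_gradient {n : ℕ} (u : E n → ℝ) : Measurable (gradient u) :=
  (InnerProductSpace.toDual ℝ (E n)).symm.continuous.measurable.comp (measurable_fderiv ℝ u)

namespace PiecewiseC1

variable {n : ℕ} {A : Set (E n)} {u : E n → ℝ}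

lemma memLp (hu : PiecewiseC1 A u) : MemLp u 2 (volume.restrict (interior A)) := by
  obtain ⟨C, hC⟩ := hu.isCompact.exists_bound_of_continuousOn hu.continuousOn
  have : IsFiniteMeasure (volume.restrict (interior A)) :=
    ⟨by simpa using (measure_mono interior_subset).trans_lt hu.isCompact.measure_lt_top⟩
  refine MemLp.of_bound ((hu.continuousOn.mono interior_subset).aestronglyMeasurable
    isOpen_interior.measurableSet) C ?_
  filter_upwards [ae_restrict_mem isOpen_interior.measurableSet] with x hx
  exact hC x (interior_subset hx)

lemma memLp_gradient (hu : PiecewiseC1 A u) :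
    MemLp (gradient u) 2 (volume.restrict (interior A)) := by
  obtain ⟨L, hL⟩ := hu.exists_ae
  have : IsFiniteMeasure (volume.restrict (interior A)) :=
    ⟨by simpa using (measure_mono interior_subset).trans_lt hu.isCompact.measure_lt_top⟩
  refine MemLp.of_bound (measurable_gradient u).aestronglyMeasurable L ?_
  rw [ae_restrict_iff' isOpen_interior.measurableSet]
  filter_upwards [hL] with x hx hxA
  rw [norm_gradient]
  exact (hx (interior_subset hxA)).2.2

/-- A continuous piecewise `C¹` function is in `H¹`, and its weak gradient is the classical one. -/
theorem hasWeakGradient (hu : PiecewiseC1 A u) :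
    HasWeakGradient (interior A) u (gradient u) := by
  refine ⟨hu.memLp, hu.memLp_gradient, fun φ hφ => ?_⟩
  have i1 := integrable_smul_of_memLp hu.memLp (hφ.memLp_gradient 2)
  have i2 := integrable_smul_of_memLp (hφ.memLp 2) hu.memLp_gradient
  refine ext_inner_left ℝ fun e => ?_
  rw [inner_neg_right, ← integral_inner i1, ← integral_inner i2, ← add_eq_zero_iff_eq_neg,
    ← integral_add (i1.const_inner e) (i2.const_inner e)]
  -- The two integrands add up to the derivative of φu along e. Extended by zero, φu is Lipschitz
  -- with compact support, because φ already vanishes on the frontier of A.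
  set ψ : E n → ℝ := A.indicator fun x => φ x * u x with hψ
  have hp : PiecewiseC1 A (fun x => φ x * u x) := hu.mul_left (hφ.1.of_le (by simp))
  obtain ⟨L, hL⟩ := hp.exists_lipschitzWith fun x hx => by
    rw [hφ.eq_zero hx.2, zero_mul]
  have hc : HasCompactSupport ψ :=
    HasCompactSupport.intro hu.isCompact fun x hx => indicator_of_notMem hx _
  rw [← integral_lineDeriv_eq_zero hL hc e, ← integral_indicator isOpen_interior.measurableSet]
  refine integral_congr_ae ?_
  obtain ⟨L', hL'⟩ := hu.exists_ae
  filter_upwards [hL'] with x hx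
  by_cases hxA : x ∈ A
  · obtain ⟨h1, h2, -⟩ := hx hxA
    rw [indicator_of_mem h1]
    have hφd : DifferentiableAt ℝ φ x := (hφ.1.differentiable (by simp)).differentiableAt
    have hd : HasFDerivAt ψ (φ x • fderiv ℝ u x + u x • fderiv ℝ φ x) x := by
      refine (hφd.hasFDerivAt.mul h2.hasFDerivAt).congr_of_eventuallyEq ?_
      filter_upwards [mem_interior_iff_mem_nhds.1 h1] with y hy
      exact indicator_of_mem hy _
    rw [(hd.hasLineDerivAt e).lineDeriv]
    simp only [inner_smul_right, inner_gradient, _root_.add_apply,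
      _root_.smul_apply, smul_eq_mul]
    ring
  · rw [indicator_of_notMem fun h => hxA (interior_subset h)]
    have hd : HasFDerivAt ψ (0 : E n →L[ℝ] ℝ) x := by
      refine (hasFDerivAt_const (0 : ℝ) x).congr_of_eventuallyEq ?_
      filter_upwards [hu.isCompact.isClosed.isOpen_compl.mem_nhds hxA] with y hy
      exact indicator_of_notMem hy _
    rw [(hd.hasLineDerivAt e).lineDeriv]
    simp

lemma memH1 (hu : PiecewiseC1 A u) : MemH1 (interior A) u := hu.hasWeakGradient.memH1

end PiecewiseC1
end VEM
end

noncomputable section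
namespace VEM

/-! ## A maximum principle for weakly harmonic functions -/

open Filter Topology in
-- With a positive second derivative the point would also be a local minimum, so f would be locally
-- constant and its second derivative zero.
lemma second_deriv_nonpos_of_isLocalMax {f f' : ℝ → ℝ} {c t₀ : ℝ} (hm : IsLocalMax f t₀)
    (hf : ∀ t, HasDerivAt f (f' t) t) (hf' : HasDerivAt f' c t₀) : c ≤ 0 := by
  by_contra! hc
  have hd : deriv f = f' := funext fun t => (hf t).deriv
  have hmin : IsLocalMin f t₀ := isLocalMin_of_deriv_deriv_pos (by rw [hd, hf'.deriv]; exact hc)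
    hm.deriv_eq_zero (hf t₀).continuousAt
  have hconst : f =ᶠ[𝓝 t₀] fun _ => f t₀ := by
    filter_upwards [hm, hmin] with t h1 h2 using le_antisymm h1 h2
  have h0 : f' =ᶠ[𝓝 t₀] fun _ => 0 := by
    filter_upwards [hconst.eventuallyEq_nhds] with t ht
    rw [← (hf t).deriv, ht.deriv_eq, deriv_const]
  have := h0.hasDerivAt_iff.1 hf'
  exact hc.ne' (this.unique (hasDerivAt_const t₀ 0))

/-! ### Mollification of weakly differentiable functions -/

open Convolution ContinuousLinearMap

variable {n : ℕ}

/-- The directional derivative of `ρ`. -/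
def dirDeriv (ρ : E n → ℝ) (e : E n) : E n → ℝ := fun x => fderiv ℝ ρ x e

lemma contDiff_dirDeriv {ρ : E n → ℝ} (h : ContDiff ℝ ∞ ρ) (e : E n) :
    ContDiff ℝ ∞ (dirDeriv ρ e) :=
  (h.fderiv_right (m := ∞) (by simp)).clm_apply contDiff_const

lemma tsupport_dirDeriv (ρ : E n → ℝ) (e : E n) : tsupport (dirDeriv ρ e) ⊆ tsupport ρ :=
  tsupport_fderiv_apply_subset ℝ e

lemma hasCompactSupport_dirDeriv {ρ : E n → ℝ} (h : HasCompactSupport ρ) (e : E n) :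
    HasCompactSupport (dirDeriv ρ e) := h.fderiv_apply ℝ e

lemma hasDerivAt_convolution_line {ρ V : E n → ℝ} (h : ContDiff ℝ ∞ ρ) (h' : HasCompactSupport ρ)
    (hV : LocallyIntegrable V) (y e : E n) (t : ℝ) :
    HasDerivAt (fun t : ℝ => (ρ ⋆[lsmul ℝ ℝ, volume] V) (y + t • e))
      ((dirDeriv ρ e ⋆[lsmul ℝ ℝ, volume] V) (y + t • e)) t := by
  have h1 := h'.hasFDerivAt_convolution_left (lsmul ℝ ℝ) (h.of_le (by simp)) hV (y + t • e)
  have h2 : HasDerivAt (fun t : ℝ => y + t • e) e t := by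
    simpa using ((hasDerivAt_id t).smul_const e).const_add y
  have h3 := h1.comp_hasDerivAt t h2
  have hi : ConvolutionExistsAt (fderiv ℝ ρ) V (y + t • e) ((lsmul ℝ ℝ).precompL (E n)) volume :=
    HasCompactSupport.convolutionExists_left _ (h'.fderiv (𝕜 := ℝ))
      (h.continuous_fderiv (by simp)) hV _
  exact h3.congr_deriv (ContinuousLinearMap.integral_apply hi e)

lemma isTestFun_reflect {U : Set (E n)} {ρ : E n → ℝ} (h : ContDiff ℝ ∞ ρ)
    {r : ℝ} (hr : tsupport ρ ⊆ Metric.closedBall 0 r) {y : E n}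
    (hy : Metric.closedBall y r ⊆ U) : IsTestFun U (fun x => ρ (y - x)) := by
  have hs : tsupport (fun x => ρ (y - x)) ⊆ Metric.closedBall y r := by
    refine closure_minimal ?_ Metric.isClosed_closedBall
    intro x hx
    have := hr (subset_tsupport ρ (a := y - x) hx)
    rw [mem_closedBall_zero_iff] at this
    rwa [Metric.mem_closedBall, dist_comm, dist_eq_norm]
  refine ⟨h.comp (contDiff_const.sub contDiff_id), ?_, hs.trans hy⟩
  exact (isCompact_closedBall y r).of_isClosed_subset (isClosed_tsupport _) hs

lemma gradient_reflect {ρ : E n → ℝ} (h : ContDiff ℝ ∞ ρ) (y x e : E n) :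
    inner ℝ e (gradient (fun x => ρ (y - x)) x) = -dirDeriv ρ e (y - x) := by
  have h1 : HasFDerivAt ρ (fderiv ℝ ρ (y - x)) (y - x) :=
    (h.differentiable (by simp)).differentiableAt.hasFDerivAt
  have h2 : HasFDerivAt (fun x => y - x) (-(ContinuousLinearMap.id ℝ (E n))) x := by
    simpa using (hasFDerivAt_id x).const_sub y
  have h3 := h1.comp x h2
  have h4 : fderiv ℝ (fun x => ρ (y - x)) x = _ := h3.fderiv
  rw [inner_gradient, h4]
  simp [dirDeriv]

/-- The reflected kernel x ↦ ρ(y - x) is a test function on U because the ball around y stays in U.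
The sign from the reflection cancels the sign in the definition of the weak gradient. -/
lemma convolution_dirDeriv_eq {U : Set (E n)} {v V : E n → ℝ} {g : E n → E n}
    (hv : HasWeakGradient U v g) (hVv : ∀ x ∈ U, V x = v x) {ρ : E n → ℝ} (h : ContDiff ℝ ∞ ρ)
    {r : ℝ} (hr : tsupport ρ ⊆ Metric.closedBall 0 r) {y : E n}
    (hy : Metric.closedBall y r ⊆ U) (hUm : MeasurableSet U) (e : E n) :
    (dirDeriv ρ e ⋆[lsmul ℝ ℝ, volume] V) y = ∫ x in U, ρ (y - x) * inner ℝ e (g x) := by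
  have hφ := isTestFun_reflect h hr hy
  have hφ' := isTestFun_reflect (contDiff_dirDeriv h e) ((tsupport_dirDeriv ρ e).trans hr) hy
  have e1 := congrArg (inner ℝ e) (hv.3 _ hφ)
  rw [inner_neg_right, ← integral_inner (integrable_smul_of_memLp hv.1 (hφ.memLp_gradient 2)),
    ← integral_inner (integrable_smul_of_memLp (hφ.memLp 2) hv.2)] at e1
  simp only [inner_smul_right, gradient_reflect h] at e1
  rw [convolution_eq_swap]
  simp only [mul_neg, integral_neg, neg_inj] at e1
  rw [← e1, ← setIntegral_eq_integral_of_forall_compl_eq_zero (s := U)]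
  · refine setIntegral_congr_fun hUm fun x hx => ?_
    simp [hVv x hx, mul_comm]
  · intro x hx
    simp [hφ'.eq_zero hx]

/-- One derivative of each pair is moved onto v. What remains is the weak Laplace equation tested
with the reflected kernel: mollification preserves harmonicity where the kernel only sees U. -/
lemma sum_convolution_second_dirDeriv {U : Set (E n)} (hU : IsOpen U) {v V : E n → ℝ}
    (hv : MemH1 U v) (hlap : HasWeakLaplacian U v 0) (hVv : ∀ x ∈ U, V x = v x)
    {ρ : E n → ℝ} (h : ContDiff ℝ ∞ ρ)
    {r : ℝ} (hr : tsupport ρ ⊆ Metric.closedBall 0 r) {y : E n}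
    (hy : Metric.closedBall y r ⊆ U) (b : OrthonormalBasis (Fin n) ℝ (E n)) :
    ∑ i, (dirDeriv (dirDeriv ρ (b i)) (b i) ⋆[lsmul ℝ ℝ, volume] V) y = 0 := by
  have hφ := isTestFun_reflect h hr hy
  have hφ' : ∀ i, IsTestFun U fun x => dirDeriv ρ (b i) (y - x) := fun i =>
    isTestFun_reflect (contDiff_dirDeriv h (b i)) ((tsupport_dirDeriv ρ (b i)).trans hr) hy
  have hg := hv.hasWeakGradient
  have e1 : ∀ i, (dirDeriv (dirDeriv ρ (b i)) (b i) ⋆[lsmul ℝ ℝ, volume] V) y =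
      ∫ x in U, dirDeriv ρ (b i) (y - x) * inner ℝ (b i) (weakGradient U v x) := fun i =>
    convolution_dirDeriv_eq hg hVv (contDiff_dirDeriv h (b i))
      ((tsupport_dirDeriv ρ (b i)).trans hr) hy hU.measurableSet (b i)
  simp only [e1]
  rw [← integral_finsetSum]
  · have := hlap _ hφ
    simp only [Pi.zero_apply, zero_mul, integral_zero, neg_zero] at this
    rw [← neg_zero, ← this, ← integral_neg]
    congr 1
    ext x
    rw [← b.sum_inner_mul_inner, ← Finset.sum_neg_distrib]
    refine Finset.sum_congr rfl fun i _ => ?_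
    rw [gradient_reflect h, real_inner_comm]
    ring
  · intro i _
    have := (integrable_smul_of_memLp ((hφ' i).memLp 2) hg.2).const_inner (𝕜 := ℝ) (b i)
    simpa only [inner_smul_right] using this

open Filter Topology in
-- The classical perturbation proof for a mollified function. If v had a positive value, then a
-- mollification plus a small multiple of ‖x - x0‖² would have a local maximum at a point where the
-- mollification is harmonic, although its Laplacian there is positive.
lemma nonpos_of_weakLaplacian_zero (hn : 0 < n) {U : Set (E n)} (hU : IsOpen U)
    (hUb : Bornology.IsBounded U) {v : E n → ℝ} (hc : ContinuousOn v (closure U))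
    (h0 : ∀ x ∈ frontier U, v x = 0) (hv : MemH1 U v) (hlap : HasWeakLaplacian U v 0) :
    ∀ x ∈ closure U, v x ≤ 0 := by
  set V : E n → ℝ := (closure U).indicator v with hV
  have hK : IsCompact (closure U) := hUb.isCompact_closure
  have hVc : Continuous V := continuous_indicator (fun x hx => h0 x (frontier_closure_subset hx))
    (by simpa using hc)
  have hV0 : ∀ x ∉ U, V x = 0 := by
    intro x hx
    by_cases h : x ∈ closure U
    · rw [hV, indicator_of_mem h]
      exact h0 x ⟨h, by rwa [hU.interior_eq]⟩
    · exact indicator_of_notMem h _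
  have hVv : ∀ x ∈ U, V x = v x := fun x hx => indicator_of_mem (subset_closure hx) _
  have hVs : HasCompactSupport V := HasCompactSupport.intro hK fun x hx =>
    hV0 x fun h => hx (subset_closure h)
  intro x1 hx1
  by_contra! hpos
  obtain ⟨x0, hx0, hmax⟩ := hK.exists_isMaxOn ⟨x1, hx1⟩ hVc.continuousOn
  set M := V x0 with hM
  have hMpos : 0 < M := by
    have := hmax hx1
    have e : V x1 = v x1 := indicator_of_mem hx1 _
    simp only [mem_ofPred_eq, e] at this
    linarith
  obtain ⟨R, hR⟩ := hUb.closure.subset_closedBall x0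
  -- Budget: mollification costs M/8 at each of two points and the quadratic term less than M/4, so
  -- a maximizer of H over the set where V ≥ M/2 still has V > M/2.
  obtain ⟨η, hη, hηR⟩ : ∃ η : ℝ, 0 < η ∧ η * R ^ 2 < M / 4 := by
    refine ⟨M / (8 * (R ^ 2 + 1)), by positivity, ?_⟩
    rw [div_mul_eq_mul_div, div_lt_div_iff₀ (by positivity) (by positivity)]
    nlinarith [sq_nonneg R]
  obtain ⟨δ, hδ, hδV⟩ := Metric.uniformContinuous_iff.1
    (hVc.uniformContinuous_of_tendsto_cocompact (hVs.is_zero_at_infty)) (M / 8) (by positivity)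
  let φ : ContDiffBump (0 : E n) := ⟨δ / 4, δ / 2, by positivity, by linarith⟩
  set ρ : E n → ℝ := φ.normed volume with hρ
  have hρc : ContDiff ℝ ∞ ρ := φ.contDiff_normed
  have hρs : HasCompactSupport ρ := φ.hasCompactSupport_normed
  have hρt : tsupport ρ ⊆ Metric.closedBall 0 (δ / 2) := by
    rw [hρ, φ.tsupport_normed_eq]
  set h : E n → ℝ := ρ ⋆[lsmul ℝ ℝ, volume] V with hh
  have hclose : ∀ x, |h x - V x| ≤ M / 8 := by
    intro x
    rw [← Real.dist_eq]
    refine φ.dist_normed_convolution_le hVc.aestronglyMeasurable fun y hy => (hδV ?_).le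
    exact (Metric.mem_ball.1 hy).trans (by change δ / 2 < δ; linarith)
  have hVli : LocallyIntegrable V := hVc.locallyIntegrable
  have hhc : Continuous h := hρs.continuous_convolution_left _ hρc.continuous hVli
  set H : E n → ℝ := fun x => h x + η * ‖x - x0‖ ^ 2 with hH
  have hHc : Continuous H := by fun_prop
  set C : Set (E n) := closure U ∩ {x | M / 2 ≤ V x} with hC
  have hCc : IsCompact C := hK.inter_right (isClosed_le continuous_const hVc)
  have hx0C : x0 ∈ C := ⟨hx0, by change M / 2 ≤ V x0; linarith⟩
  obtain ⟨y0, hy0, hymax⟩ := hCc.exists_isMaxOn ⟨x0, hx0C⟩ hHc.continuousOn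
  have hy1 : H x0 ≤ H y0 := hymax hx0C
  have hyR : ‖y0 - x0‖ ^ 2 ≤ R ^ 2 := by
    have := hR hy0.1
    rw [mem_closedBall_iff_norm] at this
    gcongr
  have hyV : M / 2 < V y0 := by
    have a1 := abs_le.1 (hclose x0)
    have a2 := abs_le.1 (hclose y0)
    have a3 : η * ‖y0 - x0‖ ^ 2 ≤ η * R ^ 2 := by gcongr
    simp only [hH, sub_self, norm_zero] at hy1
    norm_num at hy1
    linarith
  -- V is zero outside U and varies by less than M/8 over distances below δ, while V y0 > M/2.
  have hballU : Metric.closedBall y0 (δ / 2) ⊆ U := by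
    intro y hy
    by_contra hyU
    have := hδV (a := y) (b := y0) (lt_of_le_of_lt hy (by linarith))
    rw [Real.dist_eq, hV0 y hyU, zero_sub, abs_neg, abs_of_pos (by linarith)] at this
    linarith
  have hloc : IsLocalMax H y0 := by
    have hy0U : y0 ∈ U := hballU (Metric.mem_closedBall_self (by linarith))
    have h1 : ∀ᶠ y in 𝓝 y0, M / 2 < V y := hVc.continuousAt.eventually (lt_mem_nhds hyV)
    filter_upwards [h1, hU.mem_nhds hy0U] with y a1 a2
    exact hymax ⟨subset_closure a2, le_of_lt a1⟩
  let b : OrthonormalBasis (Fin n) ℝ (E n) := EuclideanSpace.basisFun (Fin n) ℝ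
  have hsum := sum_convolution_second_dirDeriv hU hv hlap hVv hρc hρt hballU b
  -- Second derivative test for H along each coordinate line. Summing over the directions kills the
  -- convolution terms and leaves 2nη ≤ 0.
  have hle : ∀ i, (dirDeriv (dirDeriv ρ (b i)) (b i) ⋆[lsmul ℝ ℝ, volume] V) y0 + 2 * η ≤ 0 := by
    intro i
    set e := b i with he
    have hline : ∀ t : ℝ, H (y0 + t • e) =
        h (y0 + t • e) + η * (‖y0 - x0‖ ^ 2 + 2 * t * inner ℝ (y0 - x0) e + t ^ 2) := by
      intro t
      simp only [hH]
      rw [show y0 + t • e - x0 = (y0 - x0) + t • e by abel, norm_add_sq_real, norm_smul,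
        inner_smul_right, he, b.orthonormal.1 i, mul_one, Real.norm_eq_abs, sq_abs]
      ring
    refine second_deriv_nonpos_of_isLocalMax (f := fun t : ℝ => H (y0 + t • e))
      (f' := fun t => (dirDeriv ρ e ⋆[lsmul ℝ ℝ, volume] V) (y0 + t • e) +
        η * (2 * inner ℝ (y0 - x0) e + 2 * t)) (t₀ := 0) ?_ ?_ ?_
    · have hcont : ContinuousAt (fun t : ℝ => y0 + t • e) 0 := by fun_prop
      have : Tendsto (fun t : ℝ => y0 + t • e) (𝓝 0) (𝓝 y0) := by
        simpa using hcont.tendsto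
      have := this.eventually hloc
      refine this.mono fun t ht => ?_
      simpa using ht
    · intro t
      simp only [hline]
      refine (hasDerivAt_convolution_line hρc hρs hVli y0 e t).add (HasDerivAt.const_mul η ?_)
      have h1 := (((hasDerivAt_id t).const_mul 2).mul_const (inner ℝ (y0 - x0) e : ℝ)).const_add
        (‖y0 - x0‖ ^ 2)
      have h2 := h1.add (hasDerivAt_pow 2 t)
      refine h2.congr_deriv ?_
      simp
    · have h1 := hasDerivAt_convolution_line (contDiff_dirDeriv hρc e)
        (hasCompactSupport_dirDeriv hρs e) hVli y0 e 0
      have h2 := (((hasDerivAt_id (0 : ℝ)).const_mul 2).const_add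
        (2 * inner ℝ (y0 - x0) e : ℝ)).const_mul η
      have h3 := h1.add h2
      simp only [zero_smul, add_zero, mul_one] at h3
      rw [mul_comm 2 η]
      exact h3
  have : ∑ i, ((dirDeriv (dirDeriv ρ (b i)) (b i) ⋆[lsmul ℝ ℝ, volume] V) y0 + 2 * η) ≤ 0 :=
    Finset.sum_nonpos fun i _ => hle i
  rw [Finset.sum_add_distrib, hsum] at this
  simp only [Finset.sum_const, Finset.card_univ, Fintype.card_fin, nsmul_eq_mul, zero_add] at this
  have hn' : (0 : ℝ) < n := by exact_mod_cast hn
  nlinarith [mul_pos hn' hη]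

/-- A weakly harmonic function which is continuous up to the boundary and vanishes on the boundary
is zero. -/
theorem eq_zero_of_weakLaplacian_zero (hn : 0 < n) {U : Set (E n)} (hU : IsOpen U)
    (hUb : Bornology.IsBounded U) {v : E n → ℝ} (hc : ContinuousOn v (closure U))
    (h0 : ∀ x ∈ frontier U, v x = 0) (hv : MemH1 U v) (hlap : HasWeakLaplacian U v 0) :
    ∀ x ∈ closure U, v x = 0 := by
  intro x hx
  have h1 := nonpos_of_weakLaplacian_zero hn hU hUb hc h0 hv hlap x hx
  have h2 := nonpos_of_weakLaplacian_zero hn hU hUb (v := (-1 : ℝ) • v) (hc.const_smul (-1 : ℝ))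
    (fun y hy => by simp [h0 y hy]) (hv.smul (-1))
    (by simpa using hlap.smul hU hv (-1)) x hx
  simp only [Pi.smul_apply, smul_eq_mul] at h2
  linarith

/-- A function with zero energy which is continuous up to the boundary and vanishes on the boundary
is zero. -/
theorem eq_zero_of_gradInner_self_eq_zero (hn : 0 < n) {U : Set (E n)} (hU : IsOpen U)
    (hUb : Bornology.IsBounded U) {v : E n → ℝ} (hc : ContinuousOn v (closure U))
    (h0 : ∀ x ∈ frontier U, v x = 0) (hv : MemH1 U v) (h : gradInner U v v = 0) :
    ∀ x ∈ closure U, v x = 0 := by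
  refine eq_zero_of_weakLaplacian_zero hn hU hUb hc h0 hv fun φ _ => ?_
  rw [integral_congr_ae (g := fun _ => (0 : ℝ))]
  · simp
  · filter_upwards [hv.weakGradient_ae_eq_zero h] with x hx
    rw [hx]; simp

end VEM
end

noncomputable section
namespace VEM

/-! ## Green's formula with a continuous piecewise `C¹` function that vanishes on the boundary -/

open Filter Topology Convolution ContinuousLinearMap

variable {n : ℕ}

lemma abs_normed_convolution_le (φ : ContDiffBump (0 : E n)) {w : E n → ℝ} {C : ℝ}
    (hC : ∀ x, |w x| ≤ C) (x : E n) :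
    |(φ.normed volume ⋆[lsmul ℝ ℝ, volume] w) x| ≤ C := by
  have h1 : Integrable (fun t => φ.normed volume t * C) volume := φ.integrable_normed.mul_const C
  have h2 := norm_integral_le_of_norm_le (f := fun t => φ.normed volume t * w (x - t)) h1
    (Eventually.of_forall fun t => by
      rw [norm_mul, Real.norm_eq_abs, Real.norm_eq_abs, abs_of_nonneg (φ.nonneg_normed t)]
      exact mul_le_mul_of_nonneg_left (hC _) (φ.nonneg_normed t))
  rw [integral_mul_const, φ.integral_normed, one_mul] at h2
  simpa [convolution] using h2

lemma abs_lineDeriv_le {z : E n → ℝ} {L : NNReal} (hz : LipschitzWith L z) (x e : E n) :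
    |lineDeriv ℝ z x e| ≤ L * ‖e‖ := by
  have := norm_lineDeriv_le_of_lipschitz ℝ hz (x₀ := x) (v := e)
  simpa using this

/-- Integration by parts for Lipschitz functions, applied to z and the reflected kernel, moves the
derivative from the kernel to z. Hence the mollified gradients inherit the Lipschitz bound of z. -/
lemma fderiv_normed_convolution (φ : ContDiffBump (0 : E n)) {z : E n → ℝ} {L : NNReal}
    (hz : LipschitzWith L z) (x e : E n) :
    fderiv ℝ (φ.normed volume ⋆[lsmul ℝ ℝ, volume] z) x e =
      (φ.normed volume ⋆[lsmul ℝ ℝ, volume] fun y => lineDeriv ℝ z y e) x := by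
  set ρ : E n → ℝ := φ.normed volume with hρ
  have hρc : ContDiff ℝ ∞ ρ := φ.contDiff_normed
  have hρs : HasCompactSupport ρ := φ.hasCompactSupport_normed
  have hd := hasDerivAt_convolution_line hρc hρs hz.continuous.locallyIntegrable x e 0
  have hdiff : DifferentiableAt ℝ (ρ ⋆[lsmul ℝ ℝ, volume] z) x :=
    (hρs.hasFDerivAt_convolution_left (lsmul ℝ ℝ) (hρc.of_le (by simp))
      hz.continuous.locallyIntegrable x).differentiableAt
  have e1 := (hdiff.hasFDerivAt.hasLineDerivAt e).lineDeriv
  rw [← e1, lineDeriv, hd.deriv, zero_smul, add_zero, convolution_eq_swap, convolution_eq_swap]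
  have hφ := isTestFun_reflect (U := univ) hρc (r := φ.rOut) (by rw [hρ, φ.tsupport_normed_eq])
    (y := x) (subset_univ _)
  obtain ⟨L', hL'⟩ := hφ.1.lipschitzWith_of_hasCompactSupport hφ.2.1 (by simp)
  have key := hz.integral_lineDeriv_mul_eq (μ := volume) hL' hφ.2.1 e
  have e2 : ∀ y, lineDeriv ℝ (fun y => ρ (x - y)) y (-e) = dirDeriv ρ e (x - y) := by
    intro y
    have h1 : DifferentiableAt ℝ (fun y => ρ (x - y)) y :=
      (hφ.1.differentiable (by simp)).differentiableAt
    rw [(h1.hasFDerivAt.hasLineDerivAt (-e)).lineDeriv, map_neg, ← inner_gradient,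
      gradient_reflect hρc, neg_neg]
  simp only [e2] at key
  simp only [lsmul_apply, smul_eq_mul]
  rw [← key]
  simp only [mul_comm]

lemma gradient_eq_sum (u : E n → ℝ) (x : E n) :
    gradient u x = ∑ i, fderiv ℝ u x (EuclideanSpace.basisFun (Fin n) ℝ i) •
      EuclideanSpace.basisFun (Fin n) ℝ i := by
  rw [← (EuclideanSpace.basisFun (Fin n) ℝ).sum_repr' (gradient u x)]
  simp only [inner_gradient]

/-- `Q` is the weak divergence of the vector field `G` on `U`. -/
def HasWeakDiv (U : Set (E n)) (G : E n → E n) (Q : E n → ℝ) : Prop :=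
  ∀ φ : E n → ℝ, IsTestFun U φ →
    ∫ x in U, inner ℝ (G x) (gradient φ x) = -∫ x in U, Q x * φ x

/-- Mollifications of z are test functions in U. Their gradients are uniformly bounded and converge
almost everywhere, so dominated convergence passes to the limit on both sides. -/
lemma HasWeakDiv.of_lipschitz {U : Set (E n)} (hU : IsOpen U) (hUb : Bornology.IsBounded U)
    {G : E n → E n} (hG : MemLp G 2 (volume.restrict U)) {Q : E n → ℝ} (hQ : Continuous Q)
    (h : HasWeakDiv U G Q) {z : E n → ℝ} {L : NNReal} (hz : LipschitzWith L z)
    (hzc : HasCompactSupport z) (hzU : tsupport z ⊆ U) :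
    ∫ x in U, inner ℝ (G x) (gradient z x) = -∫ x in U, Q x * z x := by
  have hfin : IsFiniteMeasure (volume.restrict U) := ⟨by simpa using hUb.measure_lt_top⟩
  obtain ⟨δ, hδ, hδU⟩ := hzc.isCompact.exists_cthickening_subset_open hU hzU
  -- The outer radius stays below δ, to keep supports inside U. It is exactly twice the inner
  -- radius, which is the bounded ratio that almost everywhere convergence requires.
  let φ : ℕ → ContDiffBump (0 : E n) := fun m =>
    ⟨δ / 2 * (1 / (m + 1)), δ * (1 / (m + 1)), by positivity, by
      have : (0 : ℝ) < 1 / (m + 1) := by positivity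
      nlinarith⟩
  have hφδ : ∀ m, (φ m).rOut ≤ δ := fun m => by
    change δ * (1 / ((m : ℝ) + 1)) ≤ δ
    refine mul_le_of_le_one_right hδ.le ?_
    rw [div_le_one (by positivity)]
    linarith [(Nat.cast_nonneg m : (0 : ℝ) ≤ m)]
  have hφ0 : Tendsto (fun m => (φ m).rOut) atTop (𝓝 0) := by
    have := (tendsto_one_div_add_atTop_nhds_zero_nat (𝕜 := ℝ)).const_mul δ
    rwa [mul_zero] at this
  have hφr : ∀ᶠ m in atTop, (φ m).rOut ≤ 2 * (φ m).rIn := Eventually.of_forall fun m => by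
    change δ * (1 / ((m : ℝ) + 1)) ≤ 2 * (δ / 2 * (1 / ((m : ℝ) + 1)))
    exact le_of_eq (by ring)
  set ψ : ℕ → E n → ℝ := fun m => (φ m).normed volume ⋆[lsmul ℝ ℝ, volume] z with hψ
  have hψc : ∀ m, ContDiff ℝ ∞ (ψ m) := fun m =>
    (φ m).hasCompactSupport_normed.contDiff_convolution_left _ (φ m).contDiff_normed
      hz.continuous.locallyIntegrable
  have hψs : ∀ m, tsupport (ψ m) ⊆ Metric.cthickening δ (tsupport z) := by
    intro m
    refine closure_minimal ?_ Metric.isClosed_cthickening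
    intro x hx
    by_contra hcon
    have hz0 : ∀ y ∈ Metric.ball x (φ m).rOut, z y = 0 := by
      intro y hy
      by_contra hy0
      refine hcon (Metric.mem_cthickening_of_dist_le x y δ _ (subset_tsupport _ hy0) ?_)
      rw [dist_comm]
      exact (Metric.mem_ball.1 hy).le.trans (hφδ m)
    have hx0 := hz0 x (Metric.mem_ball_self (φ m).rOut_pos)
    refine hx ?_
    rw [hψ]
    dsimp only
    rw [(φ m).normed_convolution_eq_right fun y hy => by rw [hz0 y hy, hx0], hx0]
  have hψt : ∀ m, IsTestFun U (ψ m) := fun m =>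
    ⟨hψc m, hzc.isCompact.cthickening.of_isClosed_subset (isClosed_tsupport _) (hψs m),
      (hψs m).trans hδU⟩
  have hlim1 : Tendsto (fun m => ∫ x in U, inner ℝ (G x) (gradient (ψ m) x)) atTop
      (𝓝 (∫ x in U, inner ℝ (G x) (gradient z x))) := by
    refine tendsto_integral_of_dominated_convergence (fun x => ‖G x‖ * (n * L)) ?_ ?_ ?_ ?_
    · intro m
      exact hG.1.inner (measurable_gradient (ψ m)).aestronglyMeasurable
    · exact (hG.integrable (by norm_num)).norm.mul_const _
    · intro m
      refine Eventually.of_forall fun x => ?_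
      refine (norm_inner_le_norm _ _).trans (mul_le_mul_of_nonneg_left ?_ (norm_nonneg _))
      rw [gradient_eq_sum]
      refine (norm_sum_le _ _).trans ?_
      refine (Finset.sum_le_sum (g := fun _ => (L : ℝ)) fun i _ => ?_).trans (by simp)
      rw [norm_smul, OrthonormalBasis.norm_eq_one, mul_one, fderiv_normed_convolution _ hz,
        Real.norm_eq_abs]
      refine abs_normed_convolution_le _ (fun y => ?_) x
      have := abs_lineDeriv_le hz y (EuclideanSpace.basisFun (Fin n) ℝ i)
      rwa [OrthonormalBasis.norm_eq_one, mul_one] at this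
    · refine ae_restrict_of_ae ?_
      have h1 : ∀ᵐ x : E n, ∀ i, Tendsto (fun m => fderiv ℝ (ψ m) x
          (EuclideanSpace.basisFun (Fin n) ℝ i)) atTop
          (𝓝 (lineDeriv ℝ z x (EuclideanSpace.basisFun (Fin n) ℝ i))) := by
        refine ae_all_iff.2 fun i => ?_
        filter_upwards [ContDiffBump.ae_convolution_tendsto_right_of_locallyIntegrable hφ0 hφr
          (hz.locallyIntegrable_lineDeriv (μ := volume) (EuclideanSpace.basisFun (Fin n) ℝ i))]
          with x hx
        refine hx.congr fun m => ?_
        rw [fderiv_normed_convolution _ hz]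
      filter_upwards [h1, hz.ae_differentiableAt] with x hx hdx
      refine tendsto_const_nhds.inner ?_
      simp only [gradient_eq_sum]
      refine tendsto_finsetSum _ fun i _ => Tendsto.smul_const ?_ _
      have := hx i
      rwa [(hdx.hasFDerivAt.hasLineDerivAt _).lineDeriv] at this
  obtain ⟨C, hC⟩ := hzc.exists_bound_of_continuous hz.continuous
  have hQi : IntegrableOn Q U := by
    have hK : IsCompact (closure U) := hUb.isCompact_closure
    exact (hQ.continuousOn.integrableOn_compact hK).mono_set subset_closure
  have hlim2 : Tendsto (fun m => -∫ x in U, Q x * ψ m x) atTop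
      (𝓝 (-∫ x in U, Q x * z x)) := by
    refine Tendsto.neg (tendsto_integral_of_dominated_convergence (fun x => ‖Q x‖ * C) ?_ ?_ ?_ ?_)
    · intro m
      exact (hQ.mul (hψc m).continuous).aestronglyMeasurable
    · exact hQi.norm.mul_const _
    · intro m
      refine Eventually.of_forall fun x => ?_
      rw [norm_mul]
      exact mul_le_mul_of_nonneg_left (abs_normed_convolution_le _ hC x) (norm_nonneg _)
    · refine Eventually.of_forall fun x => Tendsto.const_mul _ ?_
      exact ContDiffBump.convolution_tendsto_right_of_continuous hφ0 hz.continuous x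
  refine tendsto_nhds_unique hlim1 (hlim2.congr fun m => ?_)
  rw [h _ (hψt m)]

/-- Truncation near zero. -/
def truncate (ε t : ℝ) : ℝ := t - max (-ε) (min ε t)

lemma truncate_of_abs_le {ε t : ℝ} (h : |t| ≤ ε) : truncate ε t = 0 := by
  have := abs_le.1 h
  rw [truncate, min_eq_right this.2, max_eq_right this.1, sub_self]

lemma abs_truncate_sub_le {ε : ℝ} (hε : 0 ≤ ε) (t : ℝ) : |truncate ε t - t| ≤ ε := by
  rw [truncate, sub_sub_cancel_left, abs_neg, abs_le]
  exact ⟨le_max_left _ _, max_le (by linarith) (min_le_left _ _)⟩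

lemma truncate_of_lt {ε t : ℝ} (hε : 0 ≤ ε) (h : ε < t) : truncate ε t = t - ε := by
  rw [truncate, min_eq_left h.le, max_eq_right (by linarith)]

lemma truncate_of_lt_neg {ε t : ℝ} (hε : 0 ≤ ε) (h : t < -ε) : truncate ε t = t + ε := by
  rw [truncate, min_eq_right (by linarith), max_eq_left h.le]
  ring

lemma lipschitzWith_truncate_comp {z : E n → ℝ} {L : NNReal} (hz : LipschitzWith L z) (ε : ℝ) :
    LipschitzWith (L + L) (fun x => truncate ε (z x)) :=
  hz.sub ((hz.const_min ε).const_max (-ε))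

/-- Near a zero of z the truncation vanishes identically; elsewhere it finally differs from z by a
constant. The limit is therefore the gradient cut off on the zero set, at every point and without
knowing that the gradient vanishes almost everywhere there. -/
lemma tendsto_gradient_truncate {z : E n → ℝ} (hz : Continuous z) {ε : ℕ → ℝ}
    (hε : ∀ m, 0 < ε m) (h0 : Tendsto ε atTop (𝓝 0)) (x : E n) :
    Tendsto (fun m => gradient (fun x => truncate (ε m) (z x)) x) atTop
      (𝓝 ({x | z x ≠ 0}.indicator (gradient z) x)) := by
  by_cases hx : z x = 0
  · rw [indicator_of_notMem (by simpa using hx)]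
    refine tendsto_const_nhds.congr fun m => ?_
    have : (fun x => truncate (ε m) (z x)) =ᶠ[𝓝 x] fun _ => 0 := by
      have h1 : ∀ᶠ y in 𝓝 x, |z y| < ε m := by
        refine hz.abs.continuousAt.eventually (gt_mem_nhds ?_)
        simpa [hx] using hε m
      filter_upwards [h1] with y hy using truncate_of_abs_le hy.le
    rw [gradient, this.fderiv_eq, fderiv_const_apply, map_zero]
  · rw [indicator_of_mem (show x ∈ {x | z x ≠ 0} from hx)]
    have h1 : ∀ᶠ m in atTop, ε m < |z x| := h0.eventually (gt_mem_nhds (abs_pos.2 hx))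
    refine tendsto_const_nhds.congr' ?_
    filter_upwards [h1] with m hm
    rcases lt_abs.1 hm with h | h
    · have : (fun x => truncate (ε m) (z x)) =ᶠ[𝓝 x] fun y => z y - ε m := by
        filter_upwards [hz.continuousAt.eventually (lt_mem_nhds h)] with y hy
        exact truncate_of_lt (hε m).le hy
      rw [gradient, gradient, this.fderiv_eq, fderiv_sub_const]
    · have : (fun x => truncate (ε m) (z x)) =ᶠ[𝓝 x] fun y => z y + ε m := by
        have h' : z x < -ε m := by linarith
        filter_upwards [hz.continuousAt.eventually (gt_mem_nhds h')] with y hy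
        exact truncate_of_lt_neg (hε m).le hy
      rw [gradient, gradient, this.fderiv_eq, fderiv_add_const]

lemma norm_gradient_le_of_lipschitz {z : E n → ℝ} {L : NNReal} (hz : LipschitzWith L z) (x : E n) :
    ‖gradient z x‖ ≤ L := by
  rw [norm_gradient]
  exact norm_fderiv_le_of_lipschitz ℝ hz

/-- Truncating z at height ε gives a Lipschitz function supported in {|z| ≥ ε}, a compact subset of
U whatever the shape of the boundary. Then ε tends to 0. -/
lemma HasWeakDiv.integral_indicator_eq {U : Set (E n)} (hU : IsOpen U)
    (hUb : Bornology.IsBounded U) {G : E n → E n} (hG : MemLp G 2 (volume.restrict U))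
    {Q : E n → ℝ} (hQ : Continuous Q) (h : HasWeakDiv U G Q) {z : E n → ℝ} {L : NNReal}
    (hz : LipschitzWith L z) (hz0 : ∀ x ∉ U, z x = 0) :
    ∫ x in U, inner ℝ (G x) ({x | z x ≠ 0}.indicator (gradient z) x) = -∫ x in U, Q x * z x := by
  have hfin : IsFiniteMeasure (volume.restrict U) := ⟨by simpa using hUb.measure_lt_top⟩
  set ε : ℕ → ℝ := fun m => 1 / (m + 1) with hεdef
  have hε : ∀ m, 0 < ε m := fun m => by positivity
  have hε1 : ∀ m, ε m ≤ 1 := fun m => by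
    rw [hεdef]
    dsimp only
    rw [div_le_one (by positivity)]
    linarith [(Nat.cast_nonneg m : (0 : ℝ) ≤ m)]
  have h0 : Tendsto ε atTop (𝓝 0) := tendsto_one_div_add_atTop_nhds_zero_nat
  have hsupp : ∀ m, tsupport (fun x => truncate (ε m) (z x)) ⊆ {x | ε m ≤ |z x|} := by
    intro m
    refine closure_minimal ?_ (isClosed_le continuous_const hz.continuous.abs)
    intro x hx
    by_contra hcon
    exact hx (truncate_of_abs_le (not_le.1 hcon).le)
  have hsuppU : ∀ m, {x | ε m ≤ |z x|} ⊆ U := by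
    intro m x hx
    by_contra hcon
    have h1 : ε m ≤ |z x| := hx
    rw [hz0 x hcon, abs_zero] at h1
    exact absurd h1 (not_le.2 (hε m))
  have heq : ∀ m, ∫ x in U, inner ℝ (G x) (gradient (fun x => truncate (ε m) (z x)) x) =
      -∫ x in U, Q x * truncate (ε m) (z x) := by
    intro m
    refine h.of_lipschitz hU hUb hG hQ (lipschitzWith_truncate_comp hz (ε m)) ?_
      ((hsupp m).trans (hsuppU m))
    refine hUb.isCompact_closure.of_isClosed_subset (isClosed_tsupport _) ?_
    exact ((hsupp m).trans (hsuppU m)).trans subset_closure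
  have hlim1 : Tendsto (fun m => ∫ x in U, inner ℝ (G x)
      (gradient (fun x => truncate (ε m) (z x)) x)) atTop
      (𝓝 (∫ x in U, inner ℝ (G x) ({x | z x ≠ 0}.indicator (gradient z) x))) := by
    refine tendsto_integral_of_dominated_convergence (fun x => ‖G x‖ * (L + L)) ?_ ?_ ?_ ?_
    · exact fun m => hG.1.inner (measurable_gradient _).aestronglyMeasurable
    · exact (hG.integrable (by norm_num)).norm.mul_const _
    · refine fun m => Eventually.of_forall fun x => ?_
      refine (norm_inner_le_norm _ _).trans (mul_le_mul_of_nonneg_left ?_ (norm_nonneg _))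
      exact_mod_cast norm_gradient_le_of_lipschitz (lipschitzWith_truncate_comp hz (ε m)) x
    · exact Eventually.of_forall fun x => tendsto_const_nhds.inner
        (tendsto_gradient_truncate hz.continuous hε h0 x)
  have hQi : IntegrableOn Q U :=
    (hQ.continuousOn.integrableOn_compact hUb.isCompact_closure).mono_set subset_closure
  have hzc : HasCompactSupport z := HasCompactSupport.intro hUb.isCompact_closure
    fun x hx => hz0 x fun h => hx (subset_closure h)
  obtain ⟨C, hC⟩ := hzc.exists_bound_of_continuous hz.continuous
  have hlim2 : Tendsto (fun m => -∫ x in U, Q x * truncate (ε m) (z x)) atTop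
      (𝓝 (-∫ x in U, Q x * z x)) := by
    refine Tendsto.neg (tendsto_integral_of_dominated_convergence
      (fun x => ‖Q x‖ * (1 + C)) ?_ ?_ ?_ ?_)
    · exact fun m => (hQ.mul
        (lipschitzWith_truncate_comp hz (ε m)).continuous).aestronglyMeasurable
    · exact hQi.norm.mul_const _
    · refine fun m => Eventually.of_forall fun x => ?_
      rw [norm_mul]
      refine mul_le_mul_of_nonneg_left ?_ (norm_nonneg _)
      have h1 := abs_truncate_sub_le (hε m).le (z x)
      have h2 := hC x
      rw [Real.norm_eq_abs] at h2 ⊢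
      calc |truncate (ε m) (z x)| = |(truncate (ε m) (z x) - z x) + z x| := by ring_nf
        _ ≤ |truncate (ε m) (z x) - z x| + |z x| := abs_add_le _ _
        _ ≤ 1 + C := add_le_add (h1.trans (hε1 m)) h2
    · refine Eventually.of_forall fun x => Tendsto.const_mul _ ?_
      rw [tendsto_iff_norm_sub_tendsto_zero]
      exact squeeze_zero (fun _ => norm_nonneg _)
        (fun m => abs_truncate_sub_le (hε m).le (z x)) h0
  exact tendsto_nhds_unique hlim1 (hlim2.congr fun m => (heq m).symm)

/-- Ordinary integration by parts. These fields are used to recognize the cut-off gradient as a weak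
gradient. -/
lemma IsTestFun.hasWeakDiv_smul {U : Set (E n)} {φ : E n → ℝ} (hφ : IsTestFun U φ) (e : E n) :
    HasWeakDiv U (fun x => φ x • e) (fun x => inner ℝ e (gradient φ x)) := by
  intro ψ hψ
  have h1 : ∀ x ∉ U, inner ℝ (φ x • e) (gradient ψ x) = (0 : ℝ) := fun x hx => by
    rw [hφ.eq_zero hx, zero_smul, inner_zero_left]
  have h2 : ∀ x ∉ U, inner ℝ e (gradient φ x) * ψ x = 0 := fun x hx => by
    rw [hψ.eq_zero hx, mul_zero]
  rw [setIntegral_eq_integral_of_forall_compl_eq_zero h1,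
    setIntegral_eq_integral_of_forall_compl_eq_zero h2]
  simp only [real_inner_smul_left, inner_gradient]
  have c1 : Continuous fun x => fderiv ℝ φ x e := (contDiff_dirDeriv hφ.1 e).continuous
  have c2 : Continuous fun x => fderiv ℝ ψ x e := (contDiff_dirDeriv hψ.1 e).continuous
  refine integral_mul_fderiv_eq_neg_fderiv_mul_of_integrable ?_ ?_ ?_ ?_ ?_
  · exact (c1.mul hψ.1.continuous).integrable_of_hasCompactSupport hψ.2.1.mul_left
  · exact (hφ.1.continuous.mul c2).integrable_of_hasCompactSupport hφ.2.1.mul_right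
  · exact (hφ.1.continuous.mul hψ.1.continuous).integrable_of_hasCompactSupport hφ.2.1.mul_right
  · exact fun x _ => (hφ.1.differentiable (by simp)).differentiableAt
  · exact fun x _ => (hψ.1.differentiable (by simp)).differentiableAt

/-- Green's formula `(∇v, ∇u) = -(Δv, u)` for a continuous piecewise `C¹` function `u` that
vanishes on the boundary. -/
theorem PiecewiseC1.gradInner_eq {A : Set (E n)} {u : E n → ℝ} (hu : PiecewiseC1 A u)
    (h0 : ∀ x ∈ frontier A, u x = 0) {v q : E n → ℝ} (hv : MemH1 (interior A) v)
    (hq : Continuous q) (hlap : HasWeakLaplacian (interior A) v q) :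
    gradInner (interior A) v u = -∫ x in interior A, q x * u x := by
  have hU : IsOpen (interior A) := isOpen_interior
  have hUb : Bornology.IsBounded (interior A) := hu.isCompact.isBounded.subset interior_subset
  have hfin : IsFiniteMeasure (volume.restrict (interior A)) :=
    ⟨by simpa using hUb.measure_lt_top⟩
  set z := A.indicator u with hz
  obtain ⟨L, hL⟩ := hu.exists_lipschitzWith h0
  have hzu : ∀ x ∈ interior A, z x = u x := fun x hx => indicator_of_mem (interior_subset hx) _
  have hz0 : ∀ x ∉ interior A, z x = 0 := by
    intro x hx
    by_cases h : x ∈ A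
    · rw [hz, indicator_of_mem h]
      exact h0 x ⟨subset_closure h, hx⟩
    · exact indicator_of_notMem h _
  -- Testing with the fields φ e shows that the cut-off gradient is itself a weak gradient of u. It
  -- may thus be used in `gradInner`, and the same truncation formula applied to the gradient of v
  -- finishes the proof.
  have hwg : HasWeakGradient (interior A) u ({x | z x ≠ 0}.indicator (gradient z)) := by
    have hm : MemLp ({x | z x ≠ 0}.indicator (gradient z)) 2 (volume.restrict (interior A)) := by
      refine MemLp.of_bound (((measurable_gradient z).indicator
        (isOpen_ne_fun hL.continuous continuous_const).measurableSet).aestronglyMeasurable) L ?_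
      refine Eventually.of_forall fun x => ?_
      exact (norm_indicator_le_norm_self _ _).trans (norm_gradient_le_of_lipschitz hL x)
    refine ⟨hu.memLp, hm, fun φ hφ => ?_⟩
    refine ext_inner_left ℝ fun e => ?_
    rw [inner_neg_right, ← integral_inner (integrable_smul_of_memLp hu.memLp (hφ.memLp_gradient 2)),
      ← integral_inner (integrable_smul_of_memLp (hφ.memLp 2) hm)]
    have hGm : MemLp (fun x => φ x • e) 2 (volume.restrict (interior A)) := by
      refine MemLp.restrict _ (Continuous.memLp_of_hasCompactSupport ?_ ?_)
      · exact hφ.1.continuous.smul continuous_const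
      · exact hφ.2.1.smul_right
    have hQc : Continuous fun x => (inner ℝ e (gradient φ x) : ℝ) :=
      continuous_const.inner hφ.continuous_gradient
    have key := (hφ.hasWeakDiv_smul e).integral_indicator_eq hU hUb hGm hQc hL hz0
    simp only [real_inner_smul_left] at key
    simp only [inner_smul_right]
    rw [key, neg_neg]
    refine setIntegral_congr_fun hU.measurableSet fun x hx => ?_
    change u x * _ = _ * z x
    rw [hzu x hx, mul_comm]
  rw [VEM.gradInner_eq hU hv.hasWeakGradient hwg]
  have key := HasWeakDiv.integral_indicator_eq hU hUb hv.hasWeakGradient.2 hq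
    (show HasWeakDiv _ (weakGradient (interior A) v) q from hlap) hL hz0
  rw [key]
  congr 1
  refine setIntegral_congr_fun hU.measurableSet fun x hx => ?_
  change q x * z x = q x * u x
  rw [hzu x hx]

end VEM
end

noncomputable section
namespace VEM

/-! ## Polynomial functions -/

lemma degLE_natCast {n k : ℕ} {p : MvPolynomial (Fin n) ℝ} :
    DegLE (k : ℤ) p ↔ p.totalDegree ≤ k := by
  constructor
  · rintro (h | h)
    · simp [h]
    · exact_mod_cast h
  · intro h
    exact Or.inr (by exact_mod_cast h)

lemma contDiff_polyFun {n : ℕ} (p : MvPolynomial (Fin n) ℝ) {m : WithTop ℕ∞} :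
    ContDiff ℝ m (polyFun p) := by
  unfold polyFun
  induction p using MvPolynomial.induction_on with
  | C a => simpa using contDiff_const
  | add p q hp hq => simpa using hp.add hq
  | mul_X p i hp =>
    simp only [map_mul, MvPolynomial.eval_X]
    exact hp.mul (by fun_prop)

lemma continuous_polyFun {n : ℕ} (p : MvPolynomial (Fin n) ℝ) : Continuous (polyFun p) :=
  (contDiff_polyFun p (m := 0)).continuous

/-- The polynomial of an affine function. -/
def affPoly {n : ℕ} (f : E n →ᵃ[ℝ] ℝ) : MvPolynomial (Fin n) ℝ :=
  MvPolynomial.C (f 0) +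
    ∑ i, MvPolynomial.C (f.linear (EuclideanSpace.basisFun (Fin n) ℝ i)) * MvPolynomial.X i

lemma totalDegree_affPoly {n : ℕ} (f : E n →ᵃ[ℝ] ℝ) : (affPoly f).totalDegree ≤ 1 := by
  refine (MvPolynomial.totalDegree_add _ _).trans (max_le (by simp) ?_)
  refine MvPolynomial.totalDegree_finsetSum_le fun i _ => ?_
  refine (MvPolynomial.totalDegree_mul _ _).trans ?_
  simp

lemma polyFun_affPoly {n : ℕ} (f : E n →ᵃ[ℝ] ℝ) (x : E n) : polyFun (affPoly f) x = f x := by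
  have h1 : f x = f.linear x + f 0 := by
    have := f.map_vadd 0 x
    simpa using this
  have h2 : x = ∑ i, x i • EuclideanSpace.basisFun (Fin n) ℝ i := by
    have := (EuclideanSpace.basisFun (Fin n) ℝ).sum_repr x
    simpa using this.symm
  rw [h1]
  conv_rhs => rw [h2]
  simp [polyFun, affPoly, mul_comm, add_comm]

lemma totalDegree_bind₁_le {σ τ : Type*} (q : σ → MvPolynomial τ ℝ)
    (hq : ∀ i, (q i).totalDegree ≤ 1) (P : MvPolynomial σ ℝ) :
    (MvPolynomial.bind₁ q P).totalDegree ≤ P.totalDegree := by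
  rw [MvPolynomial.bind₁, MvPolynomial.aeval_def, MvPolynomial.eval₂_eq]
  refine MvPolynomial.totalDegree_finsetSum_le fun m hm => ?_
  refine (MvPolynomial.totalDegree_mul _ _).trans ?_
  rw [MvPolynomial.algebraMap_eq, MvPolynomial.totalDegree_C, zero_add]
  refine (MvPolynomial.totalDegree_finsetProd _ _).trans ?_
  refine le_trans ?_ (MvPolynomial.le_totalDegree hm)
  refine Finset.sum_le_sum fun i _ => ?_
  refine (MvPolynomial.totalDegree_pow _ _).trans ?_
  exact (Nat.mul_le_mul_left _ (hq i)).trans (by simp)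

lemma polyFun_bind₁ {σ : Type*} {n : ℕ} (q : σ → MvPolynomial (Fin n) ℝ) (P : MvPolynomial σ ℝ)
    (x : E n) : polyFun (MvPolynomial.bind₁ q P) x =
      MvPolynomial.eval (fun a => polyFun (q a) x) P :=
  MvPolynomial.eval₂Hom_bind₁ _ _ _ _

/-- The composition of a polynomial with an affine map. -/
def compAffine {m n : ℕ} (p : MvPolynomial (Fin n) ℝ) (r : E m →ᵃ[ℝ] E n) :
    MvPolynomial (Fin m) ℝ :=
  MvPolynomial.bind₁ (fun i => affPoly
    (((EuclideanSpace.proj i : E n →L[ℝ] ℝ) : E n →ₗ[ℝ] ℝ).toAffineMap.comp r)) p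

lemma totalDegree_compAffine {m n : ℕ} (p : MvPolynomial (Fin n) ℝ) (r : E m →ᵃ[ℝ] E n) :
    (compAffine p r).totalDegree ≤ p.totalDegree :=
  totalDegree_bind₁_le _ (fun _ => totalDegree_affPoly _) p

lemma polyFun_compAffine {m n : ℕ} (p : MvPolynomial (Fin n) ℝ) (r : E m →ᵃ[ℝ] E n) (x : E m) :
    polyFun (compAffine p r) x = polyFun p (r x) := by
  rw [compAffine, polyFun_bind₁]
  simp only [polyFun_affPoly]
  rfl

namespace IsPolyOn

variable {n k : ℕ} {A : Set (E n)} {u v : E n → ℝ}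

lemma mono {d : ℤ} {B : Set (E n)} (h : IsPolyOn d A u) (hB : B ⊆ A) : IsPolyOn d B u := by
  obtain ⟨p, hp, h⟩ := h
  exact ⟨p, hp, fun x hx => h x (hB hx)⟩

lemma congr {d : ℤ} (h : IsPolyOn d A u) (huv : ∀ x ∈ A, u x = v x) : IsPolyOn d A v := by
  obtain ⟨p, hp, h⟩ := h
  exact ⟨p, hp, fun x hx => by rw [← huv x hx, h x hx]⟩

lemma add (hu : IsPolyOn (k : ℤ) A u) (hv : IsPolyOn (k : ℤ) A v) :
    IsPolyOn (k : ℤ) A (u + v) := by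
  obtain ⟨p, hp, hp'⟩ := hu
  obtain ⟨q, hq, hq'⟩ := hv
  rw [degLE_natCast] at hp hq
  refine ⟨p + q, degLE_natCast.2 ((MvPolynomial.totalDegree_add _ _).trans (max_le hp hq)), ?_⟩
  intro x hx
  simp [hp' x hx, hq' x hx, polyFun]

lemma smul (hu : IsPolyOn (k : ℤ) A u) (r : ℝ) : IsPolyOn (k : ℤ) A (r • u) := by
  obtain ⟨p, hp, hp'⟩ := hu
  rw [degLE_natCast] at hp
  refine ⟨r • p, degLE_natCast.2 ((MvPolynomial.totalDegree_smul_le _ _).trans hp), ?_⟩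
  intro x hx
  simp [hp' x hx, polyFun]

lemma const (c : ℝ) : IsPolyOn (k : ℤ) A (fun _ => c) :=
  ⟨MvPolynomial.C c, degLE_natCast.2 (by simp), fun x _ => by simp [polyFun]⟩

lemma continuousOn {d : ℤ} (h : IsPolyOn d A u) : ContinuousOn u A := by
  obtain ⟨p, -, h⟩ := h
  exact (continuous_polyFun p).continuousOn.congr h

end IsPolyOn

/-! ## Barycentric coordinates -/

/-- Complete the vertices to an affine basis of the whole space and take its coordinates. Off the
affine span of s they depend on the completion, which is harmless. -/
lemma exists_affine_coords (s : Finset (E 3)) (hs : AffineIndependent ℝ ((↑) : s → E 3)) :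
    ∃ l : E 3 → (E 3 →ᵃ[ℝ] ℝ), (∀ a ∈ s, l a a = 1) ∧ (∀ a ∈ s, ∀ b ∈ s, a ≠ b → l a b = 0) ∧
      ∀ a ∉ s, l a = 0 := by
  classical
  obtain ⟨t, hst, hti, htop⟩ := exists_subset_affineIndependent_affineSpan_eq_top
    (s := (s : Set (E 3))) hs
  let b : AffineBasis t ℝ (E 3) := ⟨(↑), hti, by simpa using htop⟩
  have hst' : ∀ a ∈ s, a ∈ t := fun a ha => hst (Finset.mem_coe.2 ha)
  refine ⟨fun a => if h : a ∈ s then b.coord ⟨a, hst' a h⟩ else 0, ?_, ?_, ?_⟩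
  · intro a ha
    simp only [dif_pos ha]
    exact b.coord_apply_eq ⟨a, hst' a ha⟩
  · intro a ha c hc hac
    simp only [dif_pos ha]
    exact b.coord_apply_ne (i := ⟨a, hst' a ha⟩) (j := ⟨c, hst' c hc⟩) (by simpa using hac)
  · intro a ha
    simp only [dif_neg ha]

open Classical in
/-- The barycentric coordinate of the vertex `a` of the simplex `s`, as an affine function on the
whole space; it is zero if `a` is not a vertex of `s`. -/
def bary (s : Finset (E 3)) (a : E 3) : E 3 →ᵃ[ℝ] ℝ :=
  if h : AffineIndependent ℝ ((↑) : s → E 3) then (exists_affine_coords s h).choose a else 0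

lemma bary_self {s : Finset (E 3)} (h : AffineIndependent ℝ ((↑) : s → E 3)) {a : E 3}
    (ha : a ∈ s) : bary s a a = 1 := by
  rw [bary, dif_pos h]
  exact (exists_affine_coords s h).choose_spec.1 a ha

lemma bary_ne {s : Finset (E 3)} (h : AffineIndependent ℝ ((↑) : s → E 3)) {a b : E 3}
    (ha : a ∈ s) (hb : b ∈ s) (hab : a ≠ b) : bary s a b = 0 := by
  rw [bary, dif_pos h]
  exact (exists_affine_coords s h).choose_spec.2.1 a ha b hb hab

lemma bary_of_notMem {s : Finset (E 3)} {a : E 3} (ha : a ∉ s) (x : E 3) : bary s a x = 0 := by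
  rw [bary]
  split_ifs with h
  · rw [(exists_affine_coords s h).choose_spec.2.2 a ha]; rfl
  · rfl

lemma affineMap_sum_smul {ι F : Type*} [NormedAddCommGroup F] [NormedSpace ℝ F] (s : Finset ι)
    {w : ι → ℝ} (hw : ∑ i ∈ s, w i = 1)
    (p : ι → E 3) (f : E 3 →ᵃ[ℝ] F) : f (∑ i ∈ s, w i • p i) = ∑ i ∈ s, w i • f (p i) := by
  rw [← Finset.affineCombination_eq_linear_combination s p w hw,
    Finset.map_affineCombination _ _ _ hw,
    Finset.affineCombination_eq_linear_combination s _ w hw]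
  rfl

lemma bary_sum_smul {s : Finset (E 3)} (h : AffineIndependent ℝ ((↑) : s → E 3)) {w : E 3 → ℝ}
    (hw : ∑ b ∈ s, w b = 1) {a : E 3} (ha : a ∈ s) : bary s a (∑ b ∈ s, w b • b) = w a := by
  rw [affineMap_sum_smul s hw (fun b => b), Finset.sum_eq_single_of_mem a ha]
  · rw [bary_self h ha, smul_eq_mul, mul_one]
  · intro b hb hba
    rw [bary_ne h ha hb hba.symm, smul_zero]

lemma sum_bary_of_mem_affineSpan {s : Finset (E 3)} (h : AffineIndependent ℝ ((↑) : s → E 3))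
    {x : E 3} (hx : ∃ w : E 3 → ℝ, ∑ b ∈ s, w b = 1 ∧ ∑ b ∈ s, w b • b = x) :
    ∑ a ∈ s, bary s a x = 1 ∧ ∑ a ∈ s, bary s a x • a = x := by
  obtain ⟨w, hw, rfl⟩ := hx
  have : ∀ a ∈ s, bary s a (∑ b ∈ s, w b • b) = w a := fun a ha => bary_sum_smul h hw ha
  constructor
  · rw [Finset.sum_congr rfl this, hw]
  · exact Finset.sum_congr rfl fun a ha => by rw [this a ha]

lemma mem_convexHull_finset {s : Finset (E 3)} {x : E 3} :
    x ∈ convexHull ℝ (s : Set (E 3)) ↔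
      ∃ w : E 3 → ℝ, (∀ a ∈ s, 0 ≤ w a) ∧ ∑ a ∈ s, w a = 1 ∧ ∑ a ∈ s, w a • a = x :=
  Finset.mem_convexHull'

section
variable {s : Finset (E 3)} (h : AffineIndependent ℝ ((↑) : s → E 3)) {x : E 3}
include h

lemma bary_nonneg (hx : x ∈ convexHull ℝ (s : Set (E 3))) (a : E 3) : 0 ≤ bary s a x := by
  obtain ⟨w, h0, h1, rfl⟩ := mem_convexHull_finset.1 hx
  by_cases ha : a ∈ s
  · rw [bary_sum_smul h h1 ha]; exact h0 a ha
  · rw [bary_of_notMem ha]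

lemma sum_bary (hx : x ∈ convexHull ℝ (s : Set (E 3))) : ∑ a ∈ s, bary s a x = 1 := by
  obtain ⟨w, h0, h1, h2⟩ := mem_convexHull_finset.1 hx
  exact (sum_bary_of_mem_affineSpan h ⟨w, h1, h2⟩).1

lemma sum_bary_smul (hx : x ∈ convexHull ℝ (s : Set (E 3))) :
    ∑ a ∈ s, bary s a x • a = x := by
  obtain ⟨w, h0, h1, h2⟩ := mem_convexHull_finset.1 hx
  exact (sum_bary_of_mem_affineSpan h ⟨w, h1, h2⟩).2

lemma mem_convexHull_of_bary (hx : x ∈ convexHull ℝ (s : Set (E 3))) {t : Finset (E 3)}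
    (ht : t ⊆ s) (h0 : ∀ a ∈ s, a ∉ t → bary s a x = 0) : x ∈ convexHull ℝ (t : Set (E 3)) := by
  refine mem_convexHull_finset.2 ⟨fun a => bary s a x, fun a _ => bary_nonneg h hx a, ?_, ?_⟩
  · rw [Finset.sum_subset ht h0, sum_bary h hx]
  · rw [Finset.sum_subset ht fun a ha hat => by simp only [h0 a ha hat, zero_smul], sum_bary_smul h hx]

/-- Weights on t extended by zero are weights on s, and weights are unique. -/
lemma bary_eq_of_subset (t : Finset (E 3)) (hts : t ⊆ s) (hx : x ∈ convexHull ℝ (t : Set (E 3)))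
    (ht : AffineIndependent ℝ ((↑) : t → E 3)) (a : E 3) : bary s a x = bary t a x := by
  classical
  obtain ⟨w, h0, h1, rfl⟩ := mem_convexHull_finset.1 hx
  have e1 : ∑ b ∈ s, (if b ∈ t then w b else 0) = 1 := by
    rw [← h1, ← Finset.sum_filter, Finset.filter_mem_eq_inter, Finset.inter_eq_right.2 hts]
  have e2 : ∑ b ∈ s, (if b ∈ t then w b else 0) • b = ∑ b ∈ t, w b • b := by
    simp only [ite_smul, zero_smul]
    rw [← Finset.sum_filter, Finset.filter_mem_eq_inter, Finset.inter_eq_right.2 hts]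
  by_cases has : a ∈ s
  · have := bary_sum_smul h e1 has
    rw [e2] at this
    rw [this]
    split_ifs with hat
    · exact (bary_sum_smul ht h1 hat).symm
    · exact (bary_of_notMem hat _).symm
  · rw [bary_of_notMem has, bary_of_notMem fun h => has (hts h)]

end

/-! ### Hat functions of a simplicial complex -/

open Classical in
/-- The hat function of the vertex `a` of the simplicial complex `S`. -/
def hat (S : Geometry.SimplicialComplex ℝ (E 3)) (x a : E 3) : ℝ :=
  if h : ∃ s ∈ S.faces, x ∈ convexHull ℝ (s : Set (E 3)) then bary h.choose a x else 0

section
variable {S : Geometry.SimplicialComplex ℝ (E 3)} {s : Finset (E 3)} {x : E 3}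

/-- Two simplices containing x share a face containing x, and the coordinates of both restrict to
those of that face, so the choice in `hat` is immaterial. -/
lemma hat_eq_bary (hs : s ∈ S.faces) (hx : x ∈ convexHull ℝ (s : Set (E 3))) (a : E 3) :
    hat S x a = bary s a x := by
  classical
  have h : ∃ s ∈ S.faces, x ∈ convexHull ℝ (s : Set (E 3)) := ⟨s, hs, hx⟩
  rw [hat, dif_pos h]
  obtain ⟨ht, hxt⟩ := h.choose_spec
  set t := h.choose
  have hx' : x ∈ convexHull ℝ ((s ∩ t : Finset (E 3)) : Set (E 3)) := by
    rw [Finset.coe_inter]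
    exact S.inter_subset_convexHull hs ht ⟨hx, hxt⟩
  have hne : (s ∩ t).Nonempty := by
    rw [← Finset.coe_nonempty]
    exact convexHull_nonempty_iff.1 ⟨x, hx'⟩
  have hst : s ∩ t ∈ S.faces := S.down_closed hs Finset.inter_subset_left hne
  rw [bary_eq_of_subset (S.indep ht) _ Finset.inter_subset_right hx' (S.indep hst),
    bary_eq_of_subset (S.indep hs) _ Finset.inter_subset_left hx' (S.indep hst)]

lemma hat_eq_zero (hs : s ∈ S.faces) (hx : x ∈ convexHull ℝ (s : Set (E 3))) {a : E 3}
    (ha : a ∉ s) : hat S x a = 0 := by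
  rw [hat_eq_bary hs hx, bary_of_notMem ha]

lemma hat_nonneg (hs : s ∈ S.faces) (hx : x ∈ convexHull ℝ (s : Set (E 3))) (a : E 3) :
    0 ≤ hat S x a := by
  rw [hat_eq_bary hs hx]; exact bary_nonneg (S.indep hs) hx a

end

end VEM
end

noncomputable section
namespace VEM

/-! ## Continuous piecewise polynomials and their extension from subcomplexes -/

section
variable {S : Geometry.SimplicialComplex ℝ (E 3)} {k : ℕ}

lemma isCompact_convexHull_finset (s : Finset (E 3)) : IsCompact (convexHull ℝ (s : Set (E 3))) :=
  s.finite_toSet.isCompact_convexHull ℝ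

/-- Continuity is automatic: w is one function, continuous on each of finitely many closed sets. -/
lemma macroPk_of_isPolyOn (hS : S.faces.Finite) {w : E 3 → ℝ}
    (h : ∀ s ∈ S.faces, IsPolyOn (k : ℤ) (convexHull ℝ (s : Set (E 3))) w) : MacroPk k S w := by
  refine ⟨?_, h⟩
  have hfin : Finite S.faces := hS
  have e : S.space = ⋃ s : S.faces, convexHull ℝ ((s : Finset (E 3)) : Set (E 3)) := by
    rw [Geometry.SimplicialComplex.space, biUnion_eq_iUnion]
  rw [e]
  refine (locallyFinite_of_finite _).continuousOn_iUnion (fun s => ?_) fun s => ?_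
  · exact (isCompact_convexHull_finset _).isClosed
  · exact (h s s.2).continuousOn

namespace MacroPk

variable {u v : E 3 → ℝ}

lemma add (hu : MacroPk k S u) (hv : MacroPk k S v) : MacroPk k S (u + v) :=
  ⟨hu.1.add hv.1, fun s hs => (hu.2 s hs).add (hv.2 s hs)⟩

lemma smul (hu : MacroPk k S u) (r : ℝ) : MacroPk k S (r • u) :=
  ⟨hu.1.const_smul r, fun s hs => (hu.2 s hs).smul r⟩

lemma sub (hu : MacroPk k S u) (hv : MacroPk k S v) : MacroPk k S (u - v) := by
  have := hu.add (hv.smul (-1))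
  rwa [neg_one_smul, ← sub_eq_add_neg] at this

lemma const (c : ℝ) : MacroPk k S fun _ => c :=
  ⟨continuousOn_const, fun _ _ => IsPolyOn.const c⟩

lemma congr (hu : MacroPk k S u) (h : ∀ x ∈ S.space, u x = v x) : MacroPk k S v :=
  ⟨hu.1.congr fun x hx => (h x hx).symm, fun s hs => (hu.2 s hs).congr fun x hx =>
    h x (Geometry.SimplicialComplex.convexHull_subset_space hs hx)⟩

end MacroPk

lemma eval_hat_eq_polyFun {s : Finset (E 3)} (hs : s ∈ S.faces) {x : E 3}
    (hx : x ∈ convexHull ℝ (s : Set (E 3))) (P : MvPolynomial (E 3) ℝ) :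
    MvPolynomial.eval (hat S x) P =
      polyFun (MvPolynomial.bind₁ (fun a => affPoly (bary s a)) P) x := by
  rw [polyFun_bind₁]
  congr 2
  ext a
  rw [hat_eq_bary hs hx, polyFun_affPoly]

lemma isPolyOn_eval_hat {P : MvPolynomial (E 3) ℝ} (hP : P.totalDegree ≤ k)
    {s : Finset (E 3)} (hs : s ∈ S.faces) :
    IsPolyOn (k : ℤ) (convexHull ℝ (s : Set (E 3))) fun x => MvPolynomial.eval (hat S x) P :=
  ⟨_, degLE_natCast.2 ((totalDegree_bind₁_le _ (fun _ => totalDegree_affPoly _) P).trans hP),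
    fun _ hx => eval_hat_eq_polyFun hs hx P⟩

end

/-! ### Bernstein coefficients and extension of piecewise polynomials -/

section
open MvPolynomial

/-- The homogeneous form of degree `k` in the barycentric coordinates of `s` of a polynomial. -/
def bernsteinForm (k : ℕ) (s : Finset (E 3)) (p : MvPolynomial (Fin 3) ℝ) : MvPolynomial (E 3) ℝ :=
  ∑ m ∈ p.support, C (coeff m p) * ((∑ a ∈ s, X a) ^ (k - m.degree) *
    ∏ i, (∑ a ∈ s, C (a i) * X a) ^ m i)

lemma isHomogeneous_bernsteinForm {k : ℕ} (s : Finset (E 3)) {p : MvPolynomial (Fin 3) ℝ}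
    (hp : p.totalDegree ≤ k) : (bernsteinForm k s p).IsHomogeneous k := by
  refine IsHomogeneous.sum _ _ _ fun m hm => ?_
  have hmk : m.degree ≤ k := by
    refine le_trans ?_ hp
    rw [Finsupp.degree_eq_sum, ← Finsupp.sum_fintype m (fun _ e => e) (fun _ => rfl)]
    exact le_totalDegree hm
  have h1 : ((∑ a ∈ s, X a : MvPolynomial (E 3) ℝ) ^ (k - m.degree)).IsHomogeneous
      (1 * (k - m.degree)) :=
    (IsHomogeneous.sum _ _ _ fun a _ => isHomogeneous_X ℝ a).pow _
  have h2 : (∏ i, (∑ a ∈ s, C (a i) * X a : MvPolynomial (E 3) ℝ) ^ m i).IsHomogeneous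
      (∑ i, 1 * m i) :=
    IsHomogeneous.prod _ _ _ fun i _ => (IsHomogeneous.sum _ _ _ fun a _ =>
      isHomogeneous_C_mul_X _ a).pow _
  have h3 := (isHomogeneous_C (E 3) (coeff m p)).mul (h1.mul h2)
  convert h3 using 1
  simp only [one_mul, ← Finsupp.degree_eq_sum]
  omega

lemma eval_bernsteinForm (k : ℕ) {s : Finset (E 3)} (p : MvPolynomial (Fin 3) ℝ) {y : E 3 → ℝ}
    (hy : ∑ a ∈ s, y a = 1) :
    eval y (bernsteinForm k s p) = polyFun p (∑ a ∈ s, y a • a) := by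
  rw [bernsteinForm, polyFun, eval_eq' _ p, map_sum]
  refine Finset.sum_congr rfl fun m _ => ?_
  simp only [map_mul, eval_C, map_pow, map_sum, eval_X, hy, one_pow, one_mul, map_prod]
  congr 2
  ext i
  congr 1
  simp [mul_comm]

open Classical in
/-- Set all variables outside `t` to zero. -/
def restrictVars (t : Finset (E 3)) : MvPolynomial (E 3) ℝ →ₐ[ℝ] MvPolynomial (E 3) ℝ :=
  aeval fun a => if a ∈ t then X a else 0

lemma coeff_restrictVars (t : Finset (E 3)) (P : MvPolynomial (E 3) ℝ) {α : E 3 →₀ ℕ}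
    (hα : α.support ⊆ t) : coeff α (restrictVars t P) = coeff α P := by
  classical
  induction P using MvPolynomial.induction_on' with
  | monomial β c =>
    rw [restrictVars, aeval_monomial, algebraMap_eq]
    by_cases hβ : β.support ⊆ t
    · have : (β.prod fun i e => (if i ∈ t then (X i : MvPolynomial (E 3) ℝ) else 0) ^ e) =
          β.prod fun i e => X i ^ e := by
        refine Finsupp.prod_congr fun i hi => ?_
        rw [if_pos (hβ hi)]
      rw [this, ← monomial_eq]
    · obtain ⟨i, hi, hit⟩ := Finset.not_subset.1 hβ
      have : (β.prod fun i e => (if i ∈ t then (X i : MvPolynomial (E 3) ℝ) else 0) ^ e) = 0 := by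
        refine Finset.prod_eq_zero hi ?_
        simp only [if_neg hit, zero_pow (Finsupp.mem_support_iff.1 hi)]
      rw [this, mul_zero, coeff_zero, coeff_monomial, if_neg]
      rintro rfl
      exact hβ hα
  | add p q hp hq => rw [map_add, coeff_add, coeff_add, hp, hq]

lemma eval_smul_of_isHomogeneous {σ : Type*} {k : ℕ} {P : MvPolynomial σ ℝ} (hP : P.IsHomogeneous k)
    (c : ℝ) (y : σ → ℝ) : eval (fun a => c * y a) P = c ^ k * eval y P := by
  rw [eval_eq, eval_eq, Finset.mul_sum]
  refine Finset.sum_congr rfl fun m hm => ?_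
  have hk : ∑ i ∈ m.support, m i = k := by
    have := hP (mem_support_iff.1 hm)
    rw [← Finsupp.degree_apply, Finsupp.degree_eq_weight_one]
    exact this
  simp only [mul_pow, Finset.prod_mul_distrib, Finset.prod_pow_eq_pow_sum, hk]
  ring

/-- Homogeneous polynomials are determined by their values on the standard simplex. -/
lemma coeff_eq_of_eval_eq {k : ℕ} {P Q : MvPolynomial (E 3) ℝ} (hP : P.IsHomogeneous k)
    (hQ : Q.IsHomogeneous k) {t : Finset (E 3)} (ht : t.Nonempty)
    (h : ∀ y : E 3 → ℝ, (∀ a, 0 ≤ y a) → (∀ a ∉ t, y a = 0) → ∑ a ∈ t, y a = 1 →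
      eval y P = eval y Q) {α : E 3 →₀ ℕ} (hα : α.support ⊆ t) : coeff α P = coeff α Q := by
  classical
  rw [← coeff_restrictVars t P hα, ← coeff_restrictVars t Q hα]
  congr 1
  refine funext_set (fun _ => Ioi (0 : ℝ)) (fun _ => Ioi_infinite 0) fun y hy => ?_
  have hy' : ∀ a, 0 < y a := fun a => hy a (mem_univ a)
  have hr : ∀ P : MvPolynomial (E 3) ℝ, eval y (restrictVars t P) =
      eval (fun a => if a ∈ t then y a else 0) P := by
    intro P
    rw [restrictVars]
    have := eval₂Hom_bind₁ (RingHom.id ℝ) y (fun a => if a ∈ t then (X a : MvPolynomial _ ℝ) else 0) P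
    refine this.trans ?_
    congr 2
    ext a
    split_ifs <;> simp
  rw [hr, hr]
  set σ := ∑ a ∈ t, y a with hσ
  have hσ0 : 0 < σ := Finset.sum_pos (fun a _ => hy' a) ht
  -- Homogeneity reduces an arbitrary positive vector to its normalization by σ, a point of the
  -- standard simplex.
  have hsc : (fun a => if a ∈ t then y a else 0) =
      fun a => σ * (if a ∈ t then y a / σ else 0) := by
    ext a
    split_ifs
    · field_simp
    · simp
  rw [hsc, eval_smul_of_isHomogeneous hP, eval_smul_of_isHomogeneous hQ, h]
  · intro a
    split_ifs
    · exact (div_pos (hy' a) hσ0).le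
    · exact le_rfl
  · intro a ha
    rw [if_neg ha]
  · rw [Finset.sum_congr rfl fun a ha => if_pos ha, ← Finset.sum_div, div_self hσ0.ne']

/-- A function which is polynomial of degree at most `k` on all the simplices of a subcomplex is
the restriction of a continuous piecewise polynomial of degree at most `k`. -/
theorem exists_macroPk_extension {S : Geometry.SimplicialComplex ℝ (E 3)} (hS : S.faces.Finite)
    {k : ℕ} (hk : 1 ≤ k) {B : Set (Finset (E 3))} (hB : B ⊆ S.faces)
    (hBd : ∀ s ∈ B, ∀ t ⊆ s, t.Nonempty → t ∈ B) {g : E 3 → ℝ}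
    (hg : ∀ s ∈ B, IsPolyOn (k : ℤ) (convexHull ℝ (s : Set (E 3))) g) :
    ∃ w, MacroPk k S w ∧ ∀ s ∈ B, ∀ x ∈ convexHull ℝ (s : Set (E 3)), w x = g x := by
  classical
  have hex : ∀ s : Finset (E 3), ∃ P : MvPolynomial (E 3) ℝ, P.IsHomogeneous k ∧
      (s ∈ B → ∀ y : E 3 → ℝ, (∀ a ∈ s, 0 ≤ y a) → ∑ a ∈ s, y a = 1 →
        eval y P = g (∑ a ∈ s, y a • a)) := by
    intro s
    by_cases hs : s ∈ B
    · obtain ⟨p, hp, hpg⟩ := hg s hs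
      refine ⟨bernsteinForm k s p, isHomogeneous_bernsteinForm s (degLE_natCast.1 hp), ?_⟩
      intro _ y h0 h1
      rw [eval_bernsteinForm k p h1, ← hpg]
      exact mem_convexHull_finset.2 ⟨y, h0, h1, rfl⟩
    · exact ⟨0, isHomogeneous_zero _ _ _, fun h => absurd h hs⟩
  choose P hPh hPe using hex
  have hBf : B.Finite := hS.subset hB
  set I : Finset (E 3 →₀ ℕ) := hBf.toFinset.biUnion fun s => (P s).support with hI
  -- The coefficient of a monomial in the hat functions is read off on the simplex spanned by the
  -- vertices that occur in it, and set to zero if that simplex is not in B.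
  set c : (E 3 →₀ ℕ) → ℝ := fun α => if α.support ∈ B then coeff α (P α.support) else 0 with hc
  set Q : MvPolynomial (E 3) ℝ := ∑ α ∈ I, monomial α (c α) with hQ
  have hdeg : ∀ α ∈ I, α.degree = k := by
    intro α hα
    obtain ⟨s, -, hs⟩ := Finset.mem_biUnion.1 hα
    have := hPh s (mem_support_iff.1 hs)
    rw [Finsupp.degree_eq_weight_one]
    exact this
  have hQd : Q.totalDegree ≤ k := by
    refine totalDegree_finsetSum_le fun α hα => ?_
    refine (totalDegree_monomial_le _ _).trans ?_
    rw [← hdeg α hα, Finsupp.degree_apply]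
    exact le_rfl
  refine ⟨fun x => eval (hat S x) Q, macroPk_of_isPolyOn hS fun s hs => isPolyOn_eval_hat hQd hs,
    ?_⟩
  intro s hs x hx
  have hsf := hB hs
  have hz : ∀ a ∉ s, hat S x a = 0 := fun a ha => hat_eq_zero hsf hx ha
  have e1 : g x = eval (hat S x) (P s) := by
    have hb : hat S x = fun a => bary s a x := funext fun a => hat_eq_bary hsf hx a
    rw [hb, hPe s hs _ (fun a _ => bary_nonneg (S.indep hsf) hx a) (sum_bary (S.indep hsf) hx),
      sum_bary_smul (S.indep hsf) hx]
  have e2 : eval (hat S x) (P s) = ∑ α ∈ I, eval (hat S x) (monomial α (coeff α (P s))) := by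
    conv_lhs => rw [(P s).as_sum, map_sum]
    refine Finset.sum_subset ?_ fun α _ hα => ?_
    · exact Finset.subset_biUnion_of_mem (fun s => (P s).support) (hBf.mem_toFinset.2 hs)
    · rw [notMem_support_iff.1 hα, monomial_zero, map_zero]
  dsimp only
  rw [e1, e2, hQ, map_sum]
  refine Finset.sum_congr rfl fun α hα => ?_
  by_cases hαs : α.support ⊆ s
  -- Here k ≥ 1 is needed: the monomial 1 would belong to no simplex.
  · have hne : α.support.Nonempty := by
      rw [Finsupp.support_nonempty_iff]
      rintro rfl
      have := hdeg 0 hα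
      simp at this
      omega
    have hαB : α.support ∈ B := hBd s hs _ hαs hne
    have : c α = coeff α (P s) := by
      rw [hc]
      dsimp only
      rw [if_pos hαB]
      -- Consistency: on the face spanned by the support of α, both forms represent g, so their
      -- coefficients at α agree.
      refine coeff_eq_of_eval_eq (hPh _) (hPh _) hne (fun y h0 hy0 h1 => ?_) subset_rfl
      rw [hPe _ hαB y (fun a _ => h0 a) h1, hPe s hs y (fun a _ => h0 a)]
      · congr 1
        exact Finset.sum_subset hαs fun a _ ha => by simp only [hy0 a ha, zero_smul]
      · rw [← h1]
        exact (Finset.sum_subset hαs fun a _ ha => hy0 a ha).symm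
    rw [this]
  -- The monomial contains a vertex outside s, whose hat function vanishes on s.
  · obtain ⟨i, hi, his⟩ := Finset.not_subset.1 hαs
    have : ∀ r : ℝ, eval (hat S x) (monomial α r) = 0 := by
      intro r
      rw [eval_monomial, Finsupp.prod, Finset.prod_eq_zero hi, mul_zero]
      rw [hz i his, zero_pow (Finsupp.mem_support_iff.1 hi)]
    rw [this, this]

end
end VEM
end

noncomputable section
namespace VEM

/-! ## Finite-dimensionality and the abstract variational problem -/

/-- The functions which are polynomials of degree at most `k` on each set of a family, and vanish
outside their union. -/
def polySubmodule (n k : ℕ) (I : Set (Set (E n))) : Submodule ℝ (E n → ℝ) where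
  carrier := {w | (∀ A ∈ I, IsPolyOn (k : ℤ) A w) ∧ ∀ x ∉ ⋃₀ I, w x = 0}
  add_mem' := fun hu hv => ⟨fun A hA => (hu.1 A hA).add (hv.1 A hA), fun x hx => by
    simp [hu.2 x hx, hv.2 x hx]⟩
  zero_mem' := ⟨fun _ _ => IsPolyOn.const 0, fun _ _ => rfl⟩
  smul_mem' := fun c u hu => ⟨fun A hA => (hu.1 A hA).smul c, fun x hx => by simp [hu.2 x hx]⟩

lemma finiteDimensional_polySubmodule (n k : ℕ) {I : Set (Set (E n))} (hI : I.Finite) :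
    FiniteDimensional ℝ (polySubmodule n k I) := by
  have := hI.to_subtype
  let ev : ∀ A : Set (E n), MvPolynomial.restrictTotalDegree (Fin n) ℝ k →ₗ[ℝ] (A → ℝ) := fun A =>
    { toFun := fun p x => polyFun (p : MvPolynomial (Fin n) ℝ) x
      map_add' := fun p q => by ext x; simp [polyFun]
      map_smul' := fun c p => by ext x; simp [polyFun] }
  let f : polySubmodule n k I →ₗ[ℝ] ∀ A : I, LinearMap.range (ev A) :=
    { toFun := fun w A => ⟨fun x => (w : E n → ℝ) x, by
        obtain ⟨p, hp, hp'⟩ := w.2.1 A A.2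
        refine ⟨⟨p, ?_⟩, ?_⟩
        · rw [MvPolynomial.mem_restrictTotalDegree]
          exact degLE_natCast.1 hp
        · ext x
          exact (hp' x x.2).symm⟩
      map_add' := fun u v => rfl
      map_smul' := fun c u => rfl }
  refine Module.Finite.of_injective f fun u v huv => ?_
  ext x
  by_cases hx : x ∈ ⋃₀ I
  · obtain ⟨A, hA, hxA⟩ := hx
    have h1 := congrFun huv ⟨A, hA⟩
    have h2 := congrArg Subtype.val h1
    exact congrFun h2 ⟨x, hxA⟩
  · rw [u.2.2 x hx, v.2.2 x hx]

/-- Definiteness makes the induced map from V to its dual injective, hence bijective in finite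
dimension; symmetry plays no role. -/
lemma existsUnique_of_definite {V : Type*} [AddCommGroup V] [Module ℝ V] [FiniteDimensional ℝ V]
    (B : V →ₗ[ℝ] V →ₗ[ℝ] ℝ) (hB : ∀ v, B v v = 0 → v = 0) (l : V →ₗ[ℝ] ℝ) :
    ∃! u, ∀ v, B u v = l v := by
  have hinj : Function.Injective B := by
    refine (injective_iff_map_eq_zero B).2 fun v hv => hB v ?_
    rw [hv, LinearMap.zero_apply]
  have hsurj : Function.Surjective B :=
    (LinearMap.injective_iff_surjective_of_finrank_eq_finrank
      (Subspace.dual_finrank_eq (K := ℝ) (V := V)).symm).1 hinj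
  obtain ⟨u, hu⟩ := hsurj l
  refine ⟨u, fun v => by rw [hu], fun u' hu' => hinj ?_⟩
  ext v
  rw [hu' v, hu]

/-! ## Triangulated patches -/

/-- The set `A` is a polygon (`n = 2`) or polyhedron (`n = 3`), parametrized by `c`, with the
triangulation `S`. -/
structure Patch {n : ℕ} (c : E n →ᵃⁱ[ℝ] E 3) (S : Geometry.SimplicialComplex ℝ (E 3))
    (A : Set (E 3)) : Prop where
  pos : 0 < n
  triangulation : IsTriangulation n S A
  subset_range : A ⊆ range c
  isCompact : IsCompact A
  regular : closure (interior (c ⁻¹' A)) = c ⁻¹' A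

/-- The relative boundary of the patch. -/
def patchBoundary {n : ℕ} (c : E n →ᵃⁱ[ℝ] E 3) (A : Set (E 3)) : Set (E 3) :=
  c '' frontier (c ⁻¹' A)

/-- This turns polynomials in the coordinates of a face plane into polynomials on the ambient space,
as the definition of `MacroPk` demands. -/
lemma exists_affine_leftInverse {n : ℕ} (c : E n →ᵃⁱ[ℝ] E 3) :
    ∃ r : E 3 →ᵃ[ℝ] E n, ∀ y, r (c y) = y := by
  obtain ⟨g, hg⟩ := c.linearIsometry.toLinearMap.exists_leftInverse_of_injective
    (LinearMap.ker_eq_bot.2 c.linearIsometry.injective)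
  refine ⟨g.toAffineMap.comp (AffineMap.id ℝ (E 3) - AffineMap.const ℝ (E 3) (c 0)), fun y => ?_⟩
  have h1 : c y - c 0 = c.linearIsometry y := by
    have := c.map_vsub y 0
    simpa using this.symm
  have h2 := LinearMap.congr_fun hg y
  simpa [h1] using h2

namespace Patch

variable {n : ℕ} {c : E n →ᵃⁱ[ℝ] E 3} {S : Geometry.SimplicialComplex ℝ (E 3)} {A : Set (E 3)}
  (P : Patch c S A)
include P

lemma isCompact_preimage : IsCompact (c ⁻¹' A) :=
  c.isometry.isClosedEmbedding.isCompact_preimage P.isCompact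

lemma isBounded_interior : Bornology.IsBounded (interior (c ⁻¹' A)) :=
  P.isCompact_preimage.isBounded.subset interior_subset

lemma frontier_interior : frontier (interior (c ⁻¹' A)) = frontier (c ⁻¹' A) := by
  rw [frontier, frontier, P.regular, interior_interior, P.isCompact_preimage.isClosed.closure_eq]

lemma patchBoundary_subset : patchBoundary c A ⊆ A := by
  rintro _ ⟨y, hy, rfl⟩
  exact P.isCompact_preimage.isClosed.frontier_subset hy

omit P in
lemma notMem_interior {y : E n} (h : c y ∈ patchBoundary c A) : y ∉ interior (c ⁻¹' A) := by
  obtain ⟨z, hz, hzy⟩ := h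
  rw [c.injective hzy] at hz
  exact hz.2

lemma space_eq : S.space = A := P.triangulation.space_eq

lemma exists_simplex {x : E 3} (hx : x ∈ A) :
    ∃ t ∈ S.faces, t.card = n + 1 ∧ x ∈ convexHull ℝ (t : Set (E 3)) := by
  rw [← P.space_eq, Geometry.SimplicialComplex.mem_space_iff] at hx
  obtain ⟨s, hs, hxs⟩ := hx
  obtain ⟨t, ht, hst, htc⟩ := P.triangulation.pure s hs
  exact ⟨t, ht, htc, convexHull_mono (Finset.coe_subset.2 hst) hxs⟩

lemma convexHull_subset {s : Finset (E 3)} (hs : s ∈ S.faces) :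
    convexHull ℝ (s : Set (E 3)) ⊆ A := by
  rw [← P.space_eq]
  exact Geometry.SimplicialComplex.convexHull_subset_space hs

lemma piecewiseC1 {k : ℕ} {w : E 3 → ℝ} (hw : MacroPk k S w) :
    PiecewiseC1 (c ⁻¹' A) (w ∘ c) := by
  refine ⟨P.isCompact_preimage, ?_, (fun s : Finset (E 3) => c ⁻¹' convexHull ℝ (s : Set (E 3))) ''
    S.faces, P.triangulation.finite.image _, ?_, ?_⟩
  · have := hw.1
    rw [P.space_eq] at this
    exact this.comp c.continuous.continuousOn (mapsTo_preimage _ _)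
  · rw [← P.space_eq, Geometry.SimplicialComplex.space, sUnion_image]
    simp only [preimage_iUnion]
  · rintro _ ⟨s, hs, rfl⟩
    refine ⟨c.isometry.isClosedEmbedding.isCompact_preimage (isCompact_convexHull_finset s),
      (convex_convexHull ℝ _).affine_preimage c.toAffineMap, ?_⟩
    obtain ⟨p, -, hp⟩ := hw.2 s hs
    refine ⟨_, contDiff_polyFun (compAffine p c.toAffineMap), fun y hy => ?_⟩
    rw [polyFun_compAffine]
    exact hp _ hy

lemma memH1 {k : ℕ} {w : E 3 → ℝ} (hw : MacroPk k S w) :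
    MemH1 (interior (c ⁻¹' A)) (w ∘ c) := (P.piecewiseC1 hw).memH1

lemma gradInner_self_eq_zero {k : ℕ} {w : E 3 → ℝ} (hw : MacroPk k S w)
    (h0 : ∀ x ∈ patchBoundary c A, w x = 0)
    (h : gradInner (interior (c ⁻¹' A)) (w ∘ c) (w ∘ c) = 0) : ∀ x ∈ A, w x = 0 := by
  intro x hx
  obtain ⟨y, rfl⟩ := P.subset_range hx
  refine eq_zero_of_gradInner_self_eq_zero P.pos isOpen_interior P.isBounded_interior
    (v := w ∘ c) ?_ ?_ (P.memH1 hw) h y ?_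
  · rw [P.regular]
    exact (P.piecewiseC1 hw).continuousOn
  · intro z hz
    rw [P.frontier_interior] at hz
    exact h0 _ ⟨z, hz, rfl⟩
  · rw [P.regular]; exact hx

/-- The space `𝕍_k(A) ∩ H¹₀(A)`, as functions that vanish outside `A`. -/
def bubbleSpace (_P : Patch c S A) (k : ℕ) : Submodule ℝ (E 3 → ℝ) where
  carrier := {w | MacroPk k S w ∧ (∀ x ∈ patchBoundary c A, w x = 0) ∧ ∀ x ∉ A, w x = 0}
  add_mem' := fun hu hv => ⟨hu.1.add hv.1, fun x hx => by simp [hu.2.1 x hx, hv.2.1 x hx],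
    fun x hx => by simp [hu.2.2 x hx, hv.2.2 x hx]⟩
  zero_mem' := ⟨MacroPk.const 0, fun _ _ => rfl, fun _ _ => rfl⟩
  smul_mem' := fun r u hu => ⟨hu.1.smul r, fun x hx => by simp [hu.2.1 x hx],
    fun x hx => by simp [hu.2.2 x hx]⟩

lemma finiteDimensional_bubbleSpace (k : ℕ) : FiniteDimensional ℝ (P.bubbleSpace k) := by
  set I : Set (Set (E 3)) := (fun s : Finset (E 3) => convexHull ℝ (s : Set (E 3))) '' S.faces
  have := finiteDimensional_polySubmodule 3 k (I := I) (P.triangulation.finite.image _)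
  refine Submodule.finiteDimensional_of_le (S₂ := polySubmodule 3 k I) fun w hw => ⟨?_, ?_⟩
  · rintro _ ⟨s, hs, rfl⟩
    exact hw.1.2 s hs
  · intro x hx
    refine hw.2.2 x fun hxA => hx ?_
    rw [← P.space_eq, Geometry.SimplicialComplex.mem_space_iff] at hxA
    obtain ⟨s, hs, hxs⟩ := hxA
    exact ⟨_, ⟨s, hs, rfl⟩, hxs⟩

/-- The local elliptic projection with prescribed boundary values. -/
theorem exists_projection {k : ℕ} {g v : E 3 → ℝ} (hg : MacroPk k S g)
    (hv : MemH1 (interior (c ⁻¹' A)) (v ∘ c)) :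
    ∃ u, MacroPk k S u ∧ (∀ x ∈ patchBoundary c A, u x = g x) ∧
      ∀ w, MacroPk k S w → (∀ x ∈ patchBoundary c A, w x = 0) →
        gradInner (interior (c ⁻¹' A)) ((u - v) ∘ c) (w ∘ c) = 0 := by
  classical
  set U := interior (c ⁻¹' A) with hUdef
  have hU : IsOpen U := isOpen_interior
  have hH : ∀ w : P.bubbleSpace k, MemH1 U ((w : E 3 → ℝ) ∘ c) := fun w => P.memH1 w.2.1
  have := P.finiteDimensional_bubbleSpace k
  let B : P.bubbleSpace k →ₗ[ℝ] P.bubbleSpace k →ₗ[ℝ] ℝ :=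
    LinearMap.mk₂ ℝ (fun a b => gradInner U ((a : E 3 → ℝ) ∘ c) ((b : E 3 → ℝ) ∘ c))
      (fun a a' b => gradInner_add_left hU (hH a) (hH a') (hH b))
      (fun r a b => gradInner_smul_left hU (hH a) (hH b) r)
      (fun a b b' => gradInner_add_right hU (hH b) (hH b') (hH a))
      (fun r a b => gradInner_smul_right hU (hH b) (hH a) r)
  -- Write the unknown as g + z; then z solves a problem with zero boundary values and data v - g.
  have hvg : MemH1 U ((v - g) ∘ c) := hv.sub (P.memH1 hg)
  let l : P.bubbleSpace k →ₗ[ℝ] ℝ :=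
    { toFun := fun b => gradInner U ((v - g) ∘ c) ((b : E 3 → ℝ) ∘ c)
      map_add' := fun b b' => gradInner_add_right hU (hH b) (hH b') hvg
      map_smul' := fun r b => gradInner_smul_right hU (hH b) hvg r }
  obtain ⟨z, hz, -⟩ := existsUnique_of_definite B (fun w hw => by
    ext x
    by_cases hx : x ∈ A
    · exact P.gradInner_self_eq_zero w.2.1 w.2.2.1 hw x hx
    · exact w.2.2.2 x hx) l
  refine ⟨g + z, hg.add z.2.1, fun x hx => by simp [z.2.2.1 x hx], fun w hw hw0 => ?_⟩
  -- Test functions are unrestricted outside A, whereas `bubbleSpace` asks for zero there; cutting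
  -- off does not change the energy inside.
  set w' : E 3 → ℝ := A.indicator w with hw'
  have hww : ∀ x ∈ A, w x = w' x := fun x hx => (indicator_of_mem hx _).symm
  have hw'V : w' ∈ P.bubbleSpace k := by
    refine ⟨hw.congr fun x hx => hww x (P.space_eq ▸ hx), fun x hx => ?_, fun x hx =>
      indicator_of_notMem hx _⟩
    rw [← hww x (P.patchBoundary_subset hx), hw0 x hx]
  have hgz : MemH1 U ((g + (z : E 3 → ℝ) - v) ∘ c) := ((P.memH1 hg).add (hH z)).sub hv
  rw [gradInner_congr_right hU (v := w' ∘ c) (P.memH1 hw) hgz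
    fun y hy => hww _ (show y ∈ c ⁻¹' A from interior_subset hy)]
  have key : gradInner U ((z : E 3 → ℝ) ∘ c) (w' ∘ c) = gradInner U ((v - g) ∘ c) (w' ∘ c) :=
    hz ⟨w', hw'V⟩
  have e : (g + (z : E 3 → ℝ) - v) ∘ c = ((z : E 3 → ℝ) ∘ c) - ((v - g) ∘ c) := by
    ext y
    simp only [Function.comp_apply, Pi.sub_apply, Pi.add_apply]
    ring
  rw [e, gradInner_sub_left hU (hH z) hvg (hH ⟨w', hw'V⟩), key, sub_self]

/-- The vertices lie in the n-dimensional image of c, and n + 1 independent points span it. -/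
lemma affineSpan_eq {t : Finset (E 3)} (ht : t ∈ S.faces) (htc : t.card = n + 1) :
    (affineSpan ℝ (t : Set (E 3)) : Set (E 3)) = range c := by
  have h := (S.indep ht).affineSpan_eq_of_le_of_card_eq_finrank_add_one
    (sp := (⊤ : AffineSubspace ℝ (E n)).map c.toAffineMap) ?_ ?_
  · rw [Subtype.range_coe_subtype] at h
    have e : {x | x ∈ t} = (t : Set (E 3)) := rfl
    rw [e] at h
    rw [h]
    simp
  · rw [affineSpan_le]
    rintro _ ⟨a, rfl⟩
    obtain ⟨y, hy⟩ := P.subset_range (P.convexHull_subset ht (subset_convexHull ℝ _ a.2))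
    exact ⟨y, trivial, hy⟩
  · rw [AffineSubspace.map_direction, AffineSubspace.direction_top, Submodule.map_top]
    have h1 : Module.finrank ℝ (LinearMap.range c.linear) = n := by
      rw [LinearMap.finrank_range_of_inj]
      · simp
      · rw [c.linear_eq_linearIsometry]
        exact c.linearIsometry.injective
    rw [h1, Fintype.card_coe, htc]

lemma sum_bary_chart {t : Finset (E 3)} (ht : t ∈ S.faces) (htc : t.card = n + 1) (y : E n) :
    ∑ a ∈ t, bary t a (c y) = 1 ∧ ∑ a ∈ t, bary t a (c y) • a = c y := by
  classical
  refine sum_bary_of_mem_affineSpan (S.indep ht) ?_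
  have h : c y ∈ affineSpan ℝ (range ((↑) : t → E 3)) := by
    have : c y ∈ (affineSpan ℝ (t : Set (E 3)) : Set (E 3)) := by
      rw [P.affineSpan_eq ht htc]; exact mem_range_self y
    rw [Subtype.range_coe_subtype]
    exact this
  obtain ⟨w, hw, e⟩ := eq_affineCombination_of_mem_affineSpan_of_fintype h
  rw [Finset.affineCombination_eq_linear_combination _ _ _ hw] at e
  refine ⟨fun a => if h : a ∈ t then w ⟨a, h⟩ else 0, ?_, ?_⟩
  · rw [← hw, ← Finset.sum_coe_sort t]
    exact Finset.sum_congr rfl fun a _ => by simp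
  · rw [e, ← Finset.sum_coe_sort t]
    exact Finset.sum_congr rfl fun a _ => by simp

lemma mem_convexHull_of_bary_nonneg {t : Finset (E 3)} (ht : t ∈ S.faces) (htc : t.card = n + 1)
    {y : E n} (h : ∀ a ∈ t, 0 ≤ bary t a (c y)) : c y ∈ convexHull ℝ (t : Set (E 3)) := by
  obtain ⟨h1, h2⟩ := P.sum_bary_chart ht htc y
  exact mem_convexHull_finset.2 ⟨fun a => bary t a (c y), h, h1, h2⟩

omit P in
lemma isOpen_bary_pos (t : Finset (E 3)) : IsOpen {y : E n | ∀ a ∈ t, 0 < bary t a (c y)} := by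
  have : {y : E n | ∀ a ∈ t, 0 < bary t a (c y)} = ⋂ a ∈ t, {y | 0 < bary t a (c y)} := by
    ext y; simp
  rw [this]
  refine isOpen_biInter_finset fun a _ => isOpen_lt continuous_const ?_
  exact (bary t a).continuous_of_finiteDimensional.comp c.continuous

lemma bary_pos_subset {t : Finset (E 3)} (ht : t ∈ S.faces) (htc : t.card = n + 1) :
    {y : E n | ∀ a ∈ t, 0 < bary t a (c y)} ⊆ interior (c ⁻¹' A) :=
  interior_maximal (fun _ hy => P.convexHull_subset ht
    (P.mem_convexHull_of_bary_nonneg ht htc fun a ha => (hy a ha).le)) (isOpen_bary_pos t)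

lemma exists_bary_pos {t : Finset (E 3)} (ht : t ∈ S.faces) :
    {y : E n | ∀ a ∈ t, 0 < bary t a (c y)}.Nonempty := by
  have hne : t.Nonempty := Geometry.SimplicialComplex.nonempty_of_mem_faces ht
  have hc : (0 : ℝ) < t.card := by exact_mod_cast hne.card_pos
  have hw : ∑ _a ∈ t, (t.card : ℝ)⁻¹ = 1 := by
    rw [Finset.sum_const, nsmul_eq_mul, mul_inv_cancel₀ hc.ne']
  set x : E 3 := ∑ a ∈ t, (t.card : ℝ)⁻¹ • a with hx
  have hxA : x ∈ A := P.convexHull_subset ht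
    (mem_convexHull_finset.2 ⟨fun _ => (t.card : ℝ)⁻¹, fun _ _ => by positivity, hw, rfl⟩)
  obtain ⟨y, hy⟩ := P.subset_range hxA
  refine ⟨y, fun a ha => ?_⟩
  rw [hy, hx, bary_sum_smul (S.indep ht) (w := fun _ => (t.card : ℝ)⁻¹) hw ha]
  positivity

end Patch

lemma eq_zero_of_polyFun_eq_zero {n : ℕ} {p : MvPolynomial (Fin n) ℝ} {V : Set (E n)}
    (hV : IsOpen V) (hne : V.Nonempty) (h : ∀ y ∈ V, polyFun p y = 0) : p = 0 := by
  obtain ⟨y, hy⟩ := hne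
  have hV' : IsOpen ((WithLp.toLp 2 : (Fin n → ℝ) → E n) ⁻¹' V) :=
    hV.preimage (PiLp.continuous_toLp 2 _)
  obtain ⟨r, hr, hball⟩ := Metric.isOpen_iff.1 hV' (fun i => y i) hy
  refine MvPolynomial.funext_set (fun i => Metric.ball (y i) r) (fun i => ?_) fun x hx => ?_
  · rw [Real.ball_eq_Ioo]
    exact Ioo_infinite (by linarith)
  · rw [map_zero]
    rw [← ball_pi _ hr] at hx
    exact h _ (hball hx)

namespace Patch

variable {n : ℕ} {c : E n →ᵃⁱ[ℝ] E 3} {S : Geometry.SimplicialComplex ℝ (E 3)} {A : Set (E 3)}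
  (P : Patch c S A)
include P

/-- If a function with polynomial Laplacian vanishes on the boundary and its projection is zero,
then it is zero, as soon as there is an interior edge. -/
theorem eq_zero_of_projection_eq_zero {k : ℕ} {a b : E 3} (hab : {a, b} ∈ S.faces)
    (hbd : ∀ x ∈ patchBoundary c A, hat S x a * hat S x b = 0) {v : E n → ℝ}
    (hvc : ContinuousOn v (c ⁻¹' A)) (hv0 : ∀ y ∈ frontier (c ⁻¹' A), v y = 0)
    (hv : HasPolyLaplacian ((k : ℤ) - 2) (interior (c ⁻¹' A)) v)
    (hproj : ∀ w, MacroPk k S w → (∀ x ∈ patchBoundary c A, w x = 0) →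
      gradInner (interior (c ⁻¹' A)) v (w ∘ c) = 0) : ∀ y ∈ c ⁻¹' A, v y = 0 := by
  set U := interior (c ⁻¹' A) with hUdef
  obtain ⟨hH, p, hp, hlap⟩ := hv
  suffices hp0 : p = 0 by
    have hl0 : HasWeakLaplacian U v 0 := by
      have : polyFun p = 0 := by ext; simp [hp0, polyFun]
      rwa [this] at hlap
    intro y hy
    refine eq_zero_of_weakLaplacian_zero P.pos isOpen_interior P.isBounded_interior
      (by rwa [P.regular]) (fun z hz => hv0 z (by rwa [P.frontier_interior] at hz)) hH hl0 y ?_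
    rwa [P.regular]
  -- For k = 1 only the first alternative is possible. In the second, the degree of p leaves room
  -- for a product of two hat functions.
  rcases hp with hp | hp
  · exact hp
  have hk2 : p.totalDegree + 2 ≤ k := by omega
  obtain ⟨r, hr⟩ := exists_affine_leftInverse c
  -- The test function p λ_a λ_b. Green's formula turns its vanishing energy product with v into the
  -- vanishing integral of p² λ_a λ_b, a nonnegative function.
  set w : E 3 → ℝ := fun x => polyFun p (r x) * (hat S x a * hat S x b) with hw
  have hwM : MacroPk k S w := by
    refine macroPk_of_isPolyOn P.triangulation.finite fun s hs => ?_
    refine ⟨compAffine p r * (affPoly (bary s a) * affPoly (bary s b)), degLE_natCast.2 ?_, ?_⟩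
    · refine (MvPolynomial.totalDegree_mul _ _).trans (le_trans ?_ hk2)
      refine add_le_add (totalDegree_compAffine p r) ?_
      exact (MvPolynomial.totalDegree_mul _ _).trans
        (add_le_add (totalDegree_affPoly _) (totalDegree_affPoly _))
    · intro x hx
      have e : polyFun (compAffine p r * (affPoly (bary s a) * affPoly (bary s b))) x =
          polyFun (compAffine p r) x * (polyFun (affPoly (bary s a)) x *
            polyFun (affPoly (bary s b)) x) := by
        simp [polyFun]
      rw [e, polyFun_compAffine, polyFun_affPoly, polyFun_affPoly, hw]
      dsimp only
      rw [hat_eq_bary hs hx, hat_eq_bary hs hx]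
  have hw0 : ∀ x ∈ patchBoundary c A, w x = 0 := fun x hx => by
    rw [hw]; dsimp only; rw [hbd x hx, mul_zero]
  have hpc := P.piecewiseC1 hwM
  have key := hpc.gradInner_eq (fun y hy => hw0 _ ⟨y, hy, rfl⟩) hH (continuous_polyFun p) hlap
  rw [hproj w hwM hw0, eq_comm, neg_eq_zero] at key
  have hnn : ∀ y ∈ U, 0 ≤ polyFun p y * (w ∘ c) y := by
    intro y hy
    have hyA : y ∈ c ⁻¹' A := interior_subset hy
    obtain ⟨t, ht, -, hyt⟩ := P.exists_simplex hyA
    rw [Function.comp_apply, hw]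
    dsimp only
    rw [hr, ← mul_assoc]
    exact mul_nonneg (mul_self_nonneg _) (mul_nonneg (hat_nonneg ht hyt a) (hat_nonneg ht hyt b))
  have hcont : ContinuousOn (fun y => polyFun p y * (w ∘ c) y) U :=
    (continuous_polyFun p).continuousOn.mul (hpc.continuousOn.mono interior_subset)
  have hint : IntegrableOn (fun y => polyFun p y * (w ∘ c) y) U :=
    (((continuous_polyFun p).continuousOn.mul hpc.continuousOn).integrableOn_compact
      hpc.isCompact).mono_set interior_subset
  have hae : (fun y => polyFun p y * (w ∘ c) y) =ᵐ[volume.restrict U] fun _ => 0 := by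
    refine (setIntegral_eq_zero_iff_of_nonneg_ae ?_ hint).1 key
    filter_upwards [ae_restrict_mem isOpen_interior.measurableSet] with y hy using hnn y hy
  have hzero := Measure.eqOn_open_of_ae_eq hae isOpen_interior hcont continuousOn_const
  -- In the open simplex of a full-dimensional t containing the edge, both hat functions are
  -- positive, so p vanishes on an open set.
  obtain ⟨t, ht, habt, htc⟩ := P.triangulation.pure _ hab
  refine eq_zero_of_polyFun_eq_zero (isOpen_bary_pos (c := c) t) (P.exists_bary_pos ht)
    fun y hy => ?_
  have h1 := hzero (P.bary_pos_subset ht htc hy)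
  have hyt : c y ∈ convexHull ℝ (t : Set (E 3)) :=
    P.mem_convexHull_of_bary_nonneg ht htc fun a ha => (hy a ha).le
  have ha := hy a (habt (by simp))
  have hb := hy b (habt (by simp))
  simp only [Function.comp_apply, hw, hr, hat_eq_bary ht hyt] at h1
  have h2 : bary t a (c y) * bary t b (c y) ≠ 0 := (mul_pos ha hb).ne'
  rw [← mul_assoc] at h1
  exact mul_self_eq_zero.1 ((mul_eq_zero.1 h1).resolve_right h2)

end Patch
end VEM
end

noncomputable section
namespace VEM

/-! ## Interior edges and the boundary of triangulated polygons -/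

/-- The vertices whose hat function is positive at x span the smallest simplex containing x. -/
lemma exists_carrier {S : Geometry.SimplicialComplex ℝ (E 3)} {x : E 3} (hx : x ∈ S.space) :
    ∃ s ∈ S.faces, x ∈ convexHull ℝ (s : Set (E 3)) ∧ (∀ a ∈ s, 0 < hat S x a) ∧
      ∀ t ∈ S.faces, x ∈ convexHull ℝ (t : Set (E 3)) → s ⊆ t := by
  classical
  rw [Geometry.SimplicialComplex.mem_space_iff] at hx
  obtain ⟨t, ht, hxt⟩ := hx
  set s := t.filter fun a => 0 < hat S x a with hs
  have hxs : x ∈ convexHull ℝ (s : Set (E 3)) := by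
    refine mem_convexHull_of_bary (S.indep ht) hxt (Finset.filter_subset _ _) fun a ha has => ?_
    have h1 := hat_nonneg ht hxt a
    have h2 : ¬ 0 < hat S x a := fun h => has (Finset.mem_filter.2 ⟨ha, h⟩)
    rw [← hat_eq_bary ht hxt]
    exact le_antisymm (not_lt.1 h2) h1
  have hne : s.Nonempty := by
    rw [← Finset.coe_nonempty]
    exact convexHull_nonempty_iff.1 ⟨x, hxs⟩
  refine ⟨s, S.down_closed ht (Finset.filter_subset _ _) hne, hxs,
    fun a ha => (Finset.mem_filter.1 ha).2, fun u hu hxu a ha => ?_⟩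
  by_contra hau
  have := (Finset.mem_filter.1 ha).2
  rw [hat_eq_zero hu hxu hau] at this
  exact lt_irrefl _ this

namespace Patch

section
variable {n : ℕ} {c : E n →ᵃⁱ[ℝ] E 3} {S : Geometry.SimplicialComplex ℝ (E 3)} {A : Set (E 3)}
  (P : Patch c S A)
include P

omit P in
lemma isClosed_preimage_convexHull (_P : Patch c S A) (s : Finset (E 3)) :
    IsClosed (c ⁻¹' convexHull ℝ (s : Set (E 3))) :=
  (isCompact_convexHull_finset s).isClosed.preimage c.continuous

lemma isClosed_others (t : Finset (E 3)) :
    IsClosed (⋃ u ∈ {u | u ∈ S.faces ∧ u.card = n + 1 ∧ u ≠ t},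
      c ⁻¹' convexHull ℝ (u : Set (E 3))) :=
  (P.triangulation.finite.subset fun _ h => h.1).isClosed_biUnion
    fun u _ => P.isClosed_preimage_convexHull u

lemma interior_subset_union (t : Finset (E 3)) : interior (c ⁻¹' A) ⊆
    c ⁻¹' convexHull ℝ (t : Set (E 3)) ∪
      ⋃ u ∈ {u | u ∈ S.faces ∧ u.card = n + 1 ∧ u ≠ t}, c ⁻¹' convexHull ℝ (u : Set (E 3)) := by
  intro y hy
  have hyA : y ∈ c ⁻¹' A := interior_subset hy
  obtain ⟨u, hu, huc, hyu⟩ := P.exists_simplex hyA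
  by_cases h : u = t
  · left; rw [← h]; exact hyu
  · right; exact mem_biUnion (show u ∈ {u | u ∈ S.faces ∧ u.card = n + 1 ∧ u ≠ t} from
      ⟨hu, huc, h⟩) hyu

omit P in
lemma card_inter_lt (_P : Patch c S A) {s t : Finset (E 3)} (hs : s.card = n + 1)
    (ht : t.card = n + 1) (hst : s ≠ t) : (s ∩ t).card ≤ n := by
  classical
  have h : s ∩ t ⊂ s := by
    refine Finset.inter_subset_left.ssubset_of_ne fun h => hst ?_
    exact Finset.eq_of_subset_of_card_le (Finset.inter_eq_left.1 h) (by omega)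
  have := Finset.card_lt_card h
  omega

omit P in
lemma mem_convexHull_inter {s t : Finset (E 3)} (hs : s ∈ S.faces) (ht : t ∈ S.faces) {x : E 3}
    (hxs : x ∈ convexHull ℝ (s : Set (E 3))) (hxt : x ∈ convexHull ℝ (t : Set (E 3))) :
    x ∈ convexHull ℝ ((s ∩ t : Finset (E 3)) : Set (E 3)) ∧ s ∩ t ∈ S.faces := by
  have h : x ∈ convexHull ℝ ((s ∩ t : Finset (E 3)) : Set (E 3)) := by
    rw [Finset.coe_inter]
    exact S.inter_subset_convexHull hs ht ⟨hxs, hxt⟩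
  refine ⟨h, S.down_closed hs Finset.inter_subset_left ?_⟩
  rw [← Finset.coe_nonempty]
  exact convexHull_nonempty_iff.1 ⟨x, h⟩

lemma exists_bary_pos_mem {t : Finset (E 3)} (ht : t ∈ S.faces) (htc : t.card = n + 1) :
    ∃ y ∈ interior (c ⁻¹' A), c y ∈ convexHull ℝ (t : Set (E 3)) ∧
      ∀ a ∈ t, 0 < bary t a (c y) := by
  obtain ⟨y, hy⟩ := P.exists_bary_pos ht
  exact ⟨y, P.bary_pos_subset ht htc hy,
    P.mem_convexHull_of_bary_nonneg ht htc fun a ha => (hy a ha).le, hy⟩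

end

/-- In a connected patch which consists of at least two simplices of dimension `n`, there is an
interior face with `n` vertices. -/
theorem exists_interior_face {n : ℕ} {c : E n →ᵃⁱ[ℝ] E 3}
    {S : Geometry.SimplicialComplex ℝ (E 3)} {A : Set (E 3)} (P : Patch c S A)
    (hconn : IsPreconnected (interior (c ⁻¹' A))) {s t : Finset (E 3)} (hs : s ∈ S.faces)
    (ht : t ∈ S.faces) (hst : s ≠ t) (hsc : s.card = n + 1) (htc : t.card = n + 1) :
    ∃ e ∈ S.faces, e.card = n ∧ ∃ y ∈ interior (c ⁻¹' A), c y ∈ convexHull ℝ (e : Set (E 3)) := by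
  classical
  obtain ⟨y1, hy1, hy1s, -⟩ := P.exists_bary_pos_mem hs hsc
  obtain ⟨y2, hy2, hy2t, -⟩ := P.exists_bary_pos_mem ht htc
  -- The interior is covered by two closed sets, s and the union of the other n-simplices. Both meet
  -- it, so by connectedness they meet each other inside it.
  obtain ⟨y, hy, hys, hyu⟩ := isPreconnected_closed_iff.1 hconn _ _
    (P.isClosed_preimage_convexHull s) (P.isClosed_others s) (P.interior_subset_union s)
    ⟨y1, hy1, hy1s⟩ ⟨y2, hy2, mem_biUnion
      (show t ∈ {u | u ∈ S.faces ∧ u.card = n + 1 ∧ u ≠ s} from ⟨ht, htc, hst.symm⟩) hy2t⟩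
  obtain ⟨u, ⟨hu, huc, hus⟩, hyu⟩ := mem_iUnion₂.1 hyu
  obtain ⟨h1, h2⟩ := mem_convexHull_inter hs hu hys hyu
  -- The common face may have fewer than n vertices; it is enlarged inside s to exactly n.
  obtain ⟨e, he1, he2, hec⟩ := Finset.exists_subsuperset_card_eq
    (Finset.inter_subset_left (s₁ := s) (s₂ := u)) (P.card_inter_lt hsc huc hus.symm)
    (by omega : n ≤ s.card)
  refine ⟨e, S.down_closed hs he2
    ((Geometry.SimplicialComplex.nonempty_of_mem_faces h2).mono he1), hec, y, hy, ?_⟩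
  exact convexHull_mono (Finset.coe_subset.2 he1) h1

/-- On the line through a and b, these two points have parameters 1 and 0, both between σ and τ. -/
lemma mem_segment_of_param {a b p q : E 3} {σ τ : ℝ} (hp : p = σ • a + (1 - σ) • b)
    (hq : q = τ • a + (1 - τ) • b) (hσ : σ ≤ 0) (hτ : 1 ≤ τ) :
    a ∈ segment ℝ p q ∧ b ∈ segment ℝ p q := by
  have hpos : 0 < τ - σ := by linarith
  have key : ∀ ρ : ℝ, 0 ≤ ρ → ρ ≤ 1 → ρ • a + (1 - ρ) • b ∈ segment ℝ p q := by
    intro ρ h0 h1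
    refine ⟨(τ - ρ) / (τ - σ), (ρ - σ) / (τ - σ), div_nonneg (by linarith) hpos.le,
      div_nonneg (by linarith) hpos.le, ?_, ?_⟩
    · rw [← add_div]; rw [div_eq_one_iff_eq hpos.ne']; ring
    · rw [hp, hq]
      have e1 : (τ - ρ) / (τ - σ) * σ + (ρ - σ) / (τ - σ) * τ = ρ := by field_simp; ring
      have e2 : (τ - ρ) / (τ - σ) * (1 - σ) + (ρ - σ) / (τ - σ) * (1 - τ) = 1 - ρ := by
        field_simp; ring
      calc _ = ((τ - ρ) / (τ - σ) * σ + (ρ - σ) / (τ - σ) * τ) • a +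
            ((τ - ρ) / (τ - σ) * (1 - σ) + (ρ - σ) / (τ - σ) * (1 - τ)) • b := by module
        _ = _ := by rw [e1, e2]
  constructor
  · simpa using key 1 (by norm_num) le_rfl
  · simpa using key 0 le_rfl (by norm_num)

open Filter Topology in
/-- A segment in the boundary of a triangulated polygon, whose end points are vertices, is a union
of simplices. -/
theorem exists_face_subset_segment {c : E 2 →ᵃⁱ[ℝ] E 3}
    {S : Geometry.SimplicialComplex ℝ (E 3)} {A : Set (E 3)} (P : Patch c S A)
    {p q : E 3} (hp : {p} ∈ S.faces) (hq : {q} ∈ S.faces)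
    (hpq : segment ℝ p q ⊆ patchBoundary c A) {x : E 3} (hx : x ∈ segment ℝ p q) :
    ∃ s ∈ S.faces, x ∈ convexHull ℝ (s : Set (E 3)) ∧
      convexHull ℝ (s : Set (E 3)) ⊆ segment ℝ p q := by
  classical
  have hxA : x ∈ A := P.patchBoundary_subset (hpq hx)
  obtain ⟨s, hs, hxs, hpos, hmin⟩ := exists_carrier (P.space_eq ▸ hxA : x ∈ S.space)
  obtain ⟨t0, ht0, ht0c, hxt0⟩ := P.exists_simplex hxA
  have hs3 : s.card ≤ 3 := (Finset.card_le_card (hmin t0 ht0 hxt0)).trans ht0c.le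
  have hs1 : 1 ≤ s.card := (Geometry.SimplicialComplex.nonempty_of_mem_faces hs).card_pos
  have hvert : ∀ z : E 3, {z} ∈ S.faces → z ∈ convexHull ℝ (s : Set (E 3)) → z ∈ s :=
    fun z hz hzs => (Geometry.SimplicialComplex.vertex_mem_convexHull_iff hz hs).1 hzs
  have hsing : ∀ z : E 3, {z} ∈ S.faces → x = z → ∃ s ∈ S.faces,
      x ∈ convexHull ℝ (s : Set (E 3)) ∧ convexHull ℝ (s : Set (E 3)) ⊆ segment ℝ p q := by
    rintro z hz rfl
    exact ⟨{x}, hz, by simp, by simpa using hx⟩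
  by_cases hxp : x = p
  · exact hsing p hp hxp
  by_cases hxq : x = q
  · exact hsing q hq hxq
  refine ⟨s, hs, hxs, ?_⟩
  have hcases : s.card = 1 ∨ s.card = 2 ∨ s.card = 3 := by omega
  rcases hcases with h1 | h2 | h3
  · obtain ⟨z, rfl⟩ := Finset.card_eq_one.1 h1
    have hz : x = z := by simpa using hxs
    simpa [← hz] using hx
  · -- `x` is in the relative interior of the edge `s`
    obtain ⟨a, b, hab, rfl⟩ := Finset.card_eq_two.1 h2
    have hind := S.indep hs
    have has : a ∈ ({a, b} : Finset (E 3)) := by simp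
    have hbs : b ∈ ({a, b} : Finset (E 3)) := by simp
    have hz : ∀ z ∈ convexHull ℝ ((({a, b} : Finset (E 3))) : Set (E 3)),
        z = bary {a, b} a z • a + (1 - bary {a, b} a z) • b := by
      intro z hz
      have e1 := sum_bary hind hz
      have e2 := sum_bary_smul hind hz
      rw [Finset.sum_pair hab] at e1 e2
      rw [← e1, add_sub_cancel_left, e2]
    set ν := bary {a, b} a x with hν
    have hν0 : 0 < ν := by
      have := hpos a has
      rwa [hat_eq_bary hs hxs] at this
    have hν1 : ν < 1 := by
      have h1 := hpos b hbs
      rw [hat_eq_bary hs hxs] at h1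
      have e1 := sum_bary hind hxs
      rw [Finset.sum_pair hab] at e1
      linarith
    -- Walk from x a little towards q. Some triangle t is met for arbitrarily small ε; it contains
    -- x, hence the carrier {a, b} of x.
    set γ : ℝ → E 3 := fun ε => x + ε • (q - x) with hγ
    have hγc : Continuous γ := by fun_prop
    have hγ0 : γ 0 = x := by simp [hγ]
    have hγt : Tendsto γ (𝓝[>] 0) (𝓝 x) := by
      have := hγc.continuousAt (x := 0)
      rw [ContinuousAt, hγ0] at this
      exact this.mono_left nhdsWithin_le_nhds
    have hγs : ∀ ε ∈ Ioo (0 : ℝ) 1, γ ε ∈ segment ℝ p q := fun ε hε =>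
      (convex_segment p q).add_smul_sub_mem hx (right_mem_segment ℝ p q) ⟨hε.1.le, hε.2.le⟩
    have hev : ∀ᶠ ε in 𝓝[>] (0 : ℝ), ε ∈ Ioo (0 : ℝ) 1 := Ioo_mem_nhdsGT one_pos
    obtain ⟨t, ⟨ht, htc⟩, hft⟩ : ∃ t ∈ {t | t ∈ S.faces ∧ t.card = 2 + 1},
        ∃ᶠ ε in 𝓝[>] (0 : ℝ), γ ε ∈ convexHull ℝ (t : Set (E 3)) := by
      by_contra! hcon
      have h1 := (eventually_all_finite
        (P.triangulation.finite.subset fun t (ht : t ∈ {t | t ∈ S.faces ∧ t.card = 2 + 1}) =>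
          ht.1)).2 hcon
      obtain ⟨ε, hε, hε'⟩ := (h1.and hev).exists
      obtain ⟨t, ht, htc, hxt⟩ := P.exists_simplex (P.patchBoundary_subset (hpq (hγs ε hε')))
      exact hε t ⟨ht, htc⟩ hxt
    have hxt : x ∈ convexHull ℝ (t : Set (E 3)) :=
      (isCompact_convexHull_finset t).isClosed.mem_of_frequently_of_tendsto hft hγt
    have hst := hmin t ht hxt
    have hpt : ∀ d ∈ ({a, b} : Finset (E 3)), ∀ᶠ ε in 𝓝[>] (0 : ℝ), 0 < bary t d (γ ε) := by
      intro d hd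
      have h1 := hpos d hd
      rw [hat_eq_bary ht hxt] at h1
      exact (((bary t d).continuous_of_finiteDimensional.tendsto x).comp hγt).eventually
        (lt_mem_nhds h1)
    obtain ⟨ε, hεt, ⟨hεa, hεb⟩, hε⟩ :=
      (hft.and_eventually (((hpt a has).and (hpt b hbs)).and hev)).exists
    -- Otherwise all three coordinates in t are positive, so the point is in the relative interior,
    -- although the segment lies in the boundary.
    have hγab : γ ε ∈ convexHull ℝ ((({a, b} : Finset (E 3))) : Set (E 3)) := by
      refine mem_convexHull_of_bary (S.indep ht) hεt hst fun d hd hds => ?_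
      by_contra hne
      have hd0 : 0 < bary t d (γ ε) :=
        lt_of_le_of_ne (bary_nonneg (S.indep ht) hεt d) (Ne.symm hne)
      have htd : t = insert d {a, b} := by
        refine (Finset.eq_of_subset_of_card_le ?_ ?_).symm
        · exact Finset.insert_subset hd hst
        · rw [Finset.card_insert_of_notMem hds, h2, htc]
      obtain ⟨y, hy⟩ := P.subset_range (P.convexHull_subset ht hεt)
      have hyU : y ∈ interior (c ⁻¹' A) := by
        refine P.bary_pos_subset ht htc ?_
        intro e he
        rw [hy]
        rw [htd] at he
        simp only [Finset.mem_insert, Finset.mem_singleton] at he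
        rcases he with rfl | rfl | rfl
        exacts [hd0, hεa, hεb]
      have hb := hpq (hγs ε hε)
      rw [← hy] at hb
      exact notMem_interior hb hyU
    set μ := bary {a, b} a (γ ε) with hμ
    have ex := hz x hxs
    have ey := hz (γ ε) hγab
    rw [← hν] at ex
    rw [← hμ] at ey
    -- So the segment runs along the line through a and b. In the parameter of that line, x is at ν
    -- in (0, 1), q at ν + κ and p at ν - lκ, on opposite sides of x.
    set κ := (μ - ν) / ε with hκ
    have hqx : q - x = κ • (a - b) := by
      have h1 : ε • (q - x) = (μ - ν) • (a - b) := by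
        have : ε • (q - x) = γ ε - x := by simp [hγ]
        rw [this, ey]
        conv_lhs => rw [ex]
        module
      rw [hκ, div_eq_inv_mul, mul_smul, ← h1, smul_smul, inv_mul_cancel₀ hε.1.ne', one_smul]
    have hκ0 : κ ≠ 0 := by
      intro h
      rw [h, zero_smul, sub_eq_zero] at hqx
      exact hxq hqx.symm
    have eq : q = (ν + κ) • a + (1 - (ν + κ)) • b := by
      have : q = x + κ • (a - b) := by rw [← hqx]; abel
      rw [this]
      conv_lhs => rw [ex]
      module
    obtain ⟨θ1, θ2, hθ1, hθ2, hθ, hxθ⟩ := hx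
    have hθ1' : 0 < θ1 := by
      refine lt_of_le_of_ne hθ1 fun h => hxq ?_
      rw [← h, zero_add] at hθ
      rw [← hxθ, ← h, hθ]; simp
    have hθ2' : 0 < θ2 := by
      refine lt_of_le_of_ne hθ2 fun h => hxp ?_
      rw [← h, add_zero] at hθ
      rw [← hxθ, ← h, hθ]; simp
    set l := θ2 / θ1 with hl
    have hl0 : 0 < l := div_pos hθ2' hθ1'
    have ep : p = (ν - l * κ) • a + (1 - (ν - l * κ)) • b := by
      have h1 : θ1 • p = θ1 • x - (θ2 * κ) • (a - b) := by
        have h2 : θ2 • q = θ2 • x + (θ2 * κ) • (a - b) := by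
          rw [mul_smul, ← hqx]; module
        have h3 : θ1 • p = x - θ2 • q := by rw [← hxθ]; abel
        have h4 : θ1 • x = x - θ2 • x := by
          rw [eq_sub_iff_add_eq, ← add_smul, hθ, one_smul]
        rw [h3, h2, h4]
        abel
      have h5 : p = x - (l * κ) • (a - b) := by
        have h6 : p = θ1⁻¹ • (θ1 • p) := by rw [smul_smul, inv_mul_cancel₀ hθ1'.ne', one_smul]
        rw [h6, h1, smul_sub, smul_smul, smul_smul, inv_mul_cancel₀ hθ1'.ne', one_smul, hl,
          div_eq_inv_mul, mul_assoc]
      rw [h5]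
      conv_lhs => rw [ex]
      module
    -- a vertex on the line through `a` and `b` is not strictly between `a` and `b`
    have hnot : ∀ z : E 3, {z} ∈ S.faces → ∀ σ : ℝ, z = σ • a + (1 - σ) • b → σ ≤ 0 ∨ 1 ≤ σ := by
      intro z hz1 σ hzσ
      by_contra! hcon
      have hzs : z ∈ convexHull ℝ ((({a, b} : Finset (E 3))) : Set (E 3)) := by
        rw [Finset.coe_pair, convexHull_pair]
        exact ⟨σ, 1 - σ, hcon.1.le, by linarith [hcon.2], by ring, hzσ.symm⟩
      have hσ : bary {a, b} a z = σ := by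
        have hw : ∑ d ∈ ({a, b} : Finset (E 3)), (if d = a then σ else 1 - σ) = 1 := by
          rw [Finset.sum_pair hab, if_pos rfl, if_neg hab.symm]; ring
        have := bary_sum_smul hind hw has
        rw [Finset.sum_pair hab, if_pos rfl, if_neg hab.symm, ← hzσ] at this
        exact this
      have := hvert z hz1 hzs
      simp only [Finset.mem_insert, Finset.mem_singleton] at this
      rcases this with rfl | rfl
      · rw [bary_self hind has] at hσ; linarith [hcon.2]
      · rw [bary_ne hind has hbs hab] at hσ; linarith [hcon.1]
    have hsub : a ∈ segment ℝ p q ∧ b ∈ segment ℝ p q := by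
      -- The sign of κ tells which of p and q lies beyond a; neither can lie strictly between a and
      -- b, so both a and b are in the segment.
      rcases lt_or_gt_of_ne hκ0 with hneg | hpos'
      · have hlk : l * κ < 0 := mul_neg_of_pos_of_neg hl0 hneg
        have h1 := (hnot q hq _ eq).resolve_right (by linarith)
        have h2 := (hnot p hp _ ep).resolve_left (by linarith)
        have := mem_segment_of_param eq ep h1 h2
        rwa [segment_symm] at this
      · have hlk : 0 < l * κ := mul_pos hl0 hpos'
        have h1 := (hnot q hq _ eq).resolve_left (by linarith)
        have h2 := (hnot p hp _ ep).resolve_right (by linarith)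
        exact mem_segment_of_param ep eq h2 h1
    refine convexHull_min ?_ (convex_segment p q)
    intro z hz
    simp only [Finset.coe_pair, mem_insert_iff, mem_singleton_iff] at hz
    rcases hz with rfl | rfl
    exacts [hsub.1, hsub.2]
  · exfalso
    obtain ⟨y, hy⟩ := P.subset_range hxA
    have hb := hpq hx
    rw [← hy] at hb
    refine notMem_interior hb (P.bary_pos_subset hs h3 fun a ha => ?_)
    rw [hy, ← hat_eq_bary hs hxs]
    exact hpos a ha

end Patch
end VEM
end

noncomputable section
namespace VEM

/-! ## Interior edges of simply connected triangulated polyhedra -/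

/-- A finite graph without leaves has an edge which is not a bridge. -/
lemma exists_adj_reachable_deleteEdges {V : Type*} [Finite V] [Nonempty V] (G : SimpleGraph V)
    (h : ∀ v, ∃ u w, u ≠ w ∧ G.Adj v u ∧ G.Adj v w) :
    ∃ u v, G.Adj u v ∧ (G.deleteEdges {s(u, v)}).Reachable u v := by
  classical
  by_contra! hcon
  -- If every edge were a bridge, each component would be a finite tree, which has a leaf.
  have hac : G.IsAcyclic := by
    rw [SimpleGraph.isAcyclic_iff_forall_adj_isBridge]
    intro u v huv
    rw [SimpleGraph.isBridge_iff]
    exact hcon u v huv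
  obtain ⟨v⟩ := ‹Nonempty V›
  set C := G.connectedComponentMk v
  have hT : C.toSimpleGraph.IsTree := hac.isTree_connectedComponent C
  have hnb : ∀ x : C.supp, ∃ y z : C.supp, y ≠ z ∧ C.toSimpleGraph.Adj x y ∧
      C.toSimpleGraph.Adj x z := by
    rintro ⟨x, hx⟩
    obtain ⟨y, z, hyz, hxy, hxz⟩ := h x
    have hy : y ∈ C.supp := C.mem_supp_of_adj_mem_supp hx hxy
    have hz : z ∈ C.supp := C.mem_supp_of_adj_mem_supp hx hxz
    exact ⟨⟨y, hy⟩, ⟨z, hz⟩, fun h => hyz (congrArg Subtype.val h), hxy, hxz⟩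
  have : Fintype C.supp := Fintype.ofFinite _
  have : Nontrivial C.supp := by
    obtain ⟨y, z, hyz, -⟩ := hnb ⟨v, rfl⟩
    exact ⟨y, z, hyz⟩
  obtain ⟨x, hx⟩ := hT.exists_vert_degree_one_of_nontrivial
  obtain ⟨y, z, hyz, hxy, hxz⟩ := hnb x
  rw [SimpleGraph.degree_eq_one_iff_existsUnique_adj] at hx
  exact hyz (hx.unique hxy hxz)

lemma isDiscrete_range_intCast : IsDiscrete (range ((↑) : ℤ → ℝ)) := by
  have h : (AddSubgroup.zmultiples (1 : ℝ) : Set ℝ) = range ((↑) : ℤ → ℝ) := by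
    ext x
    simp [AddSubgroup.mem_zmultiples_iff]
  rw [← h, isDiscrete_iff_discreteTopology]
  exact inferInstanceAs (DiscreteTopology (AddSubgroup.zmultiples (1 : ℝ)))

/-- The pasting lemma for two closed sets, relative to U: away from one of them, continuity along it
is vacuous. -/
lemma continuousOn_of_inter_isClosed {X Y : Type*} [TopologicalSpace X] [TopologicalSpace Y]
    {U C D : Set X} {g : X → Y} (hC : IsClosed C) (hD : IsClosed D) (hU : U ⊆ C ∪ D)
    (hgC : ContinuousOn g (U ∩ C)) (hgD : ContinuousOn g (U ∩ D)) : ContinuousOn g U := by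
  have key : ∀ C : Set X, IsClosed C → ContinuousOn g (U ∩ C) → ∀ x ∈ U,
      ContinuousWithinAt g (U ∩ C) x := by
    intro C hC hg x hx
    by_cases h : x ∈ C
    · exact hg x ⟨hx, h⟩
    · refine continuousWithinAt_of_notMem_closure fun hx' => h ?_
      exact closure_minimal inter_subset_right hC hx'
  intro x hx
  refine ((key C hC hgC x hx).union (key D hD hgD x hx)).mono fun y hy => ?_
  rcases hU hy with h | h
  exacts [Or.inl ⟨hy, h⟩, Or.inr ⟨hy, h⟩]

lemma exists_int_of_exp_eq {z : ℂ} {r : ℝ}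
    (h : Complex.exp z = Complex.exp (2 * Real.pi * Complex.I * r)) :
    z.im / (2 * Real.pi) - r ∈ range ((↑) : ℤ → ℝ) := by
  obtain ⟨m, hm⟩ := Complex.exp_eq_exp_iff_exists_int.1 h
  refine ⟨m, ?_⟩
  have h1 : z.im = 2 * Real.pi * r + m * (2 * Real.pi) := by
    rw [hm]
    simp
  rw [h1]
  field_simp
  ring

namespace Patch

section
variable {n : ℕ} {c : E n →ᵃⁱ[ℝ] E 3} {S : Geometry.SimplicialComplex ℝ (E 3)} {A : Set (E 3)}
  (P : Patch c S A)

/-- The simplex `s` meets the interior of the patch. -/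
def Hits (c : E n →ᵃⁱ[ℝ] E 3) (A : Set (E 3)) (s : Finset (E 3)) : Prop :=
  ∃ y ∈ interior (c ⁻¹' A), c y ∈ convexHull ℝ (s : Set (E 3))

include P

/-- The set is star-shaped about a point of the open simplex: every other point of a segment from
there into t still has positive coordinates, except possibly the end. -/
lemma isPreconnected_inter {t : Finset (E 3)} (ht : t ∈ S.faces) (htc : t.card = n + 1) :
    IsPreconnected (interior (c ⁻¹' A) ∩ c ⁻¹' convexHull ℝ (t : Set (E 3))) := by
  obtain ⟨y0, hy0, hy0t, hpos⟩ := P.exists_bary_pos_mem ht htc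
  have hstar : StarConvex ℝ y0 (interior (c ⁻¹' A) ∩ c ⁻¹' convexHull ℝ (t : Set (E 3))) := by
    intro y hy a b ha hb hab
    rcases ha.eq_or_lt with h0 | h0
    · have : b = 1 := by linarith
      rw [← h0, this, zero_smul, one_smul, zero_add]
      exact hy
    · have hall : ∀ d ∈ t, 0 < bary t d (c (a • y0 + b • y)) := by
        intro d hd
        have h1 := Convex.combo_affine_apply (f := (bary t d).comp c.toAffineMap) (x := y0)
          (y := y) hab
        have h2 : bary t d (c (a • y0 + b • y)) = a • bary t d (c y0) + b • bary t d (c y) := h1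
        rw [h2]
        exact add_pos_of_pos_of_nonneg (mul_pos h0 (hpos d hd))
          (mul_nonneg hb (bary_nonneg (S.indep ht) hy.2 d))
      exact ⟨P.bary_pos_subset ht htc hall,
        P.mem_convexHull_of_bary_nonneg ht htc fun d hd => (hall d hd).le⟩
  exact (hstar.isPathConnected ⟨hy0, hy0t⟩).isConnected.isPreconnected

/-- An interior face with `n` vertices belongs to at least two simplices of dimension `n`. -/
lemma exists_other (hH : ∀ e ∈ S.faces, e.card < n → ¬ Hits c A e) {s t : Finset (E 3)}
    (ht : t ∈ S.faces) (htc : t.card = n + 1) (hs : s ∈ S.faces) (hsc : s.card = n)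
    (hst : s ⊆ t) (hhit : Hits c A s) :
    ∃ t' ∈ S.faces, t'.card = n + 1 ∧ t' ≠ t ∧ s ⊆ t' := by
  classical
  obtain ⟨y, hyU, hys⟩ := hhit
  suffices hy : c y ∈ c '' (⋃ u ∈ {u | u ∈ S.faces ∧ u.card = n + 1 ∧ u ≠ t},
      c ⁻¹' convexHull ℝ (u : Set (E 3))) by
    obtain ⟨y', hy', e⟩ := hy
    rw [c.injective e] at hy'
    obtain ⟨u, ⟨hu, huc, hut⟩, hyu⟩ := mem_iUnion₂.1 hy'
    refine ⟨u, hu, huc, hut, ?_⟩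
    obtain ⟨h1, h2⟩ := mem_convexHull_inter hs hu hys hyu
    have h3 : n ≤ (s ∩ u).card := not_lt.1 fun h => hH _ h2 h ⟨y, hyU, h1⟩
    rw [← Finset.eq_of_subset_of_card_le (Finset.inter_subset_left (s₁ := s) (s₂ := u))
      (by omega)]
    exact Finset.inter_subset_right
  by_contra hcon
  have hyn : y ∈ (⋃ u ∈ {u | u ∈ S.faces ∧ u.card = n + 1 ∧ u ≠ t},
      c ⁻¹' convexHull ℝ (u : Set (E 3)))ᶜ := fun h => hcon ⟨y, h, rfl⟩
  obtain ⟨d, hd⟩ : (t \ s).Nonempty := by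
    rw [← Finset.card_pos, Finset.card_sdiff_of_subset hst]
    omega
  rw [Finset.mem_sdiff] at hd
  obtain ⟨d', hd'⟩ := P.subset_range (P.convexHull_subset ht (subset_convexHull ℝ _ hd.1))
  have hbd : bary t d (c y) = 0 := by
    rw [← hat_eq_bary ht (convexHull_mono (Finset.coe_subset.2 hst) hys)]
    exact hat_eq_zero hs hys hd.2
  -- A small step from y away from the opposite vertex d makes the coordinate of d negative, so it
  -- leaves t. It remains in the interior and off the other n-simplices, which contradicts the
  -- covering.
  set γ : ℝ → E n := fun ε => AffineMap.lineMap y d' ε with hγ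
  have hγc : Continuous γ := AffineMap.lineMap_continuous
  have hγ0 : γ 0 = y := by simp [hγ]
  have hopen := ((isOpen_interior (s := c ⁻¹' A)).inter (P.isClosed_others t).isOpen_compl).preimage hγc
  have hmem : (0 : ℝ) ∈ γ ⁻¹' (interior (c ⁻¹' A) ∩
      (⋃ u ∈ {u | u ∈ S.faces ∧ u.card = n + 1 ∧ u ≠ t},
      c ⁻¹' convexHull ℝ (u : Set (E 3)))ᶜ) := by
    rw [mem_preimage, hγ0]
    exact ⟨hyU, hyn⟩
  obtain ⟨r, hr, hball⟩ := Metric.isOpen_iff.1 hopen 0 hmem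
  have h1 : -(r / 2) ∈ Metric.ball (0 : ℝ) r := by
    rw [Metric.mem_ball, dist_zero_right, norm_neg, Real.norm_of_nonneg (by positivity)]
    linarith
  obtain ⟨h2, h3⟩ := hball h1
  have h4 := (P.interior_subset_union t h2).resolve_right h3
  have h5 := bary_nonneg (S.indep ht) h4 d
  have h6 : bary t d (c (γ (-(r / 2)))) = -(r / 2) := by
    have e : bary t d (c (γ (-(r / 2)))) = (bary t d).comp c.toAffineMap (γ (-(r / 2))) := rfl
    rw [e, hγ]
    dsimp only
    rw [AffineMap.apply_lineMap]
    change AffineMap.lineMap (bary t d (c y)) (bary t d (c d')) (-(r / 2)) = _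
    rw [hbd, hd', bary_self (S.indep ht) hd.1, AffineMap.lineMap_apply]
    simp
  rw [h6] at h5
  linarith

omit P in
-- A vanishing coordinate would place the interior point y in a proper face of s, which has fewer
-- than n vertices.
lemma bary_pos_of_mem (hH : ∀ e ∈ S.faces, e.card < n → ¬ Hits c A e) {s t : Finset (E 3)}
    (ht : t ∈ S.faces) (hs : s ∈ S.faces) (hsc : s.card = n) (hst : s ⊆ t) {y : E n}
    (hy : y ∈ interior (c ⁻¹' A)) (hys : c y ∈ convexHull ℝ (s : Set (E 3))) {a : E 3}
    (ha : a ∈ s) : 0 < bary t a (c y) := by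
  classical
  have hyt := convexHull_mono (Finset.coe_subset.2 hst) hys
  refine lt_of_le_of_ne (bary_nonneg (S.indep ht) hyt a) fun h => ?_
  have h1 : bary s a (c y) = 0 := by
    rw [← hat_eq_bary hs hys, hat_eq_bary ht hyt, ← h]
  have h2 : c y ∈ convexHull ℝ ((s.erase a : Finset (E 3)) : Set (E 3)) := by
    refine mem_convexHull_of_bary (S.indep hs) hys (Finset.erase_subset _ _) fun b hb hbs => ?_
    have : b = a := by
      by_contra hne
      exact hbs (Finset.mem_erase.2 ⟨hne, hb⟩)
    rw [this, h1]
  have h3 : s.erase a ∈ S.faces := by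
    refine S.down_closed hs (Finset.erase_subset _ _) ?_
    rw [← Finset.coe_nonempty]
    exact convexHull_nonempty_iff.1 ⟨_, h2⟩
  refine hH _ h3 ?_ ⟨y, hy, h2⟩
  rw [← hsc]
  exact Finset.card_erase_lt_of_mem ha

/-- If no face with fewer than `n` vertices meets the interior, then there is a real-valued
function that increases by one on crossing a given simplex towards one of its faces, and that is an
integer on all the other simplices. -/
lemma exists_integer_jump (hU : IsSimplyConnected (interior (c ⁻¹' A)))
    (hH : ∀ e ∈ S.faces, e.card < n → ¬ Hits c A e) {s t : Finset (E 3)} (ht : t ∈ S.faces)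
    (htc : t.card = n + 1) (hs : s ∈ S.faces) (hsc : s.card = n) (hst : s ⊆ t) :
    ∃ F θ : E n → ℝ, ContinuousOn F (interior (c ⁻¹' A)) ∧
      ContinuousOn θ (interior (c ⁻¹' A) ∩ c ⁻¹' convexHull ℝ (t : Set (E 3))) ∧
      (∀ y ∈ interior (c ⁻¹' A), c y ∈ convexHull ℝ (t : Set (E 3)) →
        F y - θ y ∈ range ((↑) : ℤ → ℝ)) ∧
      (∀ t' ∈ S.faces, t'.card = n + 1 → t' ≠ t → ∀ y ∈ interior (c ⁻¹' A),
        c y ∈ convexHull ℝ (t' : Set (E 3)) → F y ∈ range ((↑) : ℤ → ℝ)) ∧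
      (∀ y ∈ interior (c ⁻¹' A), c y ∈ convexHull ℝ (s : Set (E 3)) → θ y = 1) ∧
      (∀ s' ⊆ t, s'.card = n → s' ≠ s → ∀ y, c y ∈ convexHull ℝ (s' : Set (E 3)) → θ y = 0) := by
  classical
  obtain ⟨d, hd⟩ : (t \ s).Nonempty := by
    rw [← Finset.card_pos, Finset.card_sdiff_of_subset hst]
    omega
  rw [Finset.mem_sdiff] at hd
  have hts : t = insert d s := by
    refine (Finset.eq_of_subset_of_card_le (Finset.insert_subset hd.1 hst) ?_).symm
    rw [Finset.card_insert_of_notMem hd.2]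
    omega
  set π : E n → ℝ := fun y => ∏ a ∈ s, bary t a (c y) with hπ
  set β : E n → ℝ := fun y => bary t d (c y) with hβ
  have hbc : ∀ a, Continuous fun y => bary t a (c y) := fun a =>
    (bary t a).continuous_of_finiteDimensional.comp c.continuous
  have hπc : Continuous π := continuous_finsetProd _ fun a _ => hbc a
  -- π vanishes on every facet of t other than s, and β, the coordinate of the vertex opposite s,
  -- vanishes on s. So θ interpolates between 1 on s and 0 on the other facets.
  set θ : E n → ℝ := fun y => π y / (π y + β y) with hθ
  have hθs : ∀ y ∈ interior (c ⁻¹' A), c y ∈ convexHull ℝ (s : Set (E 3)) → θ y = 1 := by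
    intro y hy hys
    have h1 : 0 < π y := Finset.prod_pos fun a ha => bary_pos_of_mem hH ht hs hsc hst hy hys ha
    have h2 : β y = 0 := by
      rw [hβ]; dsimp only
      rw [← hat_eq_bary ht (convexHull_mono (Finset.coe_subset.2 hst) hys)]
      exact hat_eq_zero hs hys hd.2
    rw [hθ]; dsimp only
    rw [h2, add_zero, div_self h1.ne']
  have hθ0 : ∀ s' ⊆ t, s'.card = n → s' ≠ s → ∀ y, c y ∈ convexHull ℝ (s' : Set (E 3)) →
      θ y = 0 := by
    intro s' hs't hs'c hne y hy
    obtain ⟨a, has, has'⟩ : ∃ a ∈ s, a ∉ s' := by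
      by_contra! hcon
      exact hne (Finset.eq_of_subset_of_card_le hcon (by omega)).symm
    have hs' : s' ∈ S.faces := by
      refine S.down_closed ht hs't ?_
      rw [← Finset.coe_nonempty]
      exact convexHull_nonempty_iff.1 ⟨_, hy⟩
    have h1 : bary t a (c y) = 0 := by
      rw [← hat_eq_bary ht (convexHull_mono (Finset.coe_subset.2 hs't) hy)]
      exact hat_eq_zero hs' hy has'
    have h2 : π y = 0 := Finset.prod_eq_zero has h1
    rw [hθ]; dsimp only
    rw [h2, zero_div]
  have hden : ∀ y ∈ interior (c ⁻¹' A), c y ∈ convexHull ℝ (t : Set (E 3)) →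
      π y + β y ≠ 0 := by
    intro y hy hyt
    have h1 : 0 ≤ β y := bary_nonneg (S.indep ht) hyt d
    have h2 : 0 ≤ π y := Finset.prod_nonneg fun a _ => bary_nonneg (S.indep ht) hyt a
    intro h0
    have h3 : β y = 0 := by linarith
    have h4 : c y ∈ convexHull ℝ (s : Set (E 3)) := by
      refine mem_convexHull_of_bary (S.indep ht) hyt hst fun a ha has => ?_
      rw [hts, Finset.mem_insert] at ha
      rw [ha.resolve_right has]
      exact h3
    -- A zero denominator forces y into s, where θ is 1, whereas division by zero makes it 0.
    have h5 := hθs y hy h4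
    rw [hθ] at h5; dsimp only at h5
    rw [h0, div_zero] at h5
    exact zero_ne_one h5
  have hθc : ContinuousOn θ (interior (c ⁻¹' A) ∩ c ⁻¹' convexHull ℝ (t : Set (E 3))) :=
    hπc.continuousOn.div (hπc.add (hbc d)).continuousOn fun y hy => hden y hy.1 hy.2
  have hoverlap : ∀ t' ∈ S.faces, t'.card = n + 1 → t' ≠ t → ∀ y ∈ interior (c ⁻¹' A),
      c y ∈ convexHull ℝ (t' : Set (E 3)) → c y ∈ convexHull ℝ (t : Set (E 3)) →
      θ y = 1 ∨ θ y = 0 := by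
    intro t' ht' ht'c hne y hy hyt' hyt
    obtain ⟨h1, h2⟩ := mem_convexHull_inter ht ht' hyt hyt'
    have h3 := P.card_inter_lt htc ht'c hne.symm
    have h4 : n ≤ (t ∩ t').card := not_lt.1 fun h => hH _ h2 h ⟨y, hy, h1⟩
    by_cases h : t ∩ t' = s
    · left; exact hθs y hy (h ▸ h1)
    · right; exact hθ0 _ Finset.inter_subset_left (by omega) h y h1
  -- A circle-valued map that turns once while t is crossed towards s and is 1 elsewhere. It is
  -- continuous because in the interior t meets other n-simplices only in facets, where θ is 0 or 1.
  set g : E n → ℂ := fun y => if c y ∈ convexHull ℝ (t : Set (E 3)) then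
    Complex.exp (2 * Real.pi * Complex.I * (θ y : ℝ)) else 1 with hg
  have hgt : ∀ y, c y ∈ convexHull ℝ (t : Set (E 3)) →
      g y = Complex.exp (2 * Real.pi * Complex.I * (θ y : ℝ)) := fun y hy => if_pos hy
  have hg1 : ∀ t' ∈ S.faces, t'.card = n + 1 → t' ≠ t → ∀ y ∈ interior (c ⁻¹' A),
      c y ∈ convexHull ℝ (t' : Set (E 3)) → g y = 1 := by
    intro t' ht' ht'c hne y hy hyt'
    by_cases hyt : c y ∈ convexHull ℝ (t : Set (E 3))
    · rw [hgt y hyt]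
      rcases hoverlap t' ht' ht'c hne y hy hyt' hyt with h | h
      · rw [h, Complex.ofReal_one, mul_one, Complex.exp_two_pi_mul_I]
      · rw [h, Complex.ofReal_zero, mul_zero, Complex.exp_zero]
    · exact if_neg hyt
  have hgc : ContinuousOn g (interior (c ⁻¹' A)) := by
    refine continuousOn_of_inter_isClosed (P.isClosed_preimage_convexHull t)
      (P.isClosed_others t) (P.interior_subset_union t) ?_ ?_
    · have h1 : ContinuousOn (fun y => Complex.exp (2 * Real.pi * Complex.I * (θ y : ℝ)))
          (interior (c ⁻¹' A) ∩ c ⁻¹' convexHull ℝ (t : Set (E 3))) :=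
        Complex.continuous_exp.comp_continuousOn
          (continuousOn_const.mul (Complex.continuous_ofReal.comp_continuousOn hθc))
      exact h1.congr fun y hy => hgt y hy.2
    · refine continuousOn_const (c := (1 : ℂ)).congr fun y hy => ?_
      obtain ⟨u, ⟨hu, huc, hut⟩, hyu⟩ := mem_iUnion₂.1 hy.2
      exact hg1 u hu huc hut y hy.1 hyu
  have hg0 : (0 : ℂ) ∉ g '' interior (c ⁻¹' A) := by
    rintro ⟨y, -, hy⟩
    rw [hg] at hy; dsimp only at hy
    split_ifs at hy with h
    · exact Complex.exp_ne_zero _ hy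
    · exact one_ne_zero hy
  -- Simple connectedness enters here: g has a continuous logarithm, whose imaginary part over 2π is
  -- the required F.
  obtain ⟨f, hfc, hfe⟩ := Complex.exists_continuousOn_eqOn_exp_comp hU isOpen_interior hgc hg0
  refine ⟨fun y => (f y).im / (2 * Real.pi), θ,
    (Complex.continuous_im.comp_continuousOn hfc).div_const _, hθc, fun y hy hyt => ?_,
    fun t' ht' ht'c hne y hy hyt' => ?_, hθs, hθ0⟩
  · refine exists_int_of_exp_eq ?_
    rw [← hgt y hyt]
    exact hfe hy
  · have h1 := exists_int_of_exp_eq (z := f y) (r := 0) ?_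
    · simpa using h1
    · rw [Complex.ofReal_zero, mul_zero, Complex.exp_zero, ← hg1 t' ht' ht'c hne y hy hyt']
      exact hfe hy

/-- In a triangulation of a simply connected patch, in which every simplex of dimension `n` has
two interior faces, there is an interior face with `n - 1` vertices. -/
theorem exists_interior_edge (hU : IsSimplyConnected (interior (c ⁻¹' A)))
    (hfac : ∀ t ∈ S.faces, t.card = n + 1 → ∃ s s' : Finset (E 3), s ⊆ t ∧ s' ⊆ t ∧ s ≠ s' ∧
      s.card = n ∧ s'.card = n ∧ Hits c A s ∧ Hits c A s') :
    ∃ e ∈ S.faces, e.card + 1 = n ∧ Hits c A e := by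
  classical
  by_contra! hcon
  -- A smaller interior face would extend, within an n-simplex, to one with n - 1 vertices that
  -- still meets the interior.
  have hH : ∀ e ∈ S.faces, e.card < n → ¬ Hits c A e := by
    rintro e he hlt ⟨y, hy, hye⟩
    have hne := (Geometry.SimplicialComplex.nonempty_of_mem_faces he)
    obtain ⟨t, ht, het, htc⟩ := P.triangulation.pure e he
    obtain ⟨e', h1, h2, h3⟩ := Finset.exists_subsuperset_card_eq het
      (by omega : e.card ≤ n - 1) (by omega)
    refine hcon e' (S.down_closed ht h2 (hne.mono h1)) (by omega)
      ⟨y, hy, convexHull_mono (Finset.coe_subset.2 h1) hye⟩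
  have hface : ∀ {s t : Finset (E 3)}, t ∈ S.faces → s ⊆ t → Hits c A s → s ∈ S.faces := by
    rintro s t ht hst ⟨y, -, hy⟩
    refine S.down_closed ht hst ?_
    rw [← Finset.coe_nonempty]
    exact convexHull_nonempty_iff.1 ⟨_, hy⟩
  let V := {s : Finset (E 3) // s ∈ S.faces ∧ (s.card = n + 1 ∨ s.card = n ∧ Hits c A s)}
  have : Finite V := (P.triangulation.finite.subset fun s hs => hs.1 :
    {s | s ∈ S.faces ∧ (s.card = n + 1 ∨ s.card = n ∧ Hits c A s)}.Finite)
  obtain ⟨y, hy⟩ := hU.nonempty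
  have hyA : y ∈ c ⁻¹' A := interior_subset hy
  obtain ⟨T, hT, hTc, -⟩ := P.exists_simplex hyA
  have : Nonempty V := ⟨⟨T, hT, Or.inl hTc⟩⟩
  -- Incidence graph of n-simplices and interior facets. It has no leaves: `hfac` gives two interior
  -- facets per simplex, and `exists_other` two simplices per interior facet.
  let G : SimpleGraph V :=
    { Adj := fun u v => u.1 ⊂ v.1 ∨ v.1 ⊂ u.1
      symm := ⟨fun u v h => h.symm⟩
      loopless := ⟨fun u h => h.elim (fun h => h.ne rfl) fun h => h.ne rfl⟩ }
  have hssub : ∀ {s t : Finset (E 3)}, s ⊆ t → s.card = n → t.card = n + 1 → s ⊂ t :=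
    fun h h1 h2 => h.ssubset_of_ne fun e => by rw [e] at h1; omega
  obtain ⟨u, v, huv, hreach⟩ := exists_adj_reachable_deleteEdges G (by
    rintro ⟨w, hw, hwc | ⟨hwc, hwh⟩⟩
    · obtain ⟨s, s', hs, hs', hne, hsc, hs'c, hsh, hs'h⟩ := hfac w hw hwc
      exact ⟨⟨s, hface hw hs hsh, Or.inr ⟨hsc, hsh⟩⟩, ⟨s', hface hw hs' hs'h, Or.inr ⟨hs'c, hs'h⟩⟩,
        fun h => hne (congrArg Subtype.val h), Or.inr (hssub hs hsc hwc),
        Or.inr (hssub hs' hs'c hwc)⟩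
    · obtain ⟨t, ht, hwt, htc⟩ : ∃ t ∈ S.faces, w ⊆ t ∧ t.card = n + 1 :=
        P.triangulation.pure w hw
      obtain ⟨t', ht', ht'c, hne, hwt'⟩ := P.exists_other hH ht htc hw hwc hwt hwh
      exact ⟨⟨t', ht', Or.inl ht'c⟩, ⟨t, ht, Or.inl htc⟩, fun h => hne (congrArg Subtype.val h),
        Or.inl (hssub hwt' hwc ht'c), Or.inl (hssub hwt hwc htc)⟩)
  have hcard : ∀ {u v : V}, u.1 ⊂ v.1 → u.1.card = n ∧ Hits c A u.1 ∧ v.1.card = n + 1 := by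
    rintro ⟨a, ha, hac | ⟨hac, hah⟩⟩ ⟨b, hb, hbc | ⟨hbc, hbh⟩⟩ h
    · have := Finset.card_lt_card h; dsimp only at this hac hbc ⊢; omega
    · have := Finset.card_lt_card h; dsimp only at this hac hbc ⊢; omega
    · exact ⟨hac, hah, hbc⟩
    · have := Finset.card_lt_card h; dsimp only at this hac hbc ⊢; omega
  -- the edge joins a simplex `t` and its face `s`
  obtain ⟨s, t, hst, hreach⟩ : ∃ s t : V, s.1 ⊂ t.1 ∧ (G.deleteEdges {s(s, t)}).Reachable s t := by
    rcases huv with h | h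
    · exact ⟨u, v, h, hreach⟩
    · refine ⟨v, u, h, ?_⟩
      rw [Sym2.eq_swap]
      exact hreach.symm
  obtain ⟨hsc, hsh, htc⟩ := hcard hst
  obtain ⟨F, θ, hFc, hθc, hFt, hF, hθ1, hθ0⟩ :=
    P.exists_integer_jump hU hH t.2.1 htc s.2.1 hsc hst.subset
  have hpt : ∀ w : V, ∃ y ∈ interior (c ⁻¹' A), c y ∈ convexHull ℝ (w.1 : Set (E 3)) := by
    rintro ⟨w, hw, hwc | ⟨-, hwh⟩⟩
    · obtain ⟨y, hy, hyw, -⟩ := P.exists_bary_pos_mem hw hwc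
      exact ⟨y, hy, hyw⟩
    · exact hwh
  choose pt hptU hptw using hpt
  let ψ : V → E n → ℝ := fun w => if w = t then θ else 0
  -- With θ subtracted on t only, the function is continuous and integer-valued on a connected set.
  have hconst : ∀ w : V, w.1.card = n + 1 → ∀ y ∈ interior (c ⁻¹' A),
      c y ∈ convexHull ℝ (w.1 : Set (E 3)) → F y - ψ w y = F (pt w) - ψ w (pt w) := by
    intro w hwc y hy hyw
    refine (P.isPreconnected_inter w.2.1 hwc).constant_of_mapsTo isDiscrete_range_intCast
      (f := fun y => F y - ψ w y) ?_ ?_ ⟨hy, hyw⟩ ⟨hptU w, hptw w⟩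
    · refine (hFc.mono inter_subset_left).sub ?_
      by_cases h : w = t
      · subst h
        simpa only [ψ, if_true] using hθc
      · have e : ψ w = fun _ => 0 := if_neg h
        rw [e]
        exact continuousOn_const
    · rintro z ⟨hz, hzw⟩
      by_cases h : w = t
      · subst h
        simpa only [ψ, if_true] using hFt z hz hzw
      · simpa only [ψ, if_neg h, Pi.zero_apply, sub_zero] using
          hF w.1 w.2.1 hwc (fun e => h (Subtype.ext e)) z hz hzw
  let val : V → ℝ := fun w => F (pt w) - ψ w (pt w)
  have hst' : s ≠ t := fun h => hst.ne (congrArg Subtype.val h)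
  have hstep : ∀ a b : V, a.1 ⊂ b.1 → s(a, b) ≠ s(s, t) → val a = val b := by
    intro a b hab hne
    obtain ⟨hac, -, hbc⟩ := hcard hab
    have h1 := hconst b hbc (pt a) (hptU a) (convexHull_mono (Finset.coe_subset.2 hab.subset)
      (hptw a))
    have hat : a ≠ t := fun h => by rw [h, htc] at hac; omega
    have h2 : ψ b (pt a) = 0 := by
      by_cases h : b = t
      · subst h
        have has : a.1 ≠ s.1 := fun e => hne (by rw [Subtype.ext e])
        simpa only [ψ, if_true] using hθ0 a.1 hab.subset hac has (pt a) (hptw a)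
      · simp only [ψ, if_neg h, Pi.zero_apply]
    have h3 : ψ a (pt a) = 0 := by simp only [ψ, if_neg hat, Pi.zero_apply]
    change F (pt a) - ψ a (pt a) = F (pt b) - ψ b (pt b)
    rw [← h1, h2, h3]
  have hval : ∀ a b : V, (G.deleteEdges {s(s, t)}).Reachable a b → val a = val b := by
    rintro a b ⟨p⟩
    induction p with
    | nil => rfl
    | cons h p ih =>
      rw [← ih]
      rw [SimpleGraph.deleteEdges_adj] at h
      rcases h.1 with h' | h'
      · exact hstep _ _ h' h.2
      · exact (hstep _ _ h' (by rw [Sym2.eq_swap]; exact h.2)).symm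
  -- Going round the cycle, avoiding the edge between s and t, gives the same value at both ends.
  -- Crossing t directly to s changes it by θ = 1.
  have h1 := hval s t hreach
  have h2 := hconst t htc (pt s) (hptU s) (convexHull_mono (Finset.coe_subset.2 hst.subset)
    (hptw s))
  have h3 : ψ t (pt s) = 1 := by
    simpa only [ψ, if_true] using hθ1 (pt s) (hptU s) (hptw s)
  have h4 : ψ s (pt s) = 0 := by simp only [ψ, if_neg hst', Pi.zero_apply]
  change F (pt s) - ψ s (pt s) = F (pt t) - ψ t (pt t) at h1
  rw [← h2, h3, h4] at h1
  linarith

end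

end Patch
end VEM
end

noncomputable section
namespace VEM

/-! ## The faces and the cells of an admissible mesh -/

/-- The product is nonzero only on simplices with both a and b as vertices. A boundary simplex of
this kind would contain the edge, which meets the interior. -/
lemma Patch.hat_mul_hat_eq_zero {n : ℕ} {c : E n →ᵃⁱ[ℝ] E 3}
    {S : Geometry.SimplicialComplex ℝ (E 3)} {A : Set (E 3)} {a b : E 3}
    (hab : Patch.Hits c A {a, b}) {B : Set (Finset (E 3))} (hB : B ⊆ S.faces)
    (hBb : ∀ s ∈ B, convexHull ℝ (s : Set (E 3)) ⊆ patchBoundary c A)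
    (hcov : ∀ x ∈ patchBoundary c A, ∃ s ∈ B, x ∈ convexHull ℝ (s : Set (E 3))) :
    ∀ x ∈ patchBoundary c A, hat S x a * hat S x b = 0 := by
  intro x hx
  obtain ⟨s, hs, hxs⟩ := hcov x hx
  by_contra hne
  have ha : a ∈ s := by
    by_contra h
    exact hne (by rw [hat_eq_zero (hB hs) hxs h, zero_mul])
  have hb : b ∈ s := by
    by_contra h
    exact hne (by rw [hat_eq_zero (hB hs) hxs h, mul_zero])
  obtain ⟨y, hy, hyab⟩ := hab
  refine Patch.notMem_interior (hBb s hs (convexHull_mono ?_ hyab)) hy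
  intro z hz
  simp only [Finset.coe_insert, Finset.coe_singleton, mem_insert_iff, mem_singleton_iff] at hz
  rcases hz with rfl | rfl
  exacts [ha, hb]

section
variable {Ω : Set (E 3)} {M : MeshData} {S : Subdivision M} (hM : M.IsMesh Ω)
  (hS : S.IsAdmissible)

include hM hS in
lemma facePatch (j : Fin M.numFaces) : Patch (M.chart j) (S.tri j) (M.face j) :=
  ⟨by norm_num, hS.tri_triangulation j, hM.face_flat j, hM.face_compact j, hM.face_regular j⟩

include hM hS in
lemma cellPatch (i : Fin M.numCells) :
    Patch (AffineIsometry.id : E 3 →ᵃⁱ[ℝ] E 3) (S.tet i) (M.cell i) :=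
  ⟨by norm_num, hS.tet_triangulation i, by simp, hM.cell_compact i, hM.cell_regular i⟩

include hM hS in
lemma MacroPk.memH1_cell {k : ℕ} {i : Fin M.numCells} {w : E 3 → ℝ} (hw : MacroPk k (S.tet i) w) :
    MemH1 (interior (M.cell i)) w :=
  (cellPatch hM hS i).memH1 hw

lemma patchBoundary_id (A : Set (E 3)) :
    patchBoundary (AffineIsometry.id : E 3 →ᵃⁱ[ℝ] E 3) A = frontier A := by
  simp [patchBoundary]

/-- The simplices of the subdivision of a face which are contained in edges of the face. -/
def edgeSimplices (S : Subdivision M) (j : Fin M.numFaces) : Set (Finset (E 3)) :=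
  {s | s ∈ (S.tri j).faces ∧ ∃ e ∈ M.edges, convexHull ℝ (e : Set (E 3)) ⊆ M.faceBoundary j ∧
    convexHull ℝ (s : Set (E 3)) ⊆ convexHull ℝ (e : Set (E 3))}

/-- The simplices of the subdivision of a cell which are contained in faces of the cell. -/
def faceSimplices (S : Subdivision M) (i : Fin M.numCells) : Set (Finset (E 3)) :=
  {s | ∃ j, M.face j ⊆ frontier (M.cell i) ∧ s ∈ (S.tri j).faces}

include hM hS in
lemma exists_mem_edgeSimplices (j : Fin M.numFaces) {x : E 3} (hx : x ∈ M.faceBoundary j) :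
    ∃ s ∈ edgeSimplices S j, x ∈ convexHull ℝ (s : Set (E 3)) := by
  classical
  obtain ⟨e, he, heb, hxe⟩ := hM.face_boundary j x hx
  obtain ⟨p, q, hpq, rfl⟩ := Finset.card_eq_two.1 (hM.edge_card e he)
  have hv := hS.vertices j _ he heb
  have hseg : convexHull ℝ (({p, q} : Finset (E 3)) : Set (E 3)) = segment ℝ p q := by
    rw [Finset.coe_pair, convexHull_pair]
  rw [hseg] at heb hxe
  obtain ⟨s, hs, hxs, hss⟩ := (facePatch hM hS j).exists_face_subset_segment (hv p (by simp))
    (hv q (by simp)) heb hxe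
  exact ⟨s, ⟨hs, {p, q}, he, by rwa [hseg], by rwa [hseg]⟩, hxs⟩

include hS in
lemma faceSimplices_subset (i : Fin M.numCells) : faceSimplices S i ⊆ (S.tet i).faces := by
  rintro s ⟨j, hj, hs⟩
  exact ((hS.compatible i j hj s).1 hs).1

include hM hS in
lemma exists_mem_faceSimplices (i : Fin M.numCells) {x : E 3} (hx : x ∈ frontier (M.cell i)) :
    ∃ s ∈ faceSimplices S i, x ∈ convexHull ℝ (s : Set (E 3)) := by
  rw [hM.cell_frontier i] at hx
  obtain ⟨j, hj, hxj⟩ := mem_iUnion₂.1 hx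
  obtain ⟨s, hs, -, hxs⟩ := (facePatch hM hS j).exists_simplex hxj
  exact ⟨s, ⟨j, hj, hs⟩, hxs⟩

include hM hS in
lemma convexHull_subset_frontier (i : Fin M.numCells) {s : Finset (E 3)}
    (hs : s ∈ faceSimplices S i) : convexHull ℝ (s : Set (E 3)) ⊆ frontier (M.cell i) := by
  obtain ⟨j, hj, hs⟩ := hs
  exact ((facePatch hM hS j).convexHull_subset hs).trans hj

include hM hS in
/-- A function on a face with polynomial Laplacian, whose boundary values and whose projection
vanish, is zero. -/
lemma face_eq_zero (j : Fin M.numFaces) {k : ℕ} {v : E 2 → ℝ} (hvc : ContinuousOn v (M.flatFace j))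
    (hv0 : ∀ y ∈ frontier (M.flatFace j), v y = 0)
    (hv : HasPolyLaplacian ((k : ℤ) - 2) (interior (M.flatFace j)) v)
    (hproj : ∀ w, MacroPk k (S.tri j) w → (∀ x ∈ M.faceBoundary j, w x = 0) →
      gradInner (interior (M.flatFace j)) v (w ∘ M.chart j) = 0) :
    ∀ y ∈ M.flatFace j, v y = 0 := by
  classical
  have P := facePatch hM hS j
  obtain ⟨s, hs, t, ht, hst, hsc, htc⟩ := hS.two_triangles j
  obtain ⟨e, he, hec, hhit⟩ :=
    P.exists_interior_face (hM.face_connected j).isPreconnected hs ht hst hsc htc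
  obtain ⟨a, b, -, rfl⟩ := Finset.card_eq_two.1 hec
  refine P.eq_zero_of_projection_eq_zero he ?_ hvc hv0 hv hproj
  exact Patch.hat_mul_hat_eq_zero hhit (B := edgeSimplices S j) (fun s hs => hs.1)
    (fun s hs => by obtain ⟨-, e, -, h1, h2⟩ := hs; exact h2.trans h1)
    fun x hx => exists_mem_edgeSimplices hM hS j hx

include hM hS in
/-- A function on a cell with polynomial Laplacian, whose boundary values and whose projection
vanish, is zero. -/
lemma cell_eq_zero (i : Fin M.numCells) {k : ℕ} {v : E 3 → ℝ} (hvc : ContinuousOn v (M.cell i))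
    (hv0 : ∀ y ∈ frontier (M.cell i), v y = 0)
    (hv : HasPolyLaplacian ((k : ℤ) - 2) (interior (M.cell i)) v)
    (hproj : ∀ w, MacroPk k (S.tet i) w → (∀ x ∈ frontier (M.cell i), w x = 0) →
      gradInner (interior (M.cell i)) v w = 0) : ∀ y ∈ M.cell i, v y = 0 := by
  classical
  have P := cellPatch hM hS i
  have hits : ∀ t ∈ (S.tet i).faces, ∀ s ⊆ t, ¬ convexHull ℝ (s : Set (E 3)) ⊆ frontier (M.cell i) →
      Patch.Hits (AffineIsometry.id : E 3 →ᵃⁱ[ℝ] E 3) (M.cell i) s := by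
    intro t ht s hst hsf
    obtain ⟨x, hxs, hxf⟩ := not_subset.1 hsf
    have hxA : x ∈ M.cell i := P.convexHull_subset ht (convexHull_mono (Finset.coe_subset.2 hst) hxs)
    refine ⟨x, ?_, hxs⟩
    change x ∈ interior (M.cell i)
    by_contra hx
    exact hxf ⟨subset_closure hxA, hx⟩
  -- With n = 3 the interior face found here has two vertices, so it is an edge.
  obtain ⟨e, he, hec, hhit⟩ := P.exists_interior_edge (hM.cell_simplyConnected i) (by
    intro t ht htc
    obtain ⟨s, s', hs, hs', hne, hsc, hs'c, hsf, hs'f⟩ := hS.two_interior_faces i t ht htc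
    exact ⟨s, s', hs, hs', hne, hsc, hs'c, hits t ht s hs hsf, hits t ht s' hs' hs'f⟩)
  obtain ⟨a, b, -, rfl⟩ := Finset.card_eq_two.1 (show e.card = 2 by omega)
  refine P.eq_zero_of_projection_eq_zero he ?_ hvc hv0 hv (fun w hw hw0 => hproj w hw ?_)
  · refine Patch.hat_mul_hat_eq_zero hhit (B := faceSimplices S i) (faceSimplices_subset hS i)
      (fun s hs => ?_) fun x hx => ?_
    · rw [patchBoundary_id]
      exact convexHull_subset_frontier hM hS i hs
    · rw [patchBoundary_id] at hx
      exact exists_mem_faceSimplices hM hS i hx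
  · rwa [patchBoundary_id] at hw0

include hM in
lemma face_subset_closure (j : Fin M.numFaces) : M.face j ⊆ closure Ω := by
  obtain ⟨i, hi⟩ := hM.face_of_cell j
  rw [← hM.cell_cover]
  exact (hi.trans (hM.cell_compact i).isClosed.frontier_subset).trans (subset_iUnion M.cell i)

include hM in
lemma cell_subset_closure (i : Fin M.numCells) : M.cell i ⊆ closure Ω := by
  rw [← hM.cell_cover]
  exact subset_iUnion M.cell i

include hM in
-- Cells are closures of their interiors, so an interior point of one cell lying in another would be
-- approached by interior points of both.
lemma cell_inter (i i' : Fin M.numCells) (hne : i ≠ i') {x : E 3} (hx : x ∈ M.cell i)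
    (hx' : x ∈ M.cell i') : x ∈ frontier (M.cell i) := by
  refine ⟨subset_closure hx, fun hxi => ?_⟩
  rw [← hM.cell_regular i'] at hx'
  obtain ⟨z, hz, hz'⟩ := mem_closure_iff.1 hx' _ isOpen_interior hxi
  exact disjoint_left.1 (hM.cell_disjoint i i' hne) hz hz'

include hM hS in
lemma MacroPk.restrict_face {k : ℕ} {i : Fin M.numCells} {j : Fin M.numFaces}
    (hij : M.face j ⊆ frontier (M.cell i)) {w : E 3 → ℝ} (hw : MacroPk k (S.tet i) w) :
    MacroPk k (S.tri j) w := by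
  refine ⟨?_, fun s hs => hw.2 s ((hS.compatible i j hij s).1 hs).1⟩
  have h := hw.1
  rw [(cellPatch hM hS i).space_eq] at h
  rw [(facePatch hM hS j).space_eq]
  exact h.mono (hij.trans (hM.cell_compact i).isClosed.frontier_subset)

end

/-! ## Existence and uniqueness of the interpolation -/

section
variable {Ω : Set (E 3)} {M : MeshData} {S : Subdivision M} {k : ℕ} {v w vh wh : E 3 → ℝ}

lemma IsInterp.macroPk_face (hM : M.IsMesh Ω) (hS : S.IsAdmissible) (h : IsInterp Ω S k v vh)
    (j : Fin M.numFaces) : MacroPk k (S.tri j) vh := by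
  obtain ⟨i, hi⟩ := hM.face_of_cell j
  exact (h.macroPk i).restrict_face hM hS hi

lemma IsInterp.memH1_face (hM : M.IsMesh Ω) (hS : S.IsAdmissible) (h : IsInterp Ω S k v vh)
    (j : Fin M.numFaces) : MemH1 (interior (M.flatFace j)) (vh ∘ M.chart j) :=
  (facePatch hM hS j).memH1 (h.macroPk_face hM hS j)

lemma IsInterp.memH1_cell (hM : M.IsMesh Ω) (hS : S.IsAdmissible) (h : IsInterp Ω S k v vh)
    (i : Fin M.numCells) : MemH1 (interior (M.cell i)) vh :=
  (h.macroPk i).memH1_cell hM hS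

lemma IsInterp.add (hM : M.IsMesh Ω) (hS : S.IsAdmissible) (hv : VirtualSpace Ω M k v)
    (hw : VirtualSpace Ω M k w) (h : IsInterp Ω S k v vh) (h' : IsInterp Ω S k w wh) :
    IsInterp Ω S k (v + w) (vh + wh) := by
  have e : vh + wh - (v + w) = (vh - v) + (wh - w) := by abel
  refine ⟨fun x hx => by simp [h.eq_zero x hx, h'.eq_zero x hx],
    fun i => (h.macroPk i).add (h'.macroPk i),
    fun j x hx => by simp [h.face_boundary j x hx, h'.face_boundary j x hx],
    fun j u hu hu0 => ?_, fun i u hu hu0 => ?_⟩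
  · rw [e]
    refine (gradInner_add_left isOpen_interior ((h.memH1_face hM hS j).sub (hv.face j).1)
      ((h'.memH1_face hM hS j).sub (hw.face j).1) ((facePatch hM hS j).memH1 hu)).trans ?_
    exact (congrArg₂ (· + ·) (h.face_proj j u hu hu0) (h'.face_proj j u hu hu0)).trans (add_zero 0)
  · rw [e, gradInner_add_left isOpen_interior ((h.memH1_cell hM hS i).sub (hv.cell i).1)
      ((h'.memH1_cell hM hS i).sub (hw.cell i).1) (hu.memH1_cell hM hS),
      h.cell_proj i u hu hu0, h'.cell_proj i u hu hu0, add_zero]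

lemma IsInterp.smul (hM : M.IsMesh Ω) (hS : S.IsAdmissible) (hv : VirtualSpace Ω M k v)
    (h : IsInterp Ω S k v vh) (r : ℝ) : IsInterp Ω S k (r • v) (r • vh) := by
  have e : r • vh - r • v = r • (vh - v) := (smul_sub _ _ _).symm
  refine ⟨fun x hx => by simp [h.eq_zero x hx], fun i => (h.macroPk i).smul r,
    fun j x hx => by simp [h.face_boundary j x hx], fun j u hu hu0 => ?_, fun i u hu hu0 => ?_⟩
  · rw [e]
    refine (gradInner_smul_left isOpen_interior ((h.memH1_face hM hS j).sub (hv.face j).1)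
      ((facePatch hM hS j).memH1 hu) r).trans ?_
    exact (congrArg (r * ·) (h.face_proj j u hu hu0)).trans (mul_zero r)
  · rw [e, gradInner_smul_left isOpen_interior ((h.memH1_cell hM hS i).sub (hv.cell i).1)
      (hu.memH1_cell hM hS), h.cell_proj i u hu hu0, mul_zero]

/-- The difference of two interpolants is an admissible test function for itself, so its energy
vanishes: first on the faces, and then, its values on the faces being zero, on the cells. -/
lemma IsInterp.eq (hM : M.IsMesh Ω) (hS : S.IsAdmissible) (hv : VirtualSpace Ω M k v)
    (h : IsInterp Ω S k v vh) (h' : IsInterp Ω S k v wh) : vh = wh := by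
  have hface : ∀ j, ∀ x ∈ M.face j, (vh - wh) x = 0 := by
    intro j
    have hd := (h.macroPk_face hM hS j).sub (h'.macroPk_face hM hS j)
    have h0 : ∀ x ∈ M.faceBoundary j, (vh - wh) x = 0 := fun x hx => by
      simp [h.face_boundary j x hx, h'.face_boundary j x hx]
    refine (facePatch hM hS j).gradInner_self_eq_zero hd h0 ?_
    have e : (vh - wh) ∘ M.chart j = (vh - v) ∘ M.chart j - (wh - v) ∘ M.chart j := by
      ext y; simp
    have h1 := gradInner_sub_left isOpen_interior ((h.memH1_face hM hS j).sub (hv.face j).1)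
      ((h'.memH1_face hM hS j).sub (hv.face j).1) ((facePatch hM hS j).memH1 hd)
    have h2 := h.face_proj j _ hd h0
    have h3 := h'.face_proj j _ hd h0
    have h4 : gradInner (interior (M.flatFace j))
        ((vh - v) ∘ M.chart j - (wh - v) ∘ M.chart j) ((vh - wh) ∘ M.chart j) = 0 :=
      h1.trans ((congrArg₂ (· - ·) h2 h3).trans (sub_zero 0))
    rw [← e] at h4
    exact h4
  have hcell : ∀ i, ∀ x ∈ M.cell i, (vh - wh) x = 0 := by
    intro i
    have hd := (h.macroPk i).sub (h'.macroPk i)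
    have h0 : ∀ x ∈ frontier (M.cell i), (vh - wh) x = 0 := fun x hx => by
      rw [hM.cell_frontier i] at hx
      obtain ⟨j, -, hxj⟩ := mem_iUnion₂.1 hx
      exact hface j x hxj
    refine (cellPatch hM hS i).gradInner_self_eq_zero hd (by rwa [patchBoundary_id]) ?_
    change gradInner (interior (M.cell i)) (vh - wh) (vh - wh) = 0
    have e : vh - wh = (vh - v) - (wh - v) := by abel
    conv_lhs => enter [2]; rw [e]
    rw [gradInner_sub_left isOpen_interior ((h.memH1_cell hM hS i).sub (hv.cell i).1)
      ((h'.memH1_cell hM hS i).sub (hv.cell i).1) (hd.memH1_cell hM hS),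
      h.cell_proj i _ hd h0, h'.cell_proj i _ hd h0, sub_zero]
  ext x
  by_cases hx : x ∈ closure Ω
  · rw [← hM.cell_cover] at hx
    obtain ⟨i, hi⟩ := mem_iUnion.1 hx
    exact sub_eq_zero.1 (hcell i x hi)
  · rw [h.eq_zero x hx, h'.eq_zero x hx]

/-- In each of the two steps, boundary data are extended by `exists_macroPk_extension` from the
boundary subcomplex and then corrected by the elliptic projection. -/
theorem exists_isInterp (hM : M.IsMesh Ω) (hS : S.IsAdmissible) (hk : 1 ≤ k)
    (hv : VirtualSpace Ω M k v) : ∃ vh, IsInterp Ω S k v vh := by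
  classical
  have hface : ∀ j, ∃ w, MacroPk k (S.tri j) w ∧ (∀ x ∈ M.faceBoundary j, w x = v x) ∧
      ∀ u, MacroPk k (S.tri j) u → (∀ x ∈ M.faceBoundary j, u x = 0) →
        gradInner (interior (M.flatFace j)) ((w - v) ∘ M.chart j) (u ∘ M.chart j) = 0 := by
    intro j
    obtain ⟨w0, hw0, hw0v⟩ := exists_macroPk_extension (hS.tri_triangulation j).finite hk
      (B := edgeSimplices S j) (fun s hs => hs.1)
      (fun s hs t hts htn => ⟨(S.tri j).down_closed hs.1 hts htn, by
        obtain ⟨e, he, h1, h2⟩ := hs.2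
        exact ⟨e, he, h1, (convexHull_mono (Finset.coe_subset.2 hts)).trans h2⟩⟩)
      (g := v) (fun s hs => by
        obtain ⟨e, he, h1, h2⟩ := hs.2
        exact (hv.edge e he).mono h2)
    obtain ⟨w, hw, hwb, hwp⟩ := (facePatch hM hS j).exists_projection hw0 (hv.face j).1
    refine ⟨w, hw, fun x hx => ?_, hwp⟩
    obtain ⟨s, hs, hxs⟩ := exists_mem_edgeSimplices hM hS j hx
    rw [hwb x hx, hw0v s hs x hxs]
  choose w hw hwb hwp using hface
  let g : E 3 → ℝ := fun x => if h : ∃ j, x ∈ M.face j then w h.choose x else 0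
  have hg : ∀ j, ∀ x ∈ M.face j, g x = w j x := by
    intro j x hx
    have h : ∃ j, x ∈ M.face j := ⟨j, hx⟩
    have hx' := h.choose_spec
    simp only [g, dif_pos h]
    by_cases e : h.choose = j
    · rw [e]
    -- Different faces meet only in points of both relative boundaries, where both face functions
    -- equal v.
    · rw [hwb _ x (hM.face_inter _ j e ⟨hx', hx⟩), hwb j x (hM.face_inter j _ (Ne.symm e) ⟨hx, hx'⟩)]
  have hcell : ∀ i, ∃ u, MacroPk k (S.tet i) u ∧ (∀ x ∈ frontier (M.cell i), u x = g x) ∧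
      ∀ z, MacroPk k (S.tet i) z → (∀ x ∈ frontier (M.cell i), z x = 0) →
        gradInner (interior (M.cell i)) (u - v) z = 0 := by
    intro i
    obtain ⟨u0, hu0, hu0g⟩ := exists_macroPk_extension (hS.tet_triangulation i).finite hk
      (B := faceSimplices S i) (faceSimplices_subset hS i)
      (fun s hs t hts htn => by
        obtain ⟨j, hj, hs⟩ := hs
        exact ⟨j, hj, (S.tri j).down_closed hs hts htn⟩)
      (g := g) (fun s hs => by
        obtain ⟨j, hj, hs⟩ := hs
        exact ((hw j).2 s hs).congr fun x hx =>
          (hg j x ((facePatch hM hS j).convexHull_subset hs hx)).symm)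
    obtain ⟨u, hu, hub, hup⟩ := (cellPatch hM hS i).exists_projection hu0 (hv.cell i).1
    rw [patchBoundary_id] at hub hup
    refine ⟨u, hu, fun x hx => ?_, hup⟩
    obtain ⟨s, hs, hxs⟩ := exists_mem_faceSimplices hM hS i hx
    rw [hub x hx, hu0g s hs x hxs]
  choose u hu hub hup using hcell
  let vh : E 3 → ℝ := fun x => if h : ∃ i, x ∈ M.cell i then u h.choose x else 0
  have hvh : ∀ i, ∀ x ∈ M.cell i, vh x = u i x := by
    intro i x hx
    have h : ∃ i, x ∈ M.cell i := ⟨i, hx⟩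
    have hx' := h.choose_spec
    simp only [vh, dif_pos h]
    by_cases e : h.choose = i
    · rw [e]
    -- Different cells meet only in both frontiers, where both cell functions equal g.
    · rw [hub _ x (cell_inter hM _ i e hx' hx), hub i x (cell_inter hM i _ (Ne.symm e) hx hx')]
  have hvhF : ∀ j, ∀ x ∈ M.face j, vh x = w j x := by
    intro j x hx
    obtain ⟨i, hi⟩ := hM.face_of_cell j
    rw [hvh i x ((hM.cell_compact i).isClosed.frontier_subset (hi hx)), hub i x (hi hx), hg j x hx]
  refine ⟨vh, fun x hx => ?_, fun i => ?_, fun j x hx => ?_, fun j z hz hz0 => ?_,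
    fun i z hz hz0 => ?_⟩
  · refine dif_neg ?_
    rintro ⟨i, hi⟩
    exact hx (cell_subset_closure hM i hi)
  · refine (hu i).congr fun x hx => (hvh i x ?_).symm
    rwa [(cellPatch hM hS i).space_eq] at hx
  · rw [hvhF j x ((facePatch hM hS j).patchBoundary_subset hx), hwb j x hx]
  · rw [← hwp j z hz hz0]
    refine (gradInner_congr_left isOpen_interior
      (((facePatch hM hS j).memH1 (hw j)).sub (hv.face j).1) ((facePatch hM hS j).memH1 hz) ?_).symm
    intro y hy
    have hyF : y ∈ M.chart j ⁻¹' M.face j := interior_subset hy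
    simp [hvhF j _ hyF]
  · rw [← hup i z hz hz0]
    refine (gradInner_congr_left isOpen_interior
      (((hu i).memH1_cell hM hS).sub (hv.cell i).1) (hz.memH1_cell hM hS) ?_).symm
    intro y hy
    have hyK : y ∈ M.cell i := interior_subset hy
    simp [hvh i y hyK]

end

end VEM
end

noncomputable section
namespace VEM

/-! ## Functions without energy -/

namespace Patch

variable {n : ℕ} {c : E n →ᵃⁱ[ℝ] E 3} {S : Geometry.SimplicialComplex ℝ (E 3)} {A : Set (E 3)}
  (P : Patch c S A)
include P

omit P in
lemma convex_bary_pos (t : Finset (E 3)) : Convex ℝ {y : E n | ∀ a ∈ t, 0 < bary t a (c y)} := by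
  have : {y : E n | ∀ a ∈ t, 0 < bary t a (c y)} =
      ⋂ a ∈ t, ((bary t a).comp c.toAffineMap) ⁻¹' Ioi 0 := by
    ext y; simp
  rw [this]
  exact convex_iInter₂ fun a _ => (convex_Ioi 0).affine_preimage _

/-- In the open simplex the weak gradient is the classical gradient of a polynomial. It vanishes
almost everywhere, hence everywhere by continuity, and the resulting constant is the whole
polynomial. -/
lemma exists_const_of_gradInner_self_eq_zero {k : ℕ} {w : E 3 → ℝ} (hw : MacroPk k S w)
    (h : gradInner (interior (c ⁻¹' A)) (w ∘ c) (w ∘ c) = 0) {t : Finset (E 3)} (ht : t ∈ S.faces)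
    (htc : t.card = n + 1) : ∃ r, ∀ x ∈ convexHull ℝ (t : Set (E 3)), w x = r := by
  obtain ⟨p, -, hp⟩ := hw.2 t ht
  set q := compAffine p c.toAffineMap with hq
  have hwq : ∀ y, c y ∈ convexHull ℝ (t : Set (E 3)) → w (c y) = polyFun q y := fun y hy => by
    rw [hp _ hy, hq, polyFun_compAffine]
    rfl
  set O := {y : E n | ∀ a ∈ t, 0 < bary t a (c y)} with hO
  have hOo : IsOpen O := isOpen_bary_pos t
  have hOt : ∀ y ∈ O, c y ∈ convexHull ℝ (t : Set (E 3)) := fun y hy =>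
    P.mem_convexHull_of_bary_nonneg ht htc fun a ha => (hy a ha).le
  have h1 : gradient (w ∘ c) =ᵐ[volume.restrict (interior (c ⁻¹' A))] 0 :=
    ((P.piecewiseC1 hw).hasWeakGradient.weakGradient_ae_eq isOpen_interior).symm.trans
      ((P.memH1 hw).weakGradient_ae_eq_zero h)
  have h2 : fderiv ℝ (polyFun q) =ᵐ[volume.restrict O] 0 := by
    filter_upwards [ae_restrict_of_ae_restrict_of_subset (P.bary_pos_subset ht htc) h1,
      ae_restrict_mem hOo.measurableSet] with y hy hyO
    have e : w ∘ c =ᶠ[nhds y] polyFun q := by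
      filter_upwards [hOo.mem_nhds hyO] with z hz using hwq z (hOt z hz)
    rw [← e.fderiv_eq, Pi.zero_apply, ← norm_eq_zero, ← norm_gradient, hy, Pi.zero_apply, norm_zero]
  have hdiff : ContDiff ℝ 1 (polyFun q) := contDiff_polyFun q
  have h3 := Measure.eqOn_open_of_ae_eq h2 hOo
    (hdiff.continuous_fderiv one_ne_zero).continuousOn continuousOn_const
  obtain ⟨r, hr⟩ := hOo.exists_is_const_of_fderiv_eq_zero (convex_bary_pos t).isPreconnected
    (hdiff.differentiable one_ne_zero).differentiableOn h3
  have h4 : q - MvPolynomial.C r = 0 := by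
    refine eq_zero_of_polyFun_eq_zero hOo (P.exists_bary_pos ht) fun y hy => ?_
    have := hr y hy
    simp only [polyFun] at this
    simp [polyFun, this]
  refine ⟨r, fun x hx => ?_⟩
  obtain ⟨y, rfl⟩ := P.subset_range (P.convexHull_subset ht hx)
  rw [hwq y hx, sub_eq_zero.1 h4]
  simp [polyFun]

lemma hasPolyLaplacian_sub_const {d : ℤ} {v : E n → ℝ}
    (hv : HasPolyLaplacian d (interior (c ⁻¹' A)) v) (r : ℝ) :
    HasPolyLaplacian d (interior (c ⁻¹' A)) (fun y => v y - r) := by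
  obtain ⟨hH, p, hp, hlap⟩ := hv
  have hc : HasWeakGradient (interior (c ⁻¹' A)) (fun _ => r) 0 := by
    have h1 := (P.piecewiseC1 (MacroPk.const (k := 0) r)).hasWeakGradient
    have e : gradient ((fun _ : E 3 => r) ∘ c) = (0 : E n → E n) := by
      funext y
      refine norm_eq_zero.1 ?_
      rw [norm_gradient]
      have : ((fun _ : E 3 => r) ∘ c) = fun _ => r := rfl
      rw [this]
      simp
    rwa [e] at h1
  have hg : HasWeakGradient (interior (c ⁻¹' A)) (fun y => v y - r)
      (weakGradient (interior (c ⁻¹' A)) v) := by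
    have h1 := hH.hasWeakGradient.sub hc
    rwa [sub_zero] at h1
  exact ⟨hg.memH1, p, hp, hlap.congr (hg.weakGradient_ae_eq isOpen_interior).symm⟩

end Patch

section
variable {Ω : Set (E 3)} {M : MeshData} {S : Subdivision M} {k : ℕ} {v w vh wh : E 3 → ℝ}

lemma IsInterp.continuousOn (hM : M.IsMesh Ω) (hS : S.IsAdmissible) (h : IsInterp Ω S k v vh) :
    ContinuousOn vh (closure Ω) := by
  rw [← hM.cell_cover]
  refine (locallyFinite_of_finite _).continuousOn_iUnion (fun i => (hM.cell_compact i).isClosed)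
    fun i => ?_
  have := (h.macroPk i).1
  rwa [(cellPatch hM hS i).space_eq] at this

/-- Being constant on each tetrahedron, vh is a continuous function with finitely many values on a
connected set. No walk through adjacent tetrahedra is needed. -/
lemma IsInterp.exists_const (hM : M.IsMesh Ω) (hS : S.IsAdmissible) (hΩ : IsConnected Ω)
    (h : IsInterp Ω S k v vh) (h0 : ∀ i, gradInner (interior (M.cell i)) vh vh = 0) :
    ∃ r, ∀ x ∈ closure Ω, vh x = r := by
  have key : ∀ i, ∀ t : Finset (E 3), ∃ r, t ∈ (S.tet i).faces → t.card = 3 + 1 →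
      ∀ x ∈ convexHull ℝ (t : Set (E 3)), vh x = r := by
    intro i t
    by_cases ht : t ∈ (S.tet i).faces ∧ t.card = 3 + 1
    · obtain ⟨r, hr⟩ := (cellPatch hM hS i).exists_const_of_gradInner_self_eq_zero (h.macroPk i)
        (h0 i) ht.1 ht.2
      exact ⟨r, fun _ _ => hr⟩
    · exact ⟨0, fun h1 h2 => absurd ⟨h1, h2⟩ ht⟩
  choose r hr using key
  have hfin : (⋃ i, r i '' (S.tet i).faces).Finite :=
    finite_iUnion fun i => (hS.tet_triangulation i).finite.image _
  have hmaps : MapsTo vh (closure Ω) (⋃ i, r i '' (S.tet i).faces) := by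
    intro x hx
    rw [← hM.cell_cover] at hx
    obtain ⟨i, hi⟩ := mem_iUnion.1 hx
    obtain ⟨t, ht, htc, hxt⟩ := (cellPatch hM hS i).exists_simplex hi
    exact mem_iUnion.2 ⟨i, t, ht, (hr i t ht htc x hxt).symm⟩
  obtain ⟨x0, hx0⟩ := hΩ.nonempty
  exact ⟨vh x0, fun x hx => hΩ.isPreconnected.closure.constant_of_mapsTo hfin.isDiscrete
    (h.continuousOn hM hS) hmaps hx (subset_closure hx0)⟩

lemma eq_zero_of_interp_const (hM : M.IsMesh Ω) (hS : S.IsAdmissible) (hΩ : IsConnected Ω)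
    (hΩb : Bornology.IsBounded Ω) (hv : VirtualSpace Ω M k v)
    (h : IsInterp Ω S k v vh) {r : ℝ} (hr : ∀ x ∈ closure Ω, vh x = r) : v = 0 := by
  have hface : ∀ j, ∀ x ∈ M.face j, v x = r := by
    intro j x hx
    have P := facePatch hM hS j
    obtain ⟨y, rfl⟩ := P.subset_range hx
    have hL : HasPolyLaplacian ((k : ℤ) - 2) (interior (M.flatFace j))
        (fun y => v (M.chart j y) - r) := P.hasPolyLaplacian_sub_const (hv.face j) r
    refine sub_eq_zero.1 (face_eq_zero hM hS j (v := fun y => v (M.chart j y) - r) ?_ ?_ hL ?_ y hx)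
    · exact ((hv.memH10.1.mono (face_subset_closure hM j)).comp (M.chart j).continuous.continuousOn
        (mapsTo_preimage _ _)).sub continuousOn_const
    · intro z hz
      have hzb : M.chart j z ∈ M.faceBoundary j := ⟨z, hz, rfl⟩
      rw [← h.face_boundary j _ hzb,
        hr _ (face_subset_closure hM j (P.patchBoundary_subset hzb)), sub_self]
    · intro u hu hu0
      have h1 := h.face_proj j u hu hu0
      -- Since vh = r, the error vh - v is -(v - r), so the projection equations say that v - r is
      -- orthogonal to all test functions.
      have h2 := gradInner_congr_left isOpen_interior (u := (vh - v) ∘ M.chart j)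
        (v := (-1 : ℝ) • fun y => v (M.chart j y) - r) ((h.memH1_face hM hS j).sub (hv.face j).1)
        (P.memH1 hu) (fun z hz => by
          have hzF : z ∈ M.chart j ⁻¹' M.face j := interior_subset hz
          simp [hr _ (face_subset_closure hM j hzF)])
      have h3 := gradInner_smul_left isOpen_interior hL.1 (P.memH1 hu) (-1)
      exact (mul_eq_zero.1 (h3.symm.trans (h2.symm.trans h1))).resolve_left (by norm_num)
  have hcell : ∀ i, ∀ x ∈ M.cell i, v x = r := by
    intro i x hx
    have P := cellPatch hM hS i
    have hL : HasPolyLaplacian ((k : ℤ) - 2) (interior (M.cell i)) (fun y => v y - r) :=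
      P.hasPolyLaplacian_sub_const (hv.cell i) r
    refine sub_eq_zero.1 (cell_eq_zero hM hS i (v := fun y => v y - r) ?_ ?_ hL ?_ x hx)
    · exact (hv.memH10.1.mono (cell_subset_closure hM i)).sub continuousOn_const
    · intro z hz
      rw [hM.cell_frontier i] at hz
      obtain ⟨j, -, hzj⟩ := mem_iUnion₂.1 hz
      rw [hface j z hzj, sub_self]
    · intro u hu hu0
      have h1 := h.cell_proj i u hu hu0
      have h2 := gradInner_congr_left isOpen_interior (u := vh - v)
        (v := (-1 : ℝ) • fun y => v y - r) ((h.memH1_cell hM hS i).sub (hv.cell i).1)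
        (hu.memH1_cell hM hS) (fun z hz => by
          have hzF : z ∈ M.cell i := interior_subset hz
          simp [hr _ (cell_subset_closure hM i hzF)])
      rw [gradInner_smul_left isOpen_interior hL.1 (hu.memH1_cell hM hS)] at h2
      have h3 := h2.symm.trans h1
      exact (mul_eq_zero.1 h3).resolve_left (by norm_num)
  have hall : ∀ x ∈ closure Ω, v x = r := by
    intro x hx
    rw [← hM.cell_cover] at hx
    obtain ⟨i, hi⟩ := mem_iUnion.1 hx
    exact hcell i x hi
  -- A nonempty bounded set is not the whole space, so in a connected space it has a boundary point;
  -- there v = 0 forces r = 0.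
  obtain ⟨z, hz⟩ : (frontier Ω).Nonempty := by
    refine nonempty_frontier_iff.2 ⟨hΩ.nonempty, ?_⟩
    rintro rfl
    exact NormedSpace.unbounded_univ ℝ (E 3) hΩb
  have hr0 : r = 0 := by rw [← hall z hz.1, hv.memH10.2.2 z hz]
  ext x
  by_cases hx : x ∈ closure Ω
  · rw [hall x hx, hr0]; rfl
  · exact hv.eq_zero x hx

/-! ## The virtual element space -/

lemma DegLE.add {n : ℕ} {d : ℤ} {p q : MvPolynomial (Fin n) ℝ} (hp : DegLE d p) (hq : DegLE d q) :
    DegLE d (p + q) := by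
  rcases hp with rfl | hp
  · rwa [zero_add]
  rcases hq with rfl | hq
  · rw [add_zero]; exact Or.inr hp
  refine Or.inr ?_
  have h : ((p + q).totalDegree : ℤ) ≤ max (p.totalDegree : ℤ) q.totalDegree := by
    exact_mod_cast MvPolynomial.totalDegree_add p q
  exact h.trans (max_le hp hq)

lemma DegLE.smul {n : ℕ} {d : ℤ} {p : MvPolynomial (Fin n) ℝ} (hp : DegLE d p) (r : ℝ) :
    DegLE d (r • p) := by
  rcases hp with rfl | hp
  · rw [smul_zero]; exact Or.inl rfl
  · refine Or.inr (le_trans ?_ hp)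
    exact_mod_cast MvPolynomial.totalDegree_smul_le r p

lemma HasPolyLaplacian.add {n : ℕ} {d : ℤ} {U : Set (E n)} (hU : IsOpen U) {v w : E n → ℝ}
    (hv : HasPolyLaplacian d U v) (hw : HasPolyLaplacian d U w) : HasPolyLaplacian d U (v + w) := by
  obtain ⟨hv, p, hp, hp'⟩ := hv
  obtain ⟨hw, q, hq, hq'⟩ := hw
  refine ⟨hv.add hw, p + q, hp.add hq, ?_⟩
  have e : polyFun (p + q) = polyFun p + polyFun q := by ext x; simp [polyFun]
  rw [e]
  exact hp'.add hU hv hw (continuous_polyFun p) (continuous_polyFun q) hq'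

lemma HasPolyLaplacian.smul {n : ℕ} {d : ℤ} {U : Set (E n)} (hU : IsOpen U) {v : E n → ℝ}
    (hv : HasPolyLaplacian d U v) (r : ℝ) : HasPolyLaplacian d U (r • v) := by
  obtain ⟨hv, p, hp, hp'⟩ := hv
  refine ⟨hv.smul r, r • p, hp.smul r, ?_⟩
  have e : polyFun (r • p) = r • polyFun p := by ext x; simp [polyFun]
  rw [e]
  exact hp'.smul hU hv r

lemma hasWeakGradient_zero {n : ℕ} (U : Set (E n)) : HasWeakGradient U 0 0 :=
  ⟨MemLp.zero, MemLp.zero, fun φ _ => by simp⟩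

lemma hasPolyLaplacian_zero {n : ℕ} {d : ℤ} {U : Set (E n)} (hU : IsOpen U) :
    HasPolyLaplacian d U 0 := by
  refine ⟨(hasWeakGradient_zero U).memH1, 0, Or.inl rfl, fun φ _ => ?_⟩
  have h1 : ∫ x in U, inner ℝ (weakGradient U 0 x) (gradient φ x) = 0 := by
    refine integral_eq_zero_of_ae ?_
    filter_upwards [(hasWeakGradient_zero U).weakGradient_ae_eq hU] with x hx
    rw [hx]; simp
  rw [h1]
  simp [polyFun]

variable (Ω M k) in
/-- The virtual element space as a vector space. -/
def virtualSubmodule : Submodule ℝ (E 3 → ℝ) where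
  carrier := {v | VirtualSpace Ω M k v}
  add_mem' := fun {u v} hu hv =>
    { eq_zero := fun x hx => by simp [hu.eq_zero x hx, hv.eq_zero x hx]
      memH10 := ⟨hu.memH10.1.add hv.memH10.1, hu.memH10.2.1.add hv.memH10.2.1, fun x hx => by
        simp [hu.memH10.2.2 x hx, hv.memH10.2.2 x hx]⟩
      edge := fun e he => (hu.edge e he).add (hv.edge e he)
      face := fun j => (hu.face j).add isOpen_interior (hv.face j)
      cell := fun i => (hu.cell i).add isOpen_interior (hv.cell i) }
  zero_mem' :=
    { eq_zero := fun x hx => rfl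
      memH10 := ⟨continuousOn_const, (hasWeakGradient_zero Ω).memH1, fun x hx => rfl⟩
      edge := fun e he => IsPolyOn.const 0
      face := fun j => hasPolyLaplacian_zero isOpen_interior
      cell := fun i => hasPolyLaplacian_zero isOpen_interior }
  smul_mem' := fun r u hu =>
    { eq_zero := fun x hx => by simp [hu.eq_zero x hx]
      memH10 := ⟨hu.memH10.1.const_smul r, hu.memH10.2.1.smul r, fun x hx => by
        simp [hu.memH10.2.2 x hx]⟩
      edge := fun e he => (hu.edge e he).smul r
      face := fun j => (hu.face j).smul isOpen_interior r
      cell := fun i => (hu.cell i).smul isOpen_interior r }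

/-- The interpolation as a linear map. -/
lemma exists_interpLinear (hM : M.IsMesh Ω) (hS : S.IsAdmissible) (hk : 1 ≤ k) :
    ∃ I : virtualSubmodule Ω M k →ₗ[ℝ] (E 3 → ℝ),
      ∀ v : virtualSubmodule Ω M k, IsInterp Ω S k v (I v) := by
  choose I hI using fun v : virtualSubmodule Ω M k => exists_isInterp hM hS hk v.2
  exact ⟨{ toFun := I
           map_add' := fun u v => (hI (u + v)).eq hM hS (u + v).2
            ((hI u).add hM hS u.2 v.2 (hI v))
           map_smul' := fun r u => (hI (r • u)).eq hM hS (r • u).2 ((hI u).smul hM hS u.2 r) }, hI⟩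

/-- The interpolation embeds the virtual space into piecewise polynomials: a zero interpolant is the
case r = 0 of `eq_zero_of_interp_const`. -/
lemma finiteDimensional_virtualSubmodule (hM : M.IsMesh Ω) (hS : S.IsAdmissible) (hΩ : IsConnected Ω)
    (hΩb : Bornology.IsBounded Ω) (hk : 1 ≤ k) :
    FiniteDimensional ℝ (virtualSubmodule Ω M k) := by
  obtain ⟨I, hI⟩ := exists_interpLinear hM hS hk
  set J : Set (Set (E 3)) :=
    ⋃ i, (fun s : Finset (E 3) => convexHull ℝ (s : Set (E 3))) '' (S.tet i).faces with hJ
  have hJf : J.Finite := finite_iUnion fun i => (hS.tet_triangulation i).finite.image _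
  have := finiteDimensional_polySubmodule 3 k hJf
  have hmem : ∀ v, I v ∈ polySubmodule 3 k J := by
    refine fun v => ⟨fun B hB => ?_, fun x hx => (hI v).eq_zero x fun hxΩ => hx ?_⟩
    · obtain ⟨i, s, hs, rfl⟩ := mem_iUnion.1 hB
      exact ((hI v).macroPk i).2 s hs
    · rw [← hM.cell_cover] at hxΩ
      obtain ⟨i, hi⟩ := mem_iUnion.1 hxΩ
      obtain ⟨t, ht, -, hxt⟩ := (cellPatch hM hS i).exists_simplex hi
      exact ⟨_, mem_iUnion.2 ⟨i, t, ht, rfl⟩, hxt⟩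
  refine Module.Finite.of_injective (I.codRestrict _ hmem)
    ((injective_iff_map_eq_zero _).2 fun v hv => ?_)
  have hv0 : I v = 0 := congrArg Subtype.val hv
  refine Subtype.ext (eq_zero_of_interp_const hM hS hΩ hΩb v.2 (hI v) (r := 0) fun x _ => ?_)
  rw [hv0]; rfl

/-- The stabilizer-free virtual element equation has exactly one solution. -/
theorem existsUnique_solution (hM : M.IsMesh Ω) (hS : S.IsAdmissible) (hΩo : IsOpen Ω)
    (hΩ : IsConnected Ω) (hΩb : Bornology.IsBounded Ω) (hk : 1 ≤ k) {f : E 3 → ℝ}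
    (hf : MemLp f 2 (volume.restrict Ω)) :
    ∃ u uh : E 3 → ℝ, IsSolution Ω S k f u uh ∧
      ∀ u' uh', IsSolution Ω S k f u' uh' → u' = u ∧ uh' = uh := by
  obtain ⟨I, hI⟩ := exists_interpLinear hM hS hk
  have hH : ∀ (i) (v : virtualSubmodule Ω M k), MemH1 (interior (M.cell i)) (I v) :=
    fun i v => (hI v).memH1_cell hM hS i
  have := finiteDimensional_virtualSubmodule hM hS hΩ hΩb hk
  let B : virtualSubmodule Ω M k →ₗ[ℝ] virtualSubmodule Ω M k →ₗ[ℝ] ℝ :=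
    LinearMap.mk₂ ℝ (fun u v => brokenInner M (I u) (I v))
      (fun u u' v => by
        simp only [brokenInner, map_add, ← Finset.sum_add_distrib]
        exact Finset.sum_congr rfl fun i _ =>
          gradInner_add_left isOpen_interior (hH i u) (hH i u') (hH i v))
      (fun r u v => by
        simp only [brokenInner, map_smul, smul_eq_mul, Finset.mul_sum]
        exact Finset.sum_congr rfl fun i _ =>
          gradInner_smul_left isOpen_interior (hH i u) (hH i v) r)
      (fun u v v' => by
        simp only [brokenInner, map_add, ← Finset.sum_add_distrib]
        exact Finset.sum_congr rfl fun i _ =>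
          gradInner_add_right isOpen_interior (hH i v) (hH i v') (hH i u))
      (fun r u v => by
        simp only [brokenInner, map_smul, smul_eq_mul, Finset.mul_sum]
        exact Finset.sum_congr rfl fun i _ =>
          gradInner_smul_right isOpen_interior (hH i v) (hH i u) r)
  have hfI : ∀ v, Integrable (fun x => f x * I v x) (volume.restrict Ω) := by
    intro v
    refine integrable_smul_of_memLp hf ?_
    have hcpt : IsCompact (closure Ω) := hΩb.isCompact_closure
    have hfin : IsFiniteMeasure (volume.restrict Ω) :=
      ⟨by simpa using hΩb.measure_lt_top⟩
    obtain ⟨C, hC⟩ := hcpt.exists_bound_of_continuousOn ((hI v).continuousOn hM hS)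
    refine MemLp.of_bound ((((hI v).continuousOn hM hS).mono
      subset_closure).aestronglyMeasurable hΩo.measurableSet) C ?_
    filter_upwards [ae_restrict_mem hΩo.measurableSet] with x hx
    exact hC x (subset_closure hx)
  let l : virtualSubmodule Ω M k →ₗ[ℝ] ℝ :=
    { toFun := fun v => ∫ x in Ω, f x * I v x
      map_add' := fun u v => by
        rw [← integral_add (hfI u) (hfI v)]
        simp only [map_add, Pi.add_apply, mul_add]
      map_smul' := fun r u => by
        rw [RingHom.id_apply, smul_eq_mul, ← integral_const_mul]
        simp only [map_smul, Pi.smul_apply, smul_eq_mul, mul_left_comm] }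
  -- Each cell energy is nonnegative, so all vanish. The interpolant is then constant, and the
  -- virtual function behind it is zero.
  have hB : ∀ v, B v v = 0 → v = 0 := by
    intro v hv
    have hsum : ∑ i, gradInner (interior (M.cell i)) (I v) (I v) = 0 := hv
    have h0 : ∀ i, gradInner (interior (M.cell i)) (I v) (I v) = 0 := fun i =>
      (Finset.sum_eq_zero_iff_of_nonneg (f := fun i => gradInner (interior (M.cell i)) (I v) (I v))
        fun i _ => gradInner_self_nonneg _).1 hsum i (Finset.mem_univ i)
    obtain ⟨r, hr⟩ := (hI v).exists_const hM hS hΩ h0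
    exact Subtype.ext (eq_zero_of_interp_const hM hS hΩ hΩb v.2 (hI v) hr)
  obtain ⟨u, hu, huniq⟩ := existsUnique_of_definite B hB l
  refine ⟨u, I u, ⟨u.2, hI u, fun v vh hv hvh => ?_⟩, fun u' uh' h => ?_⟩
  · rw [hvh.eq hM hS hv (hI ⟨v, hv⟩)]
    exact hu ⟨v, hv⟩
  · have h1 := huniq ⟨u', h.mem⟩ fun v => by
      have := h.eqn v (I v) v.2 (hI v)
      rwa [h.interp.eq hM hS h.mem (hI ⟨u', h.mem⟩)] at this
    have h2 : u' = u := congrArg Subtype.val h1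
    refine ⟨h2, h.interp.eq hM hS h.mem ?_⟩
    rw [h2]
    exact hI u

end

end VEM
end

theorem lemma3p2 (Ω : Set (VEM.E 3)) (hΩ_open : IsOpen Ω) (hΩ_conn : IsConnected Ω)
    (hΩ_bdd : Bornology.IsBounded Ω) (hΩ_reg : interior (closure Ω) = Ω)
    (M : VEM.MeshData) (hM : M.IsMesh Ω)
    (S : VEM.Subdivision M) (hS : S.IsAdmissible)
    (k : ℕ) (hk : 1 ≤ k)
    (f : VEM.E 3 → ℝ) (hf : MemLp f 2 (volume.restrict Ω)) :
    (∀ v : VEM.E 3 → ℝ, VEM.VirtualSpace Ω M k v → ∃! vh : VEM.E 3 → ℝ, VEM.IsInterp Ω S k v vh) ∧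
    (∃! u : VEM.E 3 → ℝ, ∃ uh : VEM.E 3 → ℝ, VEM.IsSolution Ω S k f u uh) ∧
    (∃! uh : VEM.E 3 → ℝ, ∃ u : VEM.E 3 → ℝ, VEM.IsSolution Ω S k f u uh) := by
  obtain ⟨u, uh, h, huniq⟩ := VEM.existsUnique_solution hM hS hΩ_open hΩ_conn hΩ_bdd hk hf
  refine ⟨fun v hv => ?_, ⟨u, ⟨uh, h⟩, fun u' ⟨uh', h'⟩ => (huniq u' uh' h').1⟩,
    ⟨uh, ⟨u, h⟩, fun uh' ⟨u', h'⟩ => (huniq u' uh' h').2⟩⟩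
  obtain ⟨vh, hvh⟩ := VEM.exists_isInterp hM hS hk hv
  exact ⟨vh, hvh, fun wh hwh => hwh.eq hM hS hv hvh⟩
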